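/- Let $\mathbb E^4_2$ be $\mathbb R^4$ with the metric $\langle\cdot,\cdot\rangle=-dx_1^2-dx_2^2+dx_3^2+dx_4^2$ and let $\mathcal{LC}=\{x:\langle x,x\rangle=0\}$. A vector is light-like if it is non-zero and lies in $\mathcal{LC}$; a curve is light-like if its velocity is light-like at every parameter. A surface in $\mathbb E^4_2$ is a smooth map $f:M\to\mathbb E^4_2$ from a smooth $2$-manifold whose induced metric is non-degenerate; $K$ is the Gaussian curvature of this metric, $\alpha_f$ the second fundamental form and $H=\frac12\operatorname{trace}\alpha_f$ the mean curvature vector. The surface is quasi-minimal if $H$ is light-like at every point, and biharmonic if its bitension field $\tau_2=-\Delta\tau$, $\tau=-\operatorname{trace}\nabla df$, $\Delta=-\operatorname{trace}(\nabla\nabla-\nabla_\nabla)$, vanishes. Consider the following families of parametrized surfaces. (i) $F(s,t)=\big(\psi(s,t),\frac{s-t}{\sqrt2},\frac{s+t}{\sqrt2},\psi(s,t)\big)$, $(s,t)\in U$, where $U\subset\mathbb R^2$ is open and $\psi:U\to\mathbb R$ is a smooth function such that $F_{st}\ne0$ everywhere and $F_{sstt}=0$. (ii) $F(s,t)=z(s)t+w(s)$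 on a product $I\times J$ of open intervals, where $z$ is a light-like curve in $\mathcal{LC}$ and $w$ is a light-like curve with $\langle z',w'\rangle=0$ and $\langle z,w'\rangle=-1$ (all smooth). (iii) $F(s,t)=\eta(t)+\big(s\,a'(t)-a(t)(m(s,t)+s\,L(t))\big)\alpha(t)+s\,a(t)\,\alpha'(t)$ on a product $I\times J$ of open intervals, where: $m\in C^\infty(I\times J)$; the metric $g_m=-(ds\otimes dt+dt\otimes ds)+2m\,dt\otimes dt$ has nowhere vanishing Gaussian curvature $K$, and $L=-\frac{K_t+mK_s+3m_sK}{K}$ depends on $t$ only; $a\in C^\infty(J)$ has no zeros; $\alpha:J\to\mathcal{LC}$ is a smooth light-like curve with $\alpha(t),\alpha'(t)$ linearly independent for all $t$; $\eta:J\to\mathbb E^4_2$ is smooth with $\langle\eta',\eta'\rangle=0$, $\langle\alpha,\eta'\rangle=0$, $\langle\eta',\alpha'\rangle=-\frac1a$, $\langle\eta',\alpha''\rangle=\frac{2a'-aL}{a^2}$; and $F_{st}+m_sF_s+mF_{ss}\neq0$ everywhere (that is, the mean curvature vector of $F$, which equals $-(F_{st}+m_sF_s+mF_{ss})$, does not vanish).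 We say that $f:M\to\mathbb E^4_2$ is locally congruent at $p\in M$ to a surface of one of these families if, for suitable local coordinates around $p$ and some isometry $T$ of $\mathbb E^4_2$, the map $T\circ f$ in these coordinates is a member $F$ of the family (the range of the coordinates being the domain of $F$). **Theorem.** Let $f:M\to\mathbb E^4_2$ be a map from a smooth $2$-manifold. (A) $f$ is locally congruent at every point of $M$ to a surface of one of the families (i), (ii), (iii) if and only if $f$ is a quasi-minimal biharmonic surface for which every point of $M$ either satisfies $K\neq0$ or has a neighbourhood on which $K\equiv0$. (B) If $f$ is any quasi-minimal biharmonic surface, then at every point that has a neighbourhood on which $K\equiv 0$ it is locally congruent to a surface of the family (i) or (ii), and at every point with $K\ne0$ it is locally congruent to a surface of the family (iii). These points together form an open dense subset of $M$. -/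

import Mathlib

open scoped Manifold ContDiff

noncomputable section

namespace QuasiMinimal

/-! ### The pseudo-Euclidean space of dimension 4 and index 2 -/

/-- The underlying vector space of the pseudo-Euclidean space `E^4_2`; only its topology and its
linear structure are used, the metric is `ip`. -/
abbrev E42 : Type := Fin 4 → ℝ

/-- The neutral metric `-dx₁² - dx₂² + dx₃² + dx₄²`. -/
def ip (x y : E42) : ℝ := -(x 0 * y 0) - x 1 * y 1 + x 2 * y 2 + x 3 * y 3

/-- Light-like vectors: non-zero null vectors. -/
def IsLightLike (x : E42) : Prop := x ≠ 0 ∧ ip x x = 0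

/-- The light cone. -/
def lightCone : Set E42 := {x | ip x x = 0}

/-- The (affine) isometries of `E^4_2`. -/
def IsIsometry (T : E42 ≃ᵃ[ℝ] E42) : Prop := ∀ x y, ip (T.linear x) (T.linear y) = ip x y

/-! ### Two-dimensional semi-Riemannian geometry in coordinates

Indices run over `Fin 2`; index `0` stands for the coordinate `s`, index `1` for `t`. -/

/-- The coordinate vector fields of the plane. -/
def coordVec (i : Fin 2) : ℝ × ℝ := if i = 0 then (1, 0) else (0, 1)

/-- Partial derivative in the `i`-th coordinate. -/
def pd {V : Type*} [NormedAddCommGroup V] [NormedSpace ℝ V] (i : Fin 2) (F : ℝ × ℝ → V)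
    (q : ℝ × ℝ) : V := fderiv ℝ F q (coordVec i)

/-- Christoffel symbols `Γᵏᵢⱼ` of the Levi-Civita connection of the metric `g`. -/
def christoffel (g : ℝ × ℝ → Matrix (Fin 2) (Fin 2) ℝ) (k i j : Fin 2) (q : ℝ × ℝ) : ℝ :=
  (1 / 2) * ∑ l, (g q)⁻¹ k l *
    (pd i (fun x => g x j l) q + pd j (fun x => g x i l) q - pd l (fun x => g x i j) q)

/-- Components of the curvature tensor: `R(∂ᵢ, ∂ⱼ) ∂ₖ = ∑ₗ (riemann g l k i j) ∂ₗ`, where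
`R(X, Y) = ∇_X ∇_Y - ∇_Y ∇_X - ∇_[X,Y]`. -/
def riemann (g : ℝ × ℝ → Matrix (Fin 2) (Fin 2) ℝ) (l k i j : Fin 2) (q : ℝ × ℝ) : ℝ :=
  pd i (christoffel g l j k) q - pd j (christoffel g l i k) q
    + ∑ n, (christoffel g l i n q * christoffel g n j k q
      - christoffel g l j n q * christoffel g n i k q)

/-- The Gaussian curvature `⟨R(∂ₛ, ∂ₜ)∂ₜ, ∂ₛ⟩ / (⟨∂ₛ, ∂ₛ⟩⟨∂ₜ, ∂ₜ⟩ - ⟨∂ₛ, ∂ₜ⟩²)` of `g`. -/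
def metricGaussCurvature (g : ℝ × ℝ → Matrix (Fin 2) (Fin 2) ℝ) (q : ℝ × ℝ) : ℝ :=
  (∑ l, riemann g l 1 0 1 q * g q l 0) / (g q).det

/-- The metric induced by a parametrized surface `F`. -/
def inducedMetric (F : ℝ × ℝ → E42) (q : ℝ × ℝ) : Matrix (Fin 2) (Fin 2) ℝ :=
  Matrix.of fun i j => ip (pd i F q) (pd j F q)

/-- The second covariant derivative `∂ᵢ∂ⱼ V - Γᵏᵢⱼ ∂ₖ V` of an `E^4_2`-valued function `V` with
respect to the metric `g` (sections of the pull-back of the tangent bundle of the flat space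
`E^4_2` are `E^4_2`-valued functions, and the pull-back connection is the ordinary derivative). -/
def secondCovDeriv (g : ℝ × ℝ → Matrix (Fin 2) (Fin 2) ℝ) (V : ℝ × ℝ → E42) (i j : Fin 2)
    (q : ℝ × ℝ) : E42 :=
  pd i (pd j V) q - ∑ k, christoffel g k i j q • pd k V q

/-- The second fundamental form, by the Gauss formula
`α(∂ᵢ, ∂ⱼ) = ∂ᵢ∂ⱼF - dF(∇_{∂ᵢ}∂ⱼ)`. -/
def secondFundForm (F : ℝ × ℝ → E42) (i j : Fin 2) (q : ℝ × ℝ) : E42 :=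
  secondCovDeriv (inducedMetric F) F i j q

/-- The mean curvature vector `H = (1/2) trace α`. -/
def meanCurvature (F : ℝ × ℝ → E42) (q : ℝ × ℝ) : E42 :=
  (1 / 2 : ℝ) • ∑ i, ∑ j, (inducedMetric F q)⁻¹ i j • secondFundForm F i j q

/-- The rough Laplacian `Δ = -trace (∇∇ - ∇_∇)` along `F`. -/
def roughLaplacian (F V : ℝ × ℝ → E42) (q : ℝ × ℝ) : E42 :=
  -∑ i, ∑ j, (inducedMetric F q)⁻¹ i j • secondCovDeriv (inducedMetric F) V i j q

/-- The tension field `τ = -trace ∇dF`. -/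
def tension (F : ℝ × ℝ → E42) (q : ℝ × ℝ) : E42 :=
  -∑ i, ∑ j, (inducedMetric F q)⁻¹ i j • secondCovDeriv (inducedMetric F) F i j q

/-- The bitension field `τ₂ = -Δτ`; the curvature term of the ambient space vanishes because
`E^4_2` is flat. -/
def bitension (F : ℝ × ℝ → E42) (q : ℝ × ℝ) : E42 := -roughLaplacian F (tension F) q

/-! ### Immersed surfaces -/

section Surface

variable {M : Type*} [TopologicalSpace M] [ChartedSpace (ℝ × ℝ) M]

/-- The local coordinate systems of the smooth two-dimensional manifold `M`. -/
def coordSystems (M : Type*) [TopologicalSpace M] [ChartedSpace (ℝ × ℝ) M] :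
    Set (OpenPartialHomeomorph M (ℝ × ℝ)) :=
  IsManifold.maximalAtlas 𝓘(ℝ, ℝ × ℝ) ∞ M

/-- `f : M → E^4_2` is a semi-Riemannian immersed surface: it is smooth and the induced metric is
non-degenerate (in particular `f` is an immersion). -/
def IsSurface (f : M → E42) : Prop :=
  ContMDiff 𝓘(ℝ, ℝ × ℝ) 𝓘(ℝ, E42) ∞ f ∧
    ∀ e ∈ coordSystems M, ∀ q ∈ e.target, (inducedMetric (f ∘ e.symm) q).det ≠ 0

/-- The mean curvature vector is light-like at every point. -/
def IsQuasiMinimal (f : M → E42) : Prop :=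
  ∀ e ∈ coordSystems M, ∀ q ∈ e.target, IsLightLike (meanCurvature (f ∘ e.symm) q)

/-- The bitension field vanishes identically. -/
def IsBiharmonic (f : M → E42) : Prop :=
  ∀ e ∈ coordSystems M, ∀ q ∈ e.target, bitension (f ∘ e.symm) q = 0

/-- The Gaussian curvature at `p` of the metric induced by `f` (computed in the preferred chart
at `p`; it does not depend on the chart). -/
def gaussCurvature (f : M → E42) (p : M) : ℝ :=
  metricGaussCurvature (inducedMetric (f ∘ (chartAt (ℝ × ℝ) p).symm)) (chartAt (ℝ × ℝ) p p)

/-- Near `p` the surface `f` is congruent to a member of the class `P` of parametrized surfaces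
(pairs of a parameter domain and a map): there are local coordinates of `M` around `p` whose
range is the parameter domain `D`, and an isometry `T` of `E^4_2`, such that `T ∘ f` in these
coordinates is the map `F` on `D`. -/
def LocallyCongruent (P : Set (ℝ × ℝ) → (ℝ × ℝ → E42) → Prop) (f : M → E42) (p : M) : Prop :=
  ∃ e ∈ coordSystems M, p ∈ e.source ∧
    ∃ T : E42 ≃ᵃ[ℝ] E42, IsIsometry T ∧
      ∃ F : ℝ × ℝ → E42, P e.target F ∧ ∀ q ∈ e.target, T (f (e.symm q)) = F q

end Surface

/-! ### The three families -/

/-- `J` is an open interval (possibly unbounded). -/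
def IsOpenInterval (J : Set ℝ) : Prop := IsOpen J ∧ J.OrdConnected

/-- `F(s,t) = (ψ, (s-t)/√2, (s+t)/√2, ψ)` on an open set `D`, with `Fₛₜ ≠ 0`, `Fₛₛₜₜ = 0`. -/
def IsGraphType (D : Set (ℝ × ℝ)) (F : ℝ × ℝ → E42) : Prop :=
  IsOpen D ∧ ∃ ψ : ℝ × ℝ → ℝ, ContDiffOn ℝ ∞ ψ D ∧
    ∀ q ∈ D, F q = ![ψ q, (q.1 - q.2) / √2, (q.1 + q.2) / √2, ψ q] ∧
      pd 1 (pd 0 F) q ≠ 0 ∧ pd 1 (pd 1 (pd 0 (pd 0 F))) q = 0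

/-- `F(s,t) = t z(s) + w(s)`, where `z` is a light-like curve in the light cone and `w` is a
light-like curve with `⟨z', w'⟩ = 0` and `⟨z, w'⟩ = -1`. -/
def IsRuledType (D : Set (ℝ × ℝ)) (F : ℝ × ℝ → E42) : Prop :=
  ∃ I J : Set ℝ, IsOpenInterval I ∧ IsOpenInterval J ∧ D = I ×ˢ J ∧
    ∃ z w : ℝ → E42, ContDiffOn ℝ ∞ z I ∧ ContDiffOn ℝ ∞ w I ∧
      (∀ s ∈ I, z s ∈ lightCone ∧ IsLightLike (deriv z s) ∧ IsLightLike (deriv w s) ∧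
        ip (deriv z s) (deriv w s) = 0 ∧ ip (z s) (deriv w s) = -1) ∧
      ∀ q ∈ D, F q = q.2 • z q.1 + w q.1

/-- The metric `g_m = -(ds ⊗ dt + dt ⊗ ds) + 2 m dt ⊗ dt`. -/
def semiGeodesicMetric (m : ℝ × ℝ → ℝ) (q : ℝ × ℝ) : Matrix (Fin 2) (Fin 2) ℝ :=
  !![0, -1; -1, 2 * m q]

/-- The function `L = -(Kₜ + m Kₛ + 3 mₛ K) / K`, where `K` is the Gaussian curvature of `g_m`. -/
def intrinsicL (m : ℝ × ℝ → ℝ) (q : ℝ × ℝ) : ℝ :=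
  -(pd 1 (metricGaussCurvature (semiGeodesicMetric m)) q
      + m q * pd 0 (metricGaussCurvature (semiGeodesicMetric m)) q
      + 3 * pd 0 m q * metricGaussCurvature (semiGeodesicMetric m) q)
    / metricGaussCurvature (semiGeodesicMetric m) q

/-- The non-flat family
`F(s,t) = η(t) + (s a'(t) - a(t) (m(s,t) + s L(t))) α(t) + s a(t) α'(t)` on `D = I × J`.
The last condition says that the mean curvature vector `-(Fₛₜ + mₛ Fₛ + m Fₛₛ)` of `F` does not
vanish. -/
def IsNonFlatType (D : Set (ℝ × ℝ)) (F : ℝ × ℝ → E42) : Prop :=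
  ∃ I J : Set ℝ, IsOpenInterval I ∧ IsOpenInterval J ∧ D = I ×ˢ J ∧
    ∃ (m : ℝ × ℝ → ℝ) (L a : ℝ → ℝ) (α η : ℝ → E42),
      ContDiffOn ℝ ∞ m D ∧ ContDiffOn ℝ ∞ a J ∧ ContDiffOn ℝ ∞ α J ∧ ContDiffOn ℝ ∞ η J ∧
      (∀ q ∈ D, metricGaussCurvature (semiGeodesicMetric m) q ≠ 0 ∧ intrinsicL m q = L q.2) ∧
      (∀ t ∈ J, a t ≠ 0 ∧
        α t ∈ lightCone ∧ IsLightLike (deriv α t) ∧ LinearIndependent ℝ ![α t, deriv α t] ∧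
        ip (deriv η t) (deriv η t) = 0 ∧ ip (α t) (deriv η t) = 0 ∧
        ip (deriv η t) (deriv α t) = -(1 / a t) ∧
        ip (deriv η t) (deriv (deriv α) t) = (2 * deriv a t - a t * L t) / a t ^ 2) ∧
      (∀ q ∈ D, F q = η q.2 + (q.1 * deriv a q.2 - a q.2 * (m q + q.1 * L q.2)) • α q.2
        + (q.1 * a q.2) • deriv α q.2) ∧
      ∀ q ∈ D, pd 1 (pd 0 F) q + pd 0 m q • pd 0 F q + m q • pd 0 (pd 0 F) q ≠ 0

end QuasiMinimal

end

/-!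
The surface is written in null coordinates `(u, v)`.

Since the mean curvature vector `H` is a light-like normal vector, the tangent planes are
indefinite (`IsQMBiharmonicOn.det_neg`), so locally there are coordinates with light-like coordinate
lines (`IsQMBiharmonicOn.exists_null_coordinates`). With `φ = ⟨F_u, F_v⟩` one has `F_uv = φ H`, and
the surface is biharmonic if and only if `H_uv = 0`. Totally isotropic subspaces of `E^4_2` have
dimension at most two; hence `H_u`, which is orthogonal to `F_v` and `H`, lies in the plane spanned
by `F_v` and `H`, and likewise for `H_v`. It follows that `⟨H, F_uu⟩ ⟨H, F_vv⟩ = 0`, that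
`⟨H, F_uu⟩` depends on `u` only and `⟨H, F_vv⟩` on `v` only, and that `H_u = 0` wherever
`⟨H, F_vv⟩ ≠ 0`. As `H_u` does not depend on `v`, there are three cases.

* `⟨H, F_uu⟩` and `⟨H, F_vv⟩` vanish identically. Then `H` has a constant direction, and the surface
  belongs to the graph family (`IsNullParametrized.coordCongruent_isGraphType`).
* `⟨H, F_vv⟩` does not vanish identically. Then `H = H(v)`, and `F_u / φ` moves along the lines
  `v = const` in the direction of `H`, with a speed proportional to the Gaussian curvature `K`. An
  affine parameter `s` on these null geodesics gives semi-geodesic coordinates `(s, t)` in which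
  `F_ss` is a multiple of `H = H(t)` (`IsNullParametrized.exists_adapted`). If `K = 0`, then
  `F_ss = 0` and the surface belongs to the ruled family (`IsAdapted.isRuledType`). If `K ≠ 0`, the
  `s`-derivative of the formula for `H` expresses `F_s` by `H(t)` and `H'(t)`, and an integration in
  `s` leads to the non-flat family with `α = H` (`IsAdapted.isNonFlatType`).
* `⟨H, F_uu⟩` does not vanish identically: interchange `u` and `v`.

That the members of the three families are quasi-minimal and biharmonic is a computation. Both
directions are transported between charts by the invariance of `H`, of the bitension field and of
`K` under changes of coordinates; for `K` this comes from the Gauss equation.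
-/


noncomputable section
namespace QuasiMinimal

/-! ### The scalar product -/

lemma ip_comm (x y : E42) : ip x y = ip y x := by simp only [ip]; ring
lemma ip_add_left (x y z : E42) : ip (x + y) z = ip x z + ip y z := by
  simp only [ip, Pi.add_apply]; ring
lemma ip_add_right (x y z : E42) : ip x (y + z) = ip x y + ip x z := by
  simp only [ip, Pi.add_apply]; ring
lemma ip_sub_left (x y z : E42) : ip (x - y) z = ip x z - ip y z := by
  simp only [ip, Pi.sub_apply]; ring
lemma ip_sub_right (x y z : E42) : ip x (y - z) = ip x y - ip x z := by
  simp only [ip, Pi.sub_apply]; ring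
lemma ip_neg_left (x y : E42) : ip (-x) y = -ip x y := by
  simp only [ip, Pi.neg_apply]; ring
lemma ip_neg_right (x y : E42) : ip x (-y) = -ip x y := by
  simp only [ip, Pi.neg_apply]; ring
lemma ip_smul_left (c : ℝ) (x y : E42) : ip (c • x) y = c * ip x y := by
  simp only [ip, Pi.smul_apply, smul_eq_mul]; ring
lemma ip_smul_right (c : ℝ) (x y : E42) : ip x (c • y) = c * ip x y := by
  simp only [ip, Pi.smul_apply, smul_eq_mul]; ring
lemma ip_zero_left (x : E42) : ip 0 x = 0 := by simp [ip]
lemma ip_zero_right (x : E42) : ip x 0 = 0 := by simp [ip]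

/-- The scalar product as a bilinear form. -/
def ipForm : LinearMap.BilinForm ℝ E42 :=
  LinearMap.mk₂ ℝ ip ip_add_left ip_smul_left ip_add_right ip_smul_right

lemma eq_zero_of_ip {x : E42} (h : ∀ y, ip x y = 0) : x = 0 := by
  have h0 := h (Pi.single 0 1)
  have h1 := h (Pi.single 1 1)
  have h2 := h (Pi.single 2 1)
  have h3 := h (Pi.single 3 1)
  simp [ip] at h0 h1 h2 h3
  ext i; fin_cases i <;> simp [h0, h1, h2, h3]

lemma ipForm_nondegenerate : ipForm.Nondegenerate :=
  ⟨fun _ h => eq_zero_of_ip h, fun x h => eq_zero_of_ip fun y => by rw [ip_comm]; exact h y⟩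

/-- The span of two independent null vectors that are orthogonal to each other is its own
orthogonal complement. -/
lemma exists_eq_smul_add_smul {x y z : E42} (hli : LinearIndependent ℝ ![x, y])
    (hxx : ip x x = 0) (hxy : ip x y = 0) (hyy : ip y y = 0) (hzx : ip z x = 0)
    (hzy : ip z y = 0) : ∃ a b : ℝ, z = a • x + b • y := by
  set W : Submodule ℝ E42 := Submodule.span ℝ (Set.range ![x, y]) with hW
  have hWr : Module.finrank ℝ W = 2 := by
    have := finrank_span_eq_card hli
    simpa using this
  have hmem : ∀ v : E42, ip v x = 0 → ip v y = 0 → v ∈ ipForm.orthogonal W := by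
    intro v hx hy
    rw [LinearMap.BilinForm.mem_orthogonal_iff]
    intro n hn
    change ip n v = 0
    rw [hW, Submodule.mem_span_range_iff_exists_fun] at hn
    obtain ⟨c, rfl⟩ := hn
    simp [Fin.sum_univ_two, ip_add_left, ip_smul_left, ip_comm x v, ip_comm y v, hx, hy]
  have hle : W ≤ ipForm.orthogonal W := by
    rw [hW, Submodule.span_le]
    rintro _ ⟨i, rfl⟩
    fin_cases i
    · exact hmem x hxx hxy
    · exact hmem y (by rw [ip_comm]; exact hxy) hyy
  have hrank : Module.finrank ℝ (ipForm.orthogonal W) = 2 := by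
    have := LinearMap.BilinForm.finrank_orthogonal ipForm_nondegenerate W
    rw [this, hWr]; simp [E42]
  have heq : W = ipForm.orthogonal W :=
    Submodule.eq_of_le_of_finrank_eq hle (by rw [hWr, hrank])
  have hz : z ∈ W := heq ▸ hmem z hzx hzy
  rw [hW, Submodule.mem_span_range_iff_exists_fun] at hz
  obtain ⟨c, hc⟩ := hz
  exact ⟨c 0, c 1, by simpa [Fin.sum_univ_two] using hc.symm⟩

/-- If `x, y` are null and not orthogonal, and `h ≠ 0` is a null vector normal to both, then
`x` and `h` are linearly independent. -/
lemma linearIndependent_of_null {x y h : E42} (hxy : ip x y ≠ 0) (hh : h ≠ 0)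
    (hhy : ip h y = 0) : LinearIndependent ℝ ![x, h] := by
  rw [LinearIndependent.pair_iff]
  intro s t hst
  have h1 : ip (s • x + t • h) y = 0 := by rw [hst, ip_zero_left]
  rw [ip_add_left, ip_smul_left, ip_smul_left, hhy, mul_zero, add_zero] at h1
  have hs : s = 0 := (mul_eq_zero.mp h1).resolve_right hxy
  subst hs
  rw [zero_smul, zero_add] at hst
  exact ⟨rfl, (smul_eq_zero.mp hst).resolve_right hh⟩

/-- If `h` is a non-zero null normal vector of a plane with basis `x, y`, `x` null, then a vector
orthogonal to `x, y, h` is a multiple of `h`. -/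
lemma exists_eq_smul_of_null {x y h z : E42} (hxx : ip x x = 0)
    (hxy : ip x y ≠ 0) (hh : h ≠ 0) (hhh : ip h h = 0) (hhx : ip h x = 0) (hhy : ip h y = 0)
    (hzx : ip z x = 0) (hzy : ip z y = 0) (hzh : ip z h = 0) : ∃ c : ℝ, z = c • h := by
  obtain ⟨a, b, rfl⟩ := exists_eq_smul_add_smul (linearIndependent_of_null hxy hh hhy) hxx
    (by rw [ip_comm]; exact hhx) hhh hzx hzh
  rw [ip_add_left, ip_smul_left, ip_smul_left, hhy, mul_zero, add_zero] at hzy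
  rw [(mul_eq_zero.mp hzy).resolve_right hxy]
  exact ⟨b, by simp⟩

/-- A plane that admits a non-zero null normal vector is not definite. The Gram determinant of
`x, y, h` and a vector `w` with `⟨h, w⟩ ≠ 0` is `-⟨h, w⟩²` times the Gram determinant of `x, y`, and
it is the square of a determinant, the metric having signature `(2, 2)`. -/
lemma gram_nonpos_of_null_normal {x y h : E42} (hh : h ≠ 0) (hhh : ip h h = 0)
    (hhx : ip h x = 0) (hhy : ip h y = 0) : ip x x * ip y y - ip x y * ip x y ≤ 0 := by
  set w : E42 := ![-h 0, -h 1, h 2, h 3] with hw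
  set c := ip h w with hc
  have hcpos : 0 < c := by
    have hc' : c = h 0 ^ 2 + h 1 ^ 2 + h 2 ^ 2 + h 3 ^ 2 := by
      simp [hc, hw, ip]; ring
    rw [hc']
    by_contra hcon
    apply hh
    have e0 : h 0 = 0 := by nlinarith [sq_nonneg (h 0), sq_nonneg (h 1), sq_nonneg (h 2), sq_nonneg (h 3)]
    have e1 : h 1 = 0 := by nlinarith [sq_nonneg (h 0), sq_nonneg (h 1), sq_nonneg (h 2), sq_nonneg (h 3)]
    have e2 : h 2 = 0 := by nlinarith [sq_nonneg (h 0), sq_nonneg (h 1), sq_nonneg (h 2), sq_nonneg (h 3)]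
    have e3 : h 3 = 0 := by nlinarith [sq_nonneg (h 0), sq_nonneg (h 1), sq_nonneg (h 2), sq_nonneg (h 3)]
    ext i; fin_cases i <;> simp [e0, e1, e2, e3]
  let A : Matrix (Fin 4) (Fin 4) ℝ := Matrix.of ![x, y, h, w]
  let η : Matrix (Fin 4) (Fin 4) ℝ := Matrix.diagonal ![-1, -1, 1, 1]
  have hη : η.det = 1 := by simp [η, Matrix.det_diagonal, Fin.prod_univ_four]
  have hG : A * η * A.transpose = !![ip x x, ip x y, 0, ip x w; ip x y, ip y y, 0, ip y w;
      0, 0, 0, c; ip x w, ip y w, c, ip w w] := by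
    have key : ∀ i j, (A * η * A.transpose) i j = ip (![x, y, h, w] i) (![x, y, h, w] j) := by
      intro i j
      change _ = ip (A i) (A j)
      simp [Matrix.mul_apply, Fin.sum_univ_four, η, Matrix.diagonal_apply, ip]
      ring
    ext i j
    rw [key]
    fin_cases i <;> fin_cases j <;>
      simp [hc, hhh, hhx, hhy, ip_comm y x, ip_comm x h, ip_comm y h, ip_comm w x, ip_comm w y,
        ip_comm w h]
  have hdet : A.det ^ 2 = -c ^ 2 * (ip x x * ip y y - ip x y * ip x y) := by
    have h1 : (A * η * A.transpose).det = A.det ^ 2 := by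
      rw [Matrix.det_mul, Matrix.det_mul, Matrix.det_transpose, hη]; ring
    rw [← h1, hG]
    simp [Matrix.det_succ_row_zero, Fin.sum_univ_succ, Fin.succAbove]
    ring
  by_contra hcon
  push Not at hcon
  nlinarith [sq_nonneg A.det, mul_pos (pow_pos hcpos 2) hcon]

/-- The coefficient of a vector that is a multiple of `h`, as a smooth function of both. -/
def coeffAlong (z h : E42) : ℝ := (∑ i, z i * h i) / ∑ i, h i * h i

lemma sum_mul_self_ne_zero {h : E42} (hh : h ≠ 0) : ∑ i, h i * h i ≠ 0 := by
  intro hs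
  apply hh
  ext i
  have := (Finset.sum_eq_zero_iff_of_nonneg (fun i _ => mul_self_nonneg (h i))).mp hs i
    (Finset.mem_univ i)
  simpa using this

lemma coeffAlong_smul_eq {z h : E42} (hh : h ≠ 0) (hz : ∃ c : ℝ, z = c • h) :
    coeffAlong z h • h = z := by
  obtain ⟨c, rfl⟩ := hz
  congr 1
  rw [coeffAlong, div_eq_iff (sum_mul_self_ne_zero hh), Finset.mul_sum]
  exact Finset.sum_congr rfl fun i _ => by simp [mul_assoc]

/-! ### Partial derivatives -/

section Pd

variable {V : Type*} [NormedAddCommGroup V] [NormedSpace ℝ V]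
variable {W : Type*} [NormedAddCommGroup W] [NormedSpace ℝ W]
variable {Ω : Set (ℝ × ℝ)} {q : ℝ × ℝ}

lemma differentiableAt_of_contDiffOn {f : ℝ × ℝ → V} (hΩ : IsOpen Ω) (hf : ContDiffOn ℝ ∞ f Ω)
    (hq : q ∈ Ω) : DifferentiableAt ℝ f q :=
  (hf.contDiffAt (hΩ.mem_nhds hq)).differentiableAt (by simp)

lemma contDiffOn_pd {f : ℝ × ℝ → V} (hΩ : IsOpen Ω) (hf : ContDiffOn ℝ ∞ f Ω) (i : Fin 2) :
    ContDiffOn ℝ ∞ (pd i f) Ω :=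
  ((contDiffOn_infty_iff_fderiv_of_isOpen hΩ).1 hf).2.clm_apply contDiffOn_const

lemma pd_congr {f g : ℝ × ℝ → V} (hΩ : IsOpen Ω) (h : Set.EqOn f g Ω) (i : Fin 2) :
    Set.EqOn (pd i f) (pd i g) Ω := fun q hq => by
  rw [pd, pd, (Filter.eventuallyEq_of_mem (hΩ.mem_nhds hq) h).fderiv_eq]

lemma pd_comm {f : ℝ × ℝ → V} (hΩ : IsOpen Ω) (hf : ContDiffOn ℝ ∞ f Ω) (hq : q ∈ Ω)
    (i j : Fin 2) : pd i (pd j f) q = pd j (pd i f) q := by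
  have hfd : DifferentiableAt ℝ (fderiv ℝ f) q :=
    differentiableAt_of_contDiffOn hΩ ((contDiffOn_infty_iff_fderiv_of_isOpen hΩ).1 hf).2 hq
  have key : ∀ i j, pd i (pd j f) q = fderiv ℝ (fderiv ℝ f) q (coordVec i) (coordVec j) := by
    intro i j
    change fderiv ℝ (fun x => fderiv ℝ f x (coordVec j)) q (coordVec i) = _
    rw [fderiv_clm_apply hfd (differentiableAt_const _)]
    simp
  rw [key, key]
  exact ((hf.contDiffAt (hΩ.mem_nhds hq)).isSymmSndFDerivAt
    (by simpa using WithTop.coe_le_coe.2 (le_top : (2 : ℕ∞) ≤ ⊤))).eq _ _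

lemma pd_const (c : V) (i : Fin 2) : pd i (fun _ => c) q = 0 := by simp [pd]

lemma pd_add {f g : ℝ × ℝ → V} (hf : DifferentiableAt ℝ f q) (hg : DifferentiableAt ℝ g q)
    (i : Fin 2) : pd i (fun x => f x + g x) q = pd i f q + pd i g q := by
  simp [pd, fderiv_fun_add hf hg]

lemma pd_sub {f g : ℝ × ℝ → V} (hf : DifferentiableAt ℝ f q) (hg : DifferentiableAt ℝ g q)
    (i : Fin 2) : pd i (fun x => f x - g x) q = pd i f q - pd i g q := by
  simp [pd, fderiv_fun_sub hf hg]

lemma pd_neg {f : ℝ × ℝ → V} (i : Fin 2) : pd i (fun x => -f x) q = -pd i f q := by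
  simp [pd]

lemma pd_smul {c : ℝ × ℝ → ℝ} {f : ℝ × ℝ → V} (hc : DifferentiableAt ℝ c q)
    (hf : DifferentiableAt ℝ f q) (i : Fin 2) :
    pd i (fun x => c x • f x) q = pd i c q • f q + c q • pd i f q := by
  simp [pd, fderiv_fun_smul hc hf, add_comm]

lemma pd_mul {c d : ℝ × ℝ → ℝ} (hc : DifferentiableAt ℝ c q) (hd : DifferentiableAt ℝ d q)
    (i : Fin 2) : pd i (fun x => c x * d x) q = pd i c q * d q + c q * pd i d q := by
  simp [pd, fderiv_fun_mul hc hd]; ring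

lemma pd_const_smul (c : ℝ) (f : ℝ × ℝ → V) (i : Fin 2) :
    pd i (fun x => c • f x) q = c • pd i f q := by
  have : fderiv ℝ (fun x => c • f x) q = c • fderiv ℝ f q :=
    congrFun (fderiv_const_smul_field (R := ℝ) (f := f) c) q
  simp [pd, this]

lemma pd_div {c d : ℝ × ℝ → ℝ} (hc : DifferentiableAt ℝ c q) (hd : DifferentiableAt ℝ d q)
    (h0 : d q ≠ 0) (i : Fin 2) :
    pd i (fun x => c x / d x) q = (pd i c q * d q - c q * pd i d q) / d q ^ 2 := by
  simp only [div_eq_mul_inv]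
  have hi : HasFDerivAt (fun x => (d x)⁻¹) (-(d q ^ 2)⁻¹ • fderiv ℝ d q) q :=
    (hasDerivAt_inv h0).comp_hasFDerivAt q hd.hasFDerivAt
  rw [pd_mul hc hi.differentiableAt]
  have hi' : pd i (fun x => (d x)⁻¹) q = -(d q ^ 2)⁻¹ * pd i d q := by
    simp [pd, hi.fderiv]
  rw [hi']
  field_simp
  ring

/-- The chain rule. -/
lemma pd_comp {f : ℝ × ℝ → V} {a b : ℝ × ℝ → ℝ} (ha : DifferentiableAt ℝ a q)
    (hb : DifferentiableAt ℝ b q) (hf : DifferentiableAt ℝ f (a q, b q)) (i : Fin 2) :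
    pd i (fun x => f (a x, b x)) q
      = pd i a q • pd 0 f (a q, b q) + pd i b q • pd 1 f (a q, b q) := by
  have h := HasFDerivAt.comp (f := fun x => (a x, b x)) q hf.hasFDerivAt
    (ha.hasFDerivAt.prodMk hb.hasFDerivAt)
  have h' : fderiv ℝ (fun x => f (a x, b x)) q
    = (fderiv ℝ f (a q, b q)).comp ((fderiv ℝ a q).prod (fderiv ℝ b q)) := h.fderiv
  simp only [pd, h', ContinuousLinearMap.comp_apply, ContinuousLinearMap.prod_apply]
  have : ∀ r s : ℝ, ((r, s) : ℝ × ℝ) = r • coordVec 0 + s • coordVec 1 := by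
    intro r s; simp [coordVec]
  rw [this (fderiv ℝ a q _), map_add, map_smul, map_smul]

lemma pd_fst (i : Fin 2) : pd i (fun x : ℝ × ℝ => x.1) q = if i = 0 then 1 else 0 := by
  have : fderiv ℝ (fun x : ℝ × ℝ => x.1) q = ContinuousLinearMap.fst ℝ ℝ ℝ := fderiv_fst
  fin_cases i <;> simp [pd, this, coordVec]

lemma pd_snd (i : Fin 2) : pd i (fun x : ℝ × ℝ => x.2) q = if i = 0 then 0 else 1 := by
  have : fderiv ℝ (fun x : ℝ × ℝ => x.2) q = ContinuousLinearMap.snd ℝ ℝ ℝ := fderiv_snd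
  fin_cases i <;> simp [pd, this, coordVec]

lemma pd_clm_comp (A : V →L[ℝ] W) {f : ℝ × ℝ → V} (hf : DifferentiableAt ℝ f q) (i : Fin 2) :
    pd i (fun x => A (f x)) q = A (pd i f q) := by
  have : fderiv ℝ (fun x => A (f x)) q = A.comp (fderiv ℝ f q) :=
    (A.hasFDerivAt.comp q hf.hasFDerivAt).fderiv
  simp [pd, this]

lemma pd_apply {f : ℝ × ℝ → E42} (hf : DifferentiableAt ℝ f q) (i : Fin 2) (k : Fin 4) :
    pd i (fun x => f x k) q = pd i f q k :=
  pd_clm_comp (ContinuousLinearMap.proj (R := ℝ) (φ := fun _ : Fin 4 => ℝ) k) hf i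

lemma contDiffOn_ip {n : WithTop ℕ∞} {X : Type*} [NormedAddCommGroup X] [NormedSpace ℝ X] {S : Set X}
    {f g : X → E42} (hf : ContDiffOn ℝ n f S) (hg : ContDiffOn ℝ n g S) :
    ContDiffOn ℝ n (fun x => ip (f x) (g x)) S := by
  rw [contDiffOn_pi] at hf hg
  have h0 := (hf 0).mul (hg 0)
  have h1 := (hf 1).mul (hg 1)
  have h2 := (hf 2).mul (hg 2)
  have h3 := (hf 3).mul (hg 3)
  exact ((h0.neg.sub h1).add h2).add h3

lemma pd_ip {f g : ℝ × ℝ → E42} (hf : DifferentiableAt ℝ f q) (hg : DifferentiableAt ℝ g q)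
    (i : Fin 2) : pd i (fun x => ip (f x) (g x)) q = ip (pd i f q) (g q) + ip (f q) (pd i g q) := by
  have hf' := differentiableAt_pi.1 hf
  have hg' := differentiableAt_pi.1 hg
  simp only [ip]
  rw [pd_add (by fun_prop) (by fun_prop), pd_add (by fun_prop) (by fun_prop),
    pd_sub (by fun_prop) (by fun_prop), pd_neg, pd_mul (hf' 0) (hg' 0), pd_mul (hf' 1) (hg' 1),
    pd_mul (hf' 2) (hg' 2), pd_mul (hf' 3) (hg' 3)]
  simp only [pd_apply hf, pd_apply hg]
  ring

lemma pd_ip_of_eqOn {f g : ℝ × ℝ → E42} {c : ℝ × ℝ → ℝ} (hΩ : IsOpen Ω)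
    (hf : ContDiffOn ℝ ∞ f Ω) (hg : ContDiffOn ℝ ∞ g Ω)
    (h : ∀ x ∈ Ω, ip (f x) (g x) = c x) (hq : q ∈ Ω) (i : Fin 2) :
    ip (pd i f q) (g q) + ip (f q) (pd i g q) = pd i c q := by
  rw [← pd_ip (differentiableAt_of_contDiffOn hΩ hf hq) (differentiableAt_of_contDiffOn hΩ hg hq)]
  exact pd_congr hΩ h i hq

lemma pd_ip_of_const {f g : ℝ × ℝ → E42} {c : ℝ} (hΩ : IsOpen Ω)
    (hf : ContDiffOn ℝ ∞ f Ω) (hg : ContDiffOn ℝ ∞ g Ω)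
    (h : ∀ x ∈ Ω, ip (f x) (g x) = c) (hq : q ∈ Ω) (i : Fin 2) :
    ip (pd i f q) (g q) + ip (f q) (pd i g q) = 0 := by
  rw [pd_ip_of_eqOn (c := fun _ => c) hΩ hf hg h hq, pd_const]

lemma contDiffOn_coeffAlong {z h : ℝ × ℝ → E42} (hz : ContDiffOn ℝ ∞ z Ω)
    (hh : ContDiffOn ℝ ∞ h Ω) (h0 : ∀ x ∈ Ω, h x ≠ 0) :
    ContDiffOn ℝ ∞ (fun x => coeffAlong (z x) (h x)) Ω := by
  have hz' := contDiffOn_pi.1 hz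
  have hh' := contDiffOn_pi.1 hh
  exact (ContDiffOn.sum fun i _ => (hz' i).mul (hh' i)).div
    (ContDiffOn.sum fun i _ => (hh' i).mul (hh' i)) fun x hx => sum_mul_self_ne_zero (h0 x hx)

end Pd

end QuasiMinimal
end

noncomputable section
namespace QuasiMinimal
open MeasureTheory Set Filter Topology

/-! ### Integrals depending on parameters -/

section Parametric

variable {E : Type} [NormedAddCommGroup E] [NormedSpace ℝ E] [FiniteDimensional ℝ E]
variable {V : Type} [NormedAddCommGroup V] [NormedSpace ℝ V]

/-- An open neighbourhood of `{q} × [0, 1]` contains a compact tube around it. -/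
lemma exists_tube {U : Set E} {W : Set (E × ℝ)} (hW : IsOpen W)
    (hUW : U ×ˢ Icc (0 : ℝ) 1 ⊆ W) {q : E} (hq : q ∈ U) :
    ∃ K ∈ 𝓝 q, IsCompact K ∧ K ×ˢ Icc (0 : ℝ) 1 ⊆ W := by
  have h1 : ({q} : Set E) ×ˢ Icc (0 : ℝ) 1 ⊆ W :=
    (prod_mono (singleton_subset_iff.2 hq) Subset.rfl).trans hUW
  obtain ⟨u, v, hu, -, hqu, hv, huv⟩ :=
    generalized_tube_lemma isCompact_singleton isCompact_Icc hW h1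
  obtain ⟨K, hK, hKu, hKc⟩ := local_compact_nhds (hu.mem_nhds (hqu rfl))
  exact ⟨K, hK, hKc, (prod_mono hKu hv).trans huv⟩

omit [NormedSpace ℝ E] [FiniteDimensional ℝ E] [NormedSpace ℝ V] in
lemma continuousOn_section {W : Set (E × ℝ)} {h : E × ℝ → V} (hh : ContinuousOn h W)
    {K : Set E} (hKW : K ×ˢ Icc (0 : ℝ) 1 ⊆ W) {x : E} (hx : x ∈ K) :
    ContinuousOn (fun θ => h (x, θ)) (Icc (0 : ℝ) 1) :=
  hh.comp (by fun_prop) fun _ hθ => hKW ⟨hx, hθ⟩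

lemma continuousOn_integral {U : Set E} {W : Set (E × ℝ)}
    (hW : IsOpen W) (hUW : U ×ˢ Icc (0 : ℝ) 1 ⊆ W) {h : E × ℝ → V} (hh : ContinuousOn h W) :
    ContinuousOn (fun q => ∫ θ in (0 : ℝ)..1, h (q, θ)) U := by
  intro q hq
  apply ContinuousAt.continuousWithinAt
  obtain ⟨K, hK, hKc, hKW⟩ := exists_tube hW hUW hq
  obtain ⟨C, hC⟩ := (hKc.prod isCompact_Icc).exists_bound_of_continuousOn (hh.mono hKW)
  have hq' : q ∈ K := mem_of_mem_nhds hK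
  apply intervalIntegral.continuousAt_of_dominated_interval (bound := fun _ => C)
  · filter_upwards [hK] with x hx
    rw [uIoc_of_le zero_le_one]
    exact ((continuousOn_section hh hKW hx).mono Ioc_subset_Icc_self).aestronglyMeasurable
      measurableSet_Ioc
  · filter_upwards [hK] with x hx
    refine Eventually.of_forall fun θ hθ => hC (x, θ) ⟨hx, ?_⟩
    rw [uIoc_of_le zero_le_one] at hθ
    exact Ioc_subset_Icc_self hθ
  · exact intervalIntegrable_const
  · refine Eventually.of_forall fun θ hθ => ?_
    rw [uIoc_of_le zero_le_one] at hθ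
    exact (hh.continuousAt (hW.mem_nhds (hKW ⟨hq', Ioc_subset_Icc_self hθ⟩))).comp
      (f := fun x => (x, θ)) (by fun_prop)

lemma hasFDerivAt_integral {U : Set E} {W : Set (E × ℝ)}
    (hW : IsOpen W) (hUW : U ×ˢ Icc (0 : ℝ) 1 ⊆ W) {h : E × ℝ → V} {h' : E × ℝ → E →L[ℝ] V}
    (hh : ContinuousOn h W) (hh' : ContinuousOn h' W)
    (hd : ∀ x ∈ W, HasFDerivAt (fun y => h (y, x.2)) (h' x) x.1) {q : E} (hq : q ∈ U) :
    HasFDerivAt (fun q => ∫ θ in (0 : ℝ)..1, h (q, θ)) (∫ θ in (0 : ℝ)..1, h' (q, θ)) q := by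
  obtain ⟨K, hK, hKc, hKW⟩ := exists_tube hW hUW hq
  obtain ⟨C, hC⟩ := (hKc.prod isCompact_Icc).exists_bound_of_continuousOn (hh'.mono hKW)
  have hq' : q ∈ K := mem_of_mem_nhds hK
  apply intervalIntegral.hasFDerivAt_integral_of_dominated_of_fderiv_le (bound := fun _ => C)
    (F := fun x θ => h (x, θ)) (F' := fun x θ => h' (x, θ)) hK
  · filter_upwards [hK] with x hx
    rw [uIoc_of_le zero_le_one]
    exact ((continuousOn_section hh hKW hx).mono Ioc_subset_Icc_self).aestronglyMeasurable
      measurableSet_Ioc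
  · apply ContinuousOn.intervalIntegrable
    rw [uIcc_of_le zero_le_one]
    exact continuousOn_section hh hKW hq'
  · rw [uIoc_of_le zero_le_one]
    exact ((continuousOn_section hh' hKW hq').mono Ioc_subset_Icc_self).aestronglyMeasurable
      measurableSet_Ioc
  · refine Eventually.of_forall fun θ hθ x hx => hC (x, θ) ⟨hx, ?_⟩
    rw [uIoc_of_le zero_le_one] at hθ
    exact Ioc_subset_Icc_self hθ
  · exact intervalIntegrable_const
  · refine Eventually.of_forall fun θ hθ x hx => hd (x, θ) (hKW ⟨hx, ?_⟩)
    rw [uIoc_of_le zero_le_one] at hθ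
    exact Ioc_subset_Icc_self hθ

/-- The induction on `n` differentiates under the integral sign, so that the derivative is again an
integral of the same form, with values in another space; hence `V` is quantified inside. -/
lemma contDiffOn_integral_nat {U : Set E} (hU : IsOpen U) {W : Set (E × ℝ)}
    (hW : IsOpen W) (hUW : U ×ˢ Icc (0 : ℝ) 1 ⊆ W) (n : ℕ) :
    ∀ {V : Type} [NormedAddCommGroup V] [NormedSpace ℝ V] {h : E × ℝ → V},
      ContDiffOn ℝ n h W → ContDiffOn ℝ n (fun q => ∫ θ in (0 : ℝ)..1, h (q, θ)) U := by
  induction n with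
  | zero =>
    intro V _ _ h hh
    rw [Nat.cast_zero, contDiffOn_zero] at hh ⊢
    exact continuousOn_integral hW hUW hh
  | succ n ih =>
    intro V _ _ h hh
    have hh1 := hh
    rw [Nat.cast_succ, contDiffOn_succ_iff_fderiv_of_isOpen hW] at hh
    set h' : E × ℝ → E →L[ℝ] V := fun x =>
      (fderiv ℝ h x).comp (ContinuousLinearMap.inl ℝ E ℝ) with hh'def
    have hh' : ContDiffOn ℝ n h' W := hh.2.2.clm_comp contDiffOn_const
    have hd : ∀ x ∈ W, HasFDerivAt (fun y => h (y, x.2)) (h' x) x.1 := by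
      intro x hx
      have h1 : HasFDerivAt h (fderiv ℝ h x) (x.1, x.2) :=
        ((hh.1 x hx).differentiableAt (hW.mem_nhds hx)).hasFDerivAt
      exact h1.comp x.1 (hasFDerivAt_prodMk_left x.1 x.2)
    have key : ∀ q ∈ U, HasFDerivAt (fun q => ∫ θ in (0 : ℝ)..1, h (q, θ))
        (∫ θ in (0 : ℝ)..1, h' (q, θ)) q := fun q hq =>
      hasFDerivAt_integral hW hUW hh1.continuousOn hh'.continuousOn hd hq
    rw [Nat.cast_succ, contDiffOn_succ_iff_fderiv_of_isOpen hU]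
    refine ⟨fun q hq => (key q hq).differentiableAt.differentiableWithinAt, by simp, ?_⟩
    exact (ih hh').congr fun q hq => (key q hq).fderiv

/-- The primitive `∫_{x₀}^{x} g(ξ, y) dξ` is of class `C^n` in `(x, y)` if `g` is. -/
lemma contDiffOn_primitive_nat {I J : Set ℝ} (hI : IsOpen I) (hIc : I.OrdConnected)
    (hJ : IsOpen J) {x₀ : ℝ} (hx₀ : x₀ ∈ I) {g : ℝ × ℝ → ℝ} (n : ℕ)
    (hg : ContDiffOn ℝ n g (I ×ˢ J)) :
    ContDiffOn ℝ n (fun q : ℝ × ℝ => ∫ ξ in x₀..q.1, g (ξ, q.2)) (I ×ˢ J) := by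
  set τ : (ℝ × ℝ) × ℝ → ℝ × ℝ := fun x => (x₀ + x.2 * (x.1.1 - x₀), x.1.2) with hτ
  have hτs : ContDiff ℝ n τ := by fun_prop
  have hW : IsOpen (τ ⁻¹' (I ×ˢ J)) := (hI.prod hJ).preimage hτs.continuous
  have hUW : (I ×ˢ J) ×ˢ Icc (0 : ℝ) 1 ⊆ τ ⁻¹' (I ×ˢ J) := by
    rintro ⟨⟨x, y⟩, θ⟩ ⟨⟨hx, hy⟩, hθ⟩
    refine ⟨?_, hy⟩
    have := hIc.convex hx₀ hx (a := 1 - θ) (b := θ) (by linarith [hθ.2]) hθ.1 (by ring)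
    simp only [smul_eq_mul] at this
    simp only [hτ]
    convert this using 1; ring
  have h1 := contDiffOn_integral_nat (hI.prod hJ) hW hUW n (h := fun x => g (τ x))
    (hg.comp hτs.contDiffOn fun x hx => hx)
  have h2 : ContDiffOn ℝ n (fun q : ℝ × ℝ => (q.1 - x₀) * ∫ θ in (0 : ℝ)..1, g (τ (q, θ)))
      (I ×ˢ J) := ContDiffOn.mul (by fun_prop) h1
  refine h2.congr fun q _ => ?_
  have := intervalIntegral.mul_integral_comp_add_mul (a := 0) (b := 1) (f := fun ξ => g (ξ, q.2))
    (q.1 - x₀) x₀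
  simp only [mul_zero, add_zero, mul_one, add_sub_cancel] at this
  rw [← this]
  simp only [hτ]
  simp_rw [mul_comm (q.1 - x₀)]

end Parametric

end QuasiMinimal
end

noncomputable section
namespace QuasiMinimal
open MeasureTheory Set Filter Topology

/-! ### Linear differential equations on an interval -/

section LinearODE

variable {V : Type*} [NormedAddCommGroup V] [NormedSpace ℝ V] {I : Set ℝ}

lemma eq_of_hasDerivAt_zero (hI : IsOpenInterval I) {F : ℝ → V}
    (hF : ∀ x ∈ I, HasDerivAt F 0 x) {x y : ℝ} (hx : x ∈ I) (hy : y ∈ I) : F x = F y :=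
  hI.1.is_const_of_deriv_eq_zero hI.2.isPreconnected
    (fun z hz => (hF z hz).differentiableAt.differentiableWithinAt)
    (fun z hz => (hF z hz).deriv) hx hy

lemma hasDerivAt_integral_of_continuousOn (hI : IsOpenInterval I) {k : ℝ → ℝ}
    (hk : ContinuousOn k I) {x₀ x : ℝ} (hx₀ : x₀ ∈ I) (hx : x ∈ I) :
    HasDerivAt (fun x => ∫ ξ in x₀..x, k ξ) (k x) x := by
  have hsub : uIcc x₀ x ⊆ I := hI.2.uIcc_subset hx₀ hx
  exact intervalIntegral.integral_hasDerivAt_right ((hk.mono hsub).intervalIntegrable)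
    (hk.stronglyMeasurableAtFilter hI.1 x hx) (hk.continuousAt (hI.1.mem_nhds hx))

/-- The solutions of `F' = k F` are the multiples of `exp ∫ k`. -/
lemma eq_exp_smul_of_linearODE (hI : IsOpenInterval I) {k : ℝ → ℝ} (hk : ContinuousOn k I)
    {F : ℝ → V} (hF : ∀ x ∈ I, HasDerivAt F (k x • F x) x) {x₀ x : ℝ} (hx₀ : x₀ ∈ I) (hx : x ∈ I) :
    F x = Real.exp (∫ ξ in x₀..x, k ξ) • F x₀ := by
  have key : ∀ z ∈ I, HasDerivAt (fun z => Real.exp (-∫ ξ in x₀..z, k ξ) • F z) 0 z := by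
    intro z hz
    have h1 := ((hasDerivAt_integral_of_continuousOn hI hk hx₀ hz).fun_neg.exp).fun_smul (hF z hz)
    convert h1 using 1
    rw [smul_smul, ← add_smul]
    ring_nf
    simp
  have h := eq_of_hasDerivAt_zero hI key hx hx₀
  simp only [intervalIntegral.integral_same, neg_zero, Real.exp_zero, one_smul] at h
  rw [← h, smul_smul, ← Real.exp_add]
  simp

lemma eq_zero_of_linearODE (hI : IsOpenInterval I) {k : ℝ → ℝ} (hk : ContinuousOn k I)
    {F : ℝ → V} (hF : ∀ x ∈ I, HasDerivAt F (k x • F x) x) {x₀ x : ℝ} (hx₀ : x₀ ∈ I)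
    (h0 : F x₀ = 0) (hx : x ∈ I) : F x = 0 := by
  rw [eq_exp_smul_of_linearODE hI hk hF hx₀ hx, h0, smul_zero]

end LinearODE

lemma isOpenInterval_Ioo (a b : ℝ) : IsOpenInterval (Ioo a b) := ⟨isOpen_Ioo, ordConnected_Ioo⟩

section Slices

variable {V : Type*} [NormedAddCommGroup V] [NormedSpace ℝ V]

lemma hasDerivAt_slice_zero {f : ℝ × ℝ → V} {q : ℝ × ℝ} (hf : DifferentiableAt ℝ f q) :
    HasDerivAt (fun x => f (x, q.2)) (pd 0 f q) q.1 := by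
  have h : HasFDerivAt f (fderiv ℝ f q) (q.1, q.2) := hf.hasFDerivAt
  have := (h.comp q.1 (hasFDerivAt_prodMk_left q.1 q.2)).hasDerivAt
  simpa [pd, coordVec, Function.comp_def] using this

lemma hasDerivAt_slice_one {f : ℝ × ℝ → V} {q : ℝ × ℝ} (hf : DifferentiableAt ℝ f q) :
    HasDerivAt (fun y => f (q.1, y)) (pd 1 f q) q.2 := by
  have h : HasFDerivAt f (fderiv ℝ f q) (q.1, q.2) := hf.hasFDerivAt
  have := (h.comp q.2 (hasFDerivAt_prodMk_right q.1 q.2)).hasDerivAt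
  simpa [pd, coordVec, Function.comp_def] using this

end Slices

/-! ### Smooth dependence of scalar differential equations on the initial value -/

section Flow

variable {f : ℝ × ℝ → ℝ}

/-- The difference quotient of `f` in the second variable, continuously extended to the
diagonal. -/
def slopeSnd (f : ℝ × ℝ → ℝ) (x a b : ℝ) : ℝ := ∫ θ in (0 : ℝ)..1, pd 1 f (x, a + θ * (b - a))

lemma sub_eq_slopeSnd_mul (hf : ContDiff ℝ ∞ f) (x a b : ℝ) :
    f (x, b) - f (x, a) = slopeSnd f x a b * (b - a) := by
  have hc : Continuous (pd 1 f) := (contDiffOn_univ.1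
    (contDiffOn_pd isOpen_univ hf.contDiffOn 1)).continuous
  have hd : ∀ θ ∈ uIcc (0 : ℝ) 1, HasDerivAt (fun θ => f (x, a + θ * (b - a)))
      (pd 1 f (x, a + θ * (b - a)) * (b - a)) θ := by
    intro θ _
    have h1 := hasDerivAt_slice_one (q := (x, a + θ * (b - a)))
      ((hf.differentiable (by simp)).differentiableAt)
    have h2 : HasDerivAt (fun θ : ℝ => a + θ * (b - a)) (b - a) θ := by
      simpa using ((hasDerivAt_id θ).mul_const (b - a)).const_add a
    exact h1.comp θ h2
  have := intervalIntegral.integral_eq_sub_of_hasDerivAt hd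
    (Continuous.intervalIntegrable (by fun_prop) _ _)
  simp only [one_mul, zero_mul, add_zero, add_sub_cancel] at this
  rw [← this, intervalIntegral.integral_mul_const, slopeSnd]

lemma continuous_slopeSnd (hf : ContDiff ℝ ∞ f) :
    Continuous fun p : ℝ × ℝ × ℝ => slopeSnd f p.1 p.2.1 p.2.2 := by
  have hc : Continuous (pd 1 f) := (contDiffOn_univ.1
    (contDiffOn_pd isOpen_univ hf.contDiffOn 1)).continuous
  apply intervalIntegral.continuous_parametric_intervalIntegral_of_continuous'
    (f := fun (p : ℝ × ℝ × ℝ) θ => pd 1 f (p.1, p.2.1 + θ * (p.2.2 - p.2.1)))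
  simp only [Function.uncurry_def]
  fun_prop

lemma slopeSnd_self (x a : ℝ) : slopeSnd f x a a = pd 1 f (x, a) := by simp [slopeSnd]

variable {I J : Set ℝ} {x₀ : ℝ} {Y : ℝ × ℝ → ℝ}

/-- The derivative of the flow with respect to the initial value is
`exp ∫ f_y`. -/
lemma hasDerivAt_flow (hf : ContDiff ℝ ∞ f) (hI : IsOpenInterval I) (hJ : IsOpen J) (hx₀ : x₀ ∈ I)
    (hY : ContinuousOn Y (I ×ˢ J)) (hY0 : ∀ y ∈ J, Y (x₀, y) = y)
    (hode : ∀ q ∈ I ×ˢ J, HasDerivAt (fun x => Y (x, q.2)) (f (q.1, Y q)) q.1)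
    {q : ℝ × ℝ} (hq : q ∈ I ×ˢ J) :
    HasDerivAt (fun y => Y (q.1, y)) (Real.exp (∫ ξ in x₀..q.1, pd 1 f (ξ, Y (ξ, q.2)))) q.2 := by
  obtain ⟨x, y⟩ := q
  obtain ⟨hx, hy⟩ := hq
  simp only at hx hy ⊢
  set g : ℝ × ℝ → ℝ := fun p => slopeSnd f p.1 (Y (p.1, y)) (Y p) with hg
  have hgc : ContinuousOn g (I ×ˢ J) := by
    have h1 : ContinuousOn (fun p : ℝ × ℝ => Y (p.1, y)) (I ×ˢ J) :=
      hY.comp (by fun_prop) fun p hp => ⟨hp.1, hy⟩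
    exact (continuous_slopeSnd hf).comp_continuousOn (continuousOn_fst.prodMk (h1.prodMk hY))
  have hP : ContinuousOn (fun p : ℝ × ℝ => ∫ ξ in x₀..p.1, g (ξ, p.2)) (I ×ˢ J) :=
    contDiffOn_zero.1 (contDiffOn_primitive_nat hI.1 hI.2 hJ hx₀ 0 (contDiffOn_zero.2 hgc))
  have key : ∀ y' ∈ J, Y (x, y') - Y (x, y) = Real.exp (∫ ξ in x₀..x, g (ξ, y')) • (y' - y) := by
    intro y' hy'
    have hk : ContinuousOn (fun ξ => g (ξ, y')) I := hgc.comp (by fun_prop) fun ξ hξ => ⟨hξ, hy'⟩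
    have := eq_exp_smul_of_linearODE hI hk (F := fun x => Y (x, y') - Y (x, y)) (fun z hz => by
      convert (hode (z, y') ⟨hz, hy'⟩).fun_sub (hode (z, y) ⟨hz, hy⟩) using 1
      rw [sub_eq_slopeSnd_mul hf]; rfl) hx₀ hx
    rw [hY0 y' hy', hY0 y hy] at this
    exact this
  have hlim : ContinuousAt (fun y' => Real.exp (∫ ξ in x₀..x, g (ξ, y'))) y := by
    have h1 : ContinuousAt (fun p : ℝ × ℝ => ∫ ξ in x₀..p.1, g (ξ, p.2)) (x, y) :=
      hP.continuousAt ((hI.1.prod hJ).mem_nhds ⟨hx, hy⟩)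
    exact (h1.comp (f := fun y' => (x, y')) (by fun_prop)).rexp
  have hval : ∫ ξ in x₀..x, pd 1 f (ξ, Y (ξ, y)) = ∫ ξ in x₀..x, g (ξ, y) := by
    simp [hg, slopeSnd_self]
  rw [hval, hasDerivAt_iff_tendsto_slope]
  refine (hlim.tendsto.mono_left nhdsWithin_le_nhds).congr' ?_
  filter_upwards [self_mem_nhdsWithin, nhdsWithin_le_nhds (hJ.mem_nhds hy)] with y' hne hy'
  rw [slope_def_field, key y' hy', smul_eq_mul, mul_div_cancel_right₀]
  exact sub_ne_zero.2 hne

/-- Both partial derivatives of the flow are expressions in the flow itself, so its differentiability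
class can be raised by induction. -/
lemma contDiffOn_flow (hf : ContDiff ℝ ∞ f) (hI : IsOpenInterval I) (hJ : IsOpen J) (hx₀ : x₀ ∈ I)
    (hY : ContinuousOn Y (I ×ˢ J)) (hY0 : ∀ y ∈ J, Y (x₀, y) = y)
    (hode : ∀ q ∈ I ×ˢ J, HasDerivAt (fun x => Y (x, q.2)) (f (q.1, Y q)) q.1) :
    ContDiffOn ℝ ∞ Y (I ×ˢ J) := by
  have hIJ : IsOpen (I ×ˢ J) := hI.1.prod hJ
  set D : ℝ × ℝ → ℝ := fun q => Real.exp (∫ ξ in x₀..q.1, pd 1 f (ξ, Y (ξ, q.2))) with hD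
  have hf1 : ContDiff ℝ ∞ (pd 1 f) := contDiffOn_univ.1
    (contDiffOn_pd isOpen_univ hf.contDiffOn 1)
  have hDn : ∀ n : ℕ, ContDiffOn ℝ n Y (I ×ˢ J) → ContDiffOn ℝ n D (I ×ˢ J) := by
    intro n hn
    have h1 : ContDiffOn ℝ n (fun p : ℝ × ℝ => pd 1 f (p.1, Y p)) (I ×ˢ J) :=
      (hf1.of_le (by exact_mod_cast le_top)).comp_contDiffOn (contDiffOn_fst.prodMk hn)
    exact (contDiffOn_primitive_nat hI.1 hI.2 hJ hx₀ n h1).exp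
  have hDc : ContinuousOn D (I ×ˢ J) :=
    (hDn 0 (contDiffOn_zero.2 hY)).continuousOn
  have hfY : ContinuousOn (fun q : ℝ × ℝ => f (q.1, Y q)) (I ×ˢ J) :=
    hf.continuous.comp_continuousOn (continuousOn_fst.prodMk hY)
  have hder : ∀ q ∈ I ×ˢ J, HasFDerivAt Y ((ContinuousLinearMap.toSpanSingleton ℝ (f (q.1, Y q))).coprod
      (ContinuousLinearMap.toSpanSingleton ℝ (D q))) q := by
    intro q hq
    have := hasStrictFDerivAt_uncurry_coprod (𝕜 := ℝ) (u := q) (f := fun x y => Y (x, y))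
      (f₁ := fun x y => ContinuousLinearMap.toSpanSingleton ℝ (f (x, Y (x, y))))
      (f₂ := fun x y => ContinuousLinearMap.toSpanSingleton ℝ (D (x, y)))
      (by filter_upwards [hIJ.mem_nhds hq] with v hv using (hode v hv).hasFDerivAt)
      (by filter_upwards [hIJ.mem_nhds hq] with v hv using
            (hasDerivAt_flow hf hI hJ hx₀ hY hY0 hode hv).hasFDerivAt)
      (((ContinuousLinearMap.toSpanSingletonCLE (𝕜 := ℝ) (E := ℝ)).continuous.continuousAt).comp
        (hfY.continuousAt (hIJ.mem_nhds hq)))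
      (((ContinuousLinearMap.toSpanSingletonCLE (𝕜 := ℝ) (E := ℝ)).continuous.continuousAt).comp
        (hDc.continuousAt (hIJ.mem_nhds hq)))
    exact this.hasFDerivAt
  rw [contDiffOn_infty]
  intro n
  induction n with
  | zero => exact contDiffOn_zero.2 hY
  | succ n ih =>
    rw [Nat.cast_succ, contDiffOn_succ_iff_fderiv_of_isOpen hIJ]
    refine ⟨fun q hq => (hder q hq).differentiableAt.differentiableWithinAt, by simp, ?_⟩
    have h1 : ContDiffOn ℝ n (fun p : ℝ × ℝ => f (p.1, Y p)) (I ×ˢ J) :=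
      (hf.of_le (by exact_mod_cast le_top)).comp_contDiffOn (contDiffOn_fst.prodMk ih)
    have h2 : ContDiffOn ℝ n (fun q => f (q.1, Y q) • ContinuousLinearMap.fst ℝ ℝ ℝ
        + D q • ContinuousLinearMap.snd ℝ ℝ ℝ) (I ×ˢ J) :=
      (h1.smul contDiffOn_const).add ((hDn n ih).smul contDiffOn_const)
    refine h2.congr fun q hq => ?_
    rw [(hder q hq).fderiv]
    ext <;> simp

/-- Solutions of `Y' = f(x, Y)` form a smooth function of `x` and of the initial value. -/
lemma exists_flow (hf : ContDiff ℝ ∞ f) (hc : HasCompactSupport f) (x₀ y₀ : ℝ) :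
    ∃ Y : ℝ × ℝ → ℝ, ContDiffOn ℝ ∞ Y (Ioo (x₀ - 1) (x₀ + 1) ×ˢ Ioo (y₀ - 1) (y₀ + 1)) ∧
      (∀ y ∈ Ioo (y₀ - 1) (y₀ + 1), Y (x₀, y) = y) ∧
      ∀ q ∈ Ioo (x₀ - 1) (x₀ + 1) ×ˢ Ioo (y₀ - 1) (y₀ + 1),
        HasDerivAt (fun x => Y (x, q.2)) (f (q.1, Y q)) q.1 ∧
        0 < pd 1 Y q := by
  obtain ⟨C, hC⟩ := hc.exists_bound_of_continuous hf.continuous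
  obtain ⟨K, hK⟩ := hf.lipschitzWith_of_hasCompactSupport hc (by simp)
  have hC0 : 0 ≤ C := (norm_nonneg _).trans (hC 0)
  lift C to NNReal using hC0
  have hpl : IsPicardLindelof (fun t x => f (t, x)) (tmin := x₀ - 1) (tmax := x₀ + 1)
      ⟨x₀, by constructor <;> linarith⟩ y₀ (C + 1) 1 C K := by
    refine ⟨fun t _ => ?_, fun x _ => ?_, fun t _ x _ => hC _, ?_⟩
    · refine LipschitzWith.lipschitzOnWith ?_
      have h2 := hK.comp (LipschitzWith.prodMk_left t (β := ℝ))
      simpa [Function.comp_def] using h2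
    · exact (hf.continuous.comp (by fun_prop)).continuousOn
    · simp
  obtain ⟨α, hα, hαc⟩ := hpl.exists_forall_mem_closedBall_eq_hasDerivWithinAt_continuousOn
  have hball : ∀ y ∈ Ioo (y₀ - 1) (y₀ + 1), y ∈ Metric.closedBall y₀ ((1 : NNReal) : ℝ) := by
    intro y hy
    rw [Real.closedBall_eq_Icc]
    exact Ioo_subset_Icc_self (by simpa using hy)
  set Y : ℝ × ℝ → ℝ := fun q => α (q.2, q.1) with hYdef
  have hYc : ContinuousOn Y (Ioo (x₀ - 1) (x₀ + 1) ×ˢ Ioo (y₀ - 1) (y₀ + 1)) :=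
    hαc.comp (by fun_prop) fun q hq => ⟨hball _ hq.2, Ioo_subset_Icc_self hq.1⟩
  have hY0 : ∀ y ∈ Ioo (y₀ - 1) (y₀ + 1), Y (x₀, y) = y := fun y hy => (hα y (hball y hy)).1
  have hode : ∀ q ∈ Ioo (x₀ - 1) (x₀ + 1) ×ˢ Ioo (y₀ - 1) (y₀ + 1),
      HasDerivAt (fun x => Y (x, q.2)) (f (q.1, Y q)) q.1 := fun q hq =>
    ((hα q.2 (hball _ hq.2)).2 q.1 (Ioo_subset_Icc_self hq.1)).hasDerivAt
      (Icc_mem_nhds hq.1.1 hq.1.2)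
  have hx₀ : x₀ ∈ Ioo (x₀ - 1) (x₀ + 1) := by constructor <;> linarith
  have hYs := contDiffOn_flow hf (isOpenInterval_Ioo _ _) isOpen_Ioo hx₀ hYc hY0 hode
  refine ⟨Y, hYs, hY0, fun q hq => ⟨hode q hq, ?_⟩⟩
  have h1 := hasDerivAt_flow hf (isOpenInterval_Ioo _ _) isOpen_Ioo hx₀ hYc hY0 hode hq
  have h2 := hasDerivAt_slice_one
    (differentiableAt_of_contDiffOn (isOpen_Ioo.prod isOpen_Ioo) hYs hq)
  rw [h2.unique h1]
  exact Real.exp_pos _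

end Flow

/-! ### Local diffeomorphisms of the plane -/

/-- The inverse function theorem for maps of the plane given by two component functions. -/
lemma exists_localDiffeo {Ω : Set (ℝ × ℝ)} (hΩ : IsOpen Ω) {a b : ℝ × ℝ → ℝ}
    (ha : ContDiffOn ℝ ∞ a Ω) (hb : ContDiffOn ℝ ∞ b Ω)
    (hJ : ∀ q ∈ Ω, pd 0 a q * pd 1 b q - pd 1 a q * pd 0 b q ≠ 0) {q₀ : ℝ × ℝ} (hq₀ : q₀ ∈ Ω) :
    ∃ φ : OpenPartialHomeomorph (ℝ × ℝ) (ℝ × ℝ), q₀ ∈ φ.source ∧ φ.source ⊆ Ω ∧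
      (∀ q, φ q = (a q, b q)) ∧ ContDiffOn ℝ ∞ φ.symm φ.target := by
  have hs : ContDiffOn ℝ ∞ (fun q => (a q, b q)) Ω := ha.prodMk hb
  have hder : ∀ q ∈ Ω, ∃ L : (ℝ × ℝ) ≃L[ℝ] (ℝ × ℝ),
      HasFDerivAt (fun q => (a q, b q)) (L : (ℝ × ℝ) →L[ℝ] (ℝ × ℝ)) q := by
    intro q hq
    have hd := (differentiableAt_of_contDiffOn hΩ hs hq).hasFDerivAt
    set A := fderiv ℝ (fun q => (a q, b q)) q with hA
    have hA' : A = (fderiv ℝ a q).prod (fderiv ℝ b q) :=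
      ((differentiableAt_of_contDiffOn hΩ ha hq).hasFDerivAt.prodMk
        (differentiableAt_of_contDiffOn hΩ hb hq).hasFDerivAt).fderiv
    have hinj : Function.Injective (A : (ℝ × ℝ) →ₗ[ℝ] (ℝ × ℝ)) := by
      rw [← LinearMap.ker_eq_bot, LinearMap.ker_eq_bot']
      rintro ⟨r, s⟩ h
      have hrs : ((r, s) : ℝ × ℝ) = r • coordVec 0 + s • coordVec 1 := by simp [coordVec]
      have h' : A (r, s) = 0 := h
      rw [hrs, hA', map_add, map_smul, map_smul] at h'
      have h1 : r * pd 0 a q + s * pd 1 a q = 0 := congrArg Prod.fst h'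
      have h2 : r * pd 0 b q + s * pd 1 b q = 0 := congrArg Prod.snd h'
      have hr : r * (pd 0 a q * pd 1 b q - pd 1 a q * pd 0 b q) = 0 := by
        linear_combination pd 1 b q * h1 - pd 1 a q * h2
      have hs' : s * (pd 0 a q * pd 1 b q - pd 1 a q * pd 0 b q) = 0 := by
        linear_combination pd 0 a q * h2 - pd 0 b q * h1
      have hj := hJ q hq
      simp [(mul_eq_zero.1 hr).resolve_right hj, (mul_eq_zero.1 hs').resolve_right hj]
    refine ⟨(LinearEquiv.ofInjectiveEndo _ hinj).toContinuousLinearEquiv, ?_⟩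
    have hLA : ((LinearEquiv.ofInjectiveEndo _ hinj).toContinuousLinearEquiv :
        (ℝ × ℝ) →L[ℝ] (ℝ × ℝ)) = A := ContinuousLinearMap.ext fun _ => rfl
    rw [hLA]
    exact hd
  obtain ⟨L, hL⟩ := hder q₀ hq₀
  set φ₀ := (hs.contDiffAt (hΩ.mem_nhds hq₀)).toOpenPartialHomeomorph _ hL (by simp) with hφ₀
  have hφ₀c : (φ₀ : ℝ × ℝ → ℝ × ℝ) = fun q => (a q, b q) := rfl
  refine ⟨φ₀.restrOpen Ω hΩ, ⟨ContDiffAt.mem_toOpenPartialHomeomorph_source _ _ _, hq₀⟩, ?_, ?_, ?_⟩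
  · rw [OpenPartialHomeomorph.restrOpen_source]; exact inter_subset_right
  · intro q; rfl
  · intro p hp
    apply ContDiffAt.contDiffWithinAt
    have hpΩ : (φ₀.restrOpen Ω hΩ).symm p ∈ Ω := by
      have := (φ₀.restrOpen Ω hΩ).map_target hp
      rw [OpenPartialHomeomorph.restrOpen_source] at this
      exact this.2
    obtain ⟨L', hL'⟩ := hder _ hpΩ
    exact (φ₀.restrOpen Ω hΩ).contDiffAt_symm hp hL' (hs.contDiffAt (hΩ.mem_nhds hpΩ))

/-! ### First integrals of a direction field in the plane -/

/-- Near each point, the direction field `∂₀ + l ∂₁` has a smooth first integral `u` with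
`∂₁ u ≠ 0`. -/
lemma exists_firstIntegral {Ω : Set (ℝ × ℝ)} (hΩ : IsOpen Ω) {l : ℝ × ℝ → ℝ}
    (hl : ContDiffOn ℝ ∞ l Ω) {q₀ : ℝ × ℝ} (hq₀ : q₀ ∈ Ω) :
    ∃ (N : Set (ℝ × ℝ)) (u : ℝ × ℝ → ℝ), IsOpen N ∧ q₀ ∈ N ∧ N ⊆ Ω ∧ ContDiffOn ℝ ∞ u N ∧
      ∀ q ∈ N, pd 0 u q + l q * pd 1 u q = 0 ∧ pd 1 u q ≠ 0 := by
  obtain ⟨r, hr, hrΩ⟩ := Metric.isOpen_iff.1 hΩ q₀ hq₀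
  let χ : ContDiffBump q₀ := ⟨r / 4, r / 2, by linarith, by linarith⟩
  have hχΩ : tsupport χ ⊆ Ω := by
    rw [χ.tsupport_eq]
    exact (Metric.closedBall_subset_ball (by change r / 2 < r; linarith)).trans hrΩ
  set f : ℝ × ℝ → ℝ := fun q => χ q * l q with hfdef
  have hfs : ContDiff ℝ ∞ f := by
    rw [contDiff_iff_contDiffAt]
    intro x
    by_cases hx : x ∈ Ω
    · exact χ.contDiff.contDiffAt.mul (hl.contDiffAt (hΩ.mem_nhds hx))
    · have hx' : x ∉ tsupport χ := fun h => hx (hχΩ h)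
      have h0 : f =ᶠ[𝓝 x] fun _ => 0 := by
        filter_upwards [notMem_tsupport_iff_eventuallyEq.1 hx'] with z hz
        simp only [hfdef, hz]; simp
      exact contDiffAt_const.congr_of_eventuallyEq h0
  have hfc : HasCompactSupport f := χ.hasCompactSupport.mul_right
  obtain ⟨x₀, y₀⟩ := q₀
  obtain ⟨Y, hYs, hY0, hY⟩ := exists_flow hfs hfc x₀ y₀
  set B := Ioo (x₀ - 1) (x₀ + 1) ×ˢ Ioo (y₀ - 1) (y₀ + 1) with hB
  have hBo : IsOpen B := isOpen_Ioo.prod isOpen_Ioo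
  have hq₀B : ((x₀, y₀) : ℝ × ℝ) ∈ B := by
    refine ⟨⟨?_, ?_⟩, ?_, ?_⟩ <;> simp
  obtain ⟨φ, hφ0, hφB, hφ, hφs⟩ := exists_localDiffeo hBo (a := fun q => q.1) (b := Y)
    contDiffOn_fst hYs (fun q hq => by
      rw [pd_fst, pd_fst]; simpa using (hY q hq).2.ne') hq₀B
  set O : Set (ℝ × ℝ) := φ.target ∩ Metric.ball (x₀, y₀) (r / 4) with hO
  have hOo : IsOpen O := φ.open_target.inter Metric.isOpen_ball
  have hφq : φ (x₀, y₀) = (x₀, y₀) := by rw [hφ, hY0 y₀ hq₀B.2]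
  refine ⟨O, fun p => (φ.symm p).2, hOo, ⟨?_, Metric.mem_ball_self (by linarith)⟩, ?_, ?_, ?_⟩
  · rw [← hφq]; exact φ.map_source hφ0
  · exact inter_subset_right.trans ((Metric.ball_subset_ball (by linarith)).trans hrΩ)
  · exact (contDiff_snd.comp_contDiffOn hφs).mono inter_subset_left
  · intro p hp
    set q := φ.symm p with hq
    have hqs : q ∈ φ.source := φ.map_target hp.1
    have hpq : (q.1, Y q) = p := by rw [← hφ q]; exact φ.right_inv hp.1
    have hus : DifferentiableAt ℝ (fun p => (φ.symm p).2) p :=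
      differentiableAt_of_contDiffOn φ.open_target (contDiff_snd.comp_contDiffOn hφs) hp.1
    have hYd : DifferentiableAt ℝ Y q := differentiableAt_of_contDiffOn hBo hYs (hφB hqs)
    -- the identity `u (x, Y (x, y)) = y` is differentiated
    have hid : EqOn (fun z : ℝ × ℝ => (φ.symm (z.1, Y z)).2) (fun z => z.2) φ.source := by
      intro z hz
      simp only
      rw [← hφ z, φ.left_inv hz]
    have hchain : ∀ i, pd i (fun z : ℝ × ℝ => z.1) q * pd 0 (fun p => (φ.symm p).2) p
        + pd i Y q * pd 1 (fun p => (φ.symm p).2) p = pd i (fun z : ℝ × ℝ => z.2) q := by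
      intro i
      rw [← pd_congr φ.open_source hid i hqs]
      rw [← hpq] at hus
      rw [pd_comp (f := fun p => (φ.symm p).2) differentiableAt_fst hYd hus, hpq]
      rfl
    have h0 := hchain 0
    have h1 := hchain 1
    have hY0' : pd 0 Y q = l p := by
      rw [(hasDerivAt_slice_zero hYd).unique (hY q (hφB hqs)).1, hpq, hfdef]
      have : χ p = 1 := χ.one_of_mem_closedBall (Metric.ball_subset_closedBall hp.2)
      simp [this]
    simp only [pd_fst, pd_snd, hY0', if_true, one_mul] at h0 h1
    refine ⟨by simpa using h0, fun hcon => ?_⟩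
    rw [hcon] at h1
    simp at h1

end QuasiMinimal
end

noncomputable section
namespace QuasiMinimal
open Set

/-! ### Christoffel symbols of induced metrics and the Gauss equation -/

section Christoffel

variable {Ω : Set (ℝ × ℝ)} {F : ℝ × ℝ → E42} {q : ℝ × ℝ}

lemma inducedMetric_apply (F : ℝ × ℝ → E42) (q : ℝ × ℝ) (i j : Fin 2) :
    inducedMetric F q i j = ip (pd i F q) (pd j F q) := rfl

lemma inducedMetric_symm (F : ℝ × ℝ → E42) (q : ℝ × ℝ) (i j : Fin 2) :
    inducedMetric F q i j = inducedMetric F q j i := ip_comm _ _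

lemma det_inducedMetric (F : ℝ × ℝ → E42) (q : ℝ × ℝ) :
    (inducedMetric F q).det = inducedMetric F q 0 0 * inducedMetric F q 1 1
      - inducedMetric F q 0 1 * inducedMetric F q 0 1 := by
  rw [Matrix.det_fin_two, inducedMetric_symm F q 1 0]

lemma contDiffOn_inducedMetric (hΩ : IsOpen Ω) (hF : ContDiffOn ℝ ∞ F Ω) (i j : Fin 2) :
    ContDiffOn ℝ ∞ (fun x => inducedMetric F x i j) Ω :=
  contDiffOn_ip (contDiffOn_pd hΩ hF i) (contDiffOn_pd hΩ hF j)

lemma contDiffOn_inv_apply {g : ℝ × ℝ → Matrix (Fin 2) (Fin 2) ℝ}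
    (hg : ∀ i j, ContDiffOn ℝ ∞ (fun x => g x i j) Ω) (hdet : ∀ x ∈ Ω, (g x).det ≠ 0)
    (i j : Fin 2) : ContDiffOn ℝ ∞ (fun x => (g x)⁻¹ i j) Ω := by
  have hd : ContDiffOn ℝ ∞ (fun x => (g x).det⁻¹) Ω := by
    refine ContDiffOn.inv ?_ hdet
    simp only [Matrix.det_fin_two]
    exact ((hg 0 0).mul (hg 1 1)).sub ((hg 0 1).mul (hg 1 0))
  have h : ∀ x, (g x)⁻¹ = (g x).det⁻¹ • !![g x 1 1, -g x 0 1; -g x 1 0, g x 0 0] := by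
    intro x
    rw [Matrix.inv_def, Ring.inverse_eq_inv', Matrix.adjugate_fin_two]
  simp only [h, Matrix.smul_apply, smul_eq_mul]
  refine hd.mul ?_
  fin_cases i <;> fin_cases j
  · exact hg 1 1
  · exact (hg 0 1).neg
  · exact (hg 1 0).neg
  · exact hg 0 0

lemma contDiffOn_christoffel {g : ℝ × ℝ → Matrix (Fin 2) (Fin 2) ℝ} (hΩ : IsOpen Ω)
    (hg : ∀ i j, ContDiffOn ℝ ∞ (fun x => g x i j) Ω) (hdet : ∀ x ∈ Ω, (g x).det ≠ 0)
    (k i j : Fin 2) : ContDiffOn ℝ ∞ (christoffel g k i j) Ω := by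
  refine contDiffOn_const.mul (ContDiffOn.sum fun l _ => ?_)
  exact (contDiffOn_inv_apply hg hdet k l).mul
    (((contDiffOn_pd hΩ (hg j l) i).add (contDiffOn_pd hΩ (hg i l) j)).sub
      (contDiffOn_pd hΩ (hg i j) l))

/-- The Levi-Civita connection of the induced metric is the tangential part of the flat
connection. -/
lemma sum_christoffel_mul (hΩ : IsOpen Ω) (hF : ContDiffOn ℝ ∞ F Ω) (hq : q ∈ Ω)
    (hdet : (inducedMetric F q).det ≠ 0) (i j l : Fin 2) :
    ∑ k, christoffel (inducedMetric F) k i j q * inducedMetric F q k l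
      = ip (pd i (pd j F) q) (pd l F q) := by
  have hd : ∀ k, DifferentiableAt ℝ (pd k F) q := fun k =>
    differentiableAt_of_contDiffOn hΩ (contDiffOn_pd hΩ hF k) hq
  have hc : ∀ n, pd i (fun x => inducedMetric F x j n) q + pd j (fun x => inducedMetric F x i n) q
      - pd n (fun x => inducedMetric F x i j) q = 2 * ip (pd i (pd j F) q) (pd n F q) := by
    intro n
    simp only [inducedMetric_apply]
    rw [pd_ip (hd _) (hd _), pd_ip (hd _) (hd _), pd_ip (hd _) (hd _), pd_comm hΩ hF hq n i,
      pd_comm hΩ hF hq j i, pd_comm hΩ hF hq n j, ip_comm (pd j F q), ip_comm (pd i F q) (pd j _ q)]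
    ring
  have hinv : inducedMetric F q * (inducedMetric F q)⁻¹ = 1 :=
    Matrix.mul_nonsing_inv _ (isUnit_iff_ne_zero.2 hdet)
  have hinv' : ∀ n, ∑ k, inducedMetric F q l k * (inducedMetric F q)⁻¹ k n = if l = n then 1 else 0 := by
    intro n
    rw [← Matrix.mul_apply, hinv, Matrix.one_apply]
  simp only [christoffel, hc]
  have h0 := hinv' 0
  have h1 := hinv' 1
  rw [Fin.sum_univ_two] at h0 h1
  simp only [Fin.sum_univ_two, inducedMetric_symm F q _ l]
  fin_cases l
  · simp at h0 h1
    simp only [Fin.zero_eta]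
    linear_combination ip (pd i (pd j F) q) (pd 0 F q) * h0 + ip (pd i (pd j F) q) (pd 1 F q) * h1
  · simp at h0 h1
    simp only [Fin.mk_one]
    linear_combination ip (pd i (pd j F) q) (pd 0 F q) * h0 + ip (pd i (pd j F) q) (pd 1 F q) * h1

lemma ip_secondFundForm_pd (hΩ : IsOpen Ω) (hF : ContDiffOn ℝ ∞ F Ω) (hq : q ∈ Ω)
    (hdet : (inducedMetric F q).det ≠ 0) (i j l : Fin 2) :
    ip (secondFundForm F i j q) (pd l F q) = 0 := by
  have h := sum_christoffel_mul hΩ hF hq hdet i j l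
  simp only [secondFundForm, secondCovDeriv, Fin.sum_univ_two, inducedMetric_apply, ip_sub_left,
    ip_add_left, ip_smul_left] at h ⊢
  linear_combination -h

lemma contDiffOn_secondFundForm (hΩ : IsOpen Ω) (hF : ContDiffOn ℝ ∞ F Ω)
    (hdet : ∀ x ∈ Ω, (inducedMetric F x).det ≠ 0) (i j : Fin 2) :
    ContDiffOn ℝ ∞ (secondFundForm F i j) Ω :=
  (contDiffOn_pd hΩ (contDiffOn_pd hΩ hF j) i).sub (ContDiffOn.sum fun k _ =>
    (contDiffOn_christoffel hΩ (contDiffOn_inducedMetric hΩ hF) hdet k i j).smul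
      (contDiffOn_pd hΩ hF k))

lemma secondFundForm_comm (hΩ : IsOpen Ω) (hF : ContDiffOn ℝ ∞ F Ω) (hq : q ∈ Ω) :
    secondFundForm F 1 0 q = secondFundForm F 0 1 q := by
  have hc : ∀ k, christoffel (inducedMetric F) k 1 0 q = christoffel (inducedMetric F) k 0 1 q := by
    intro k
    have e : ∀ x, inducedMetric F x 1 0 = inducedMetric F x 0 1 := fun x =>
      inducedMetric_symm F x 1 0
    simp only [christoffel, e]
    congr 1
    refine Finset.sum_congr rfl fun l _ => ?_
    ring
  simp only [secondFundForm, secondCovDeriv, hc, pd_comm hΩ hF hq 1 0]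

/-- The Gauss equation. -/
lemma gauss_equation (hΩ : IsOpen Ω) (hF : ContDiffOn ℝ ∞ F Ω)
    (hdet : ∀ x ∈ Ω, (inducedMetric F x).det ≠ 0) (hq : q ∈ Ω) :
    metricGaussCurvature (inducedMetric F) q
      = (ip (secondFundForm F 0 0 q) (secondFundForm F 1 1 q)
        - ip (secondFundForm F 0 1 q) (secondFundForm F 0 1 q)) / (inducedMetric F q).det := by
  have hα := contDiffOn_secondFundForm hΩ hF hdet
  have hF1 := contDiffOn_pd hΩ hF
  have hΓ := contDiffOn_christoffel hΩ (contDiffOn_inducedMetric hΩ hF) hdet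
  have hn := fun i j l => ip_secondFundForm_pd hΩ hF hq (hdet q hq) i j l
  have hdα : ∀ i j, DifferentiableAt ℝ (secondFundForm F i j) q := fun i j =>
    differentiableAt_of_contDiffOn hΩ (hα i j) hq
  have hdF : ∀ i, DifferentiableAt ℝ (pd i F) q := fun i =>
    differentiableAt_of_contDiffOn hΩ (hF1 i) hq
  have hdΓ : ∀ k i j, DifferentiableAt ℝ (christoffel (inducedMetric F) k i j) q := fun k i j =>
    differentiableAt_of_contDiffOn hΩ (hΓ k i j) hq
  -- the third derivatives of `F`, through the Gauss formula
  have hthird : ∀ i j k, pd i (pd j (pd k F)) q = pd i (secondFundForm F j k) q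
      + (pd i (christoffel (inducedMetric F) 0 j k) q • pd 0 F q
        + christoffel (inducedMetric F) 0 j k q • pd i (pd 0 F) q)
      + (pd i (christoffel (inducedMetric F) 1 j k) q • pd 1 F q
        + christoffel (inducedMetric F) 1 j k q • pd i (pd 1 F) q) := by
    intro i j k
    have : pd j (pd k F) = fun x => secondFundForm F j k x
        + christoffel (inducedMetric F) 0 j k x • pd 0 F x
        + christoffel (inducedMetric F) 1 j k x • pd 1 F x := by
      funext x
      simp only [secondFundForm, secondCovDeriv, Fin.sum_univ_two]
      abel
    rw [this, pd_add ((hdα j k).fun_add ((hdΓ 0 j k).fun_smul (hdF 0)))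
        ((hdΓ 1 j k).fun_smul (hdF 1)),
      pd_add (hdα j k) ((hdΓ 0 j k).fun_smul (hdF 0)), pd_smul (hdΓ 0 j k) (hdF 0),
      pd_smul (hdΓ 1 j k) (hdF 1)]
  have hsym : pd 0 (pd 1 (pd 1 F)) q = pd 1 (pd 0 (pd 1 F)) q := pd_comm hΩ (hF1 1) hq 0 1
  rw [hthird, hthird] at hsym
  have hn' : ∀ i j k l, ip (pd i (secondFundForm F j k) q) (pd l F q)
      = -ip (secondFundForm F j k q) (pd i (pd l F) q) := fun i j k l => by
    have := pd_ip_of_const hΩ (hα j k) (hF1 l)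
      (fun x hx => ip_secondFundForm_pd hΩ hF hx (hdet x hx) j k l) hq i
    linear_combination this
  have hnn : ∀ i j l m, ip (secondFundForm F i j q) (pd l (pd m F) q)
      = ip (secondFundForm F i j q) (secondFundForm F l m q) := by
    intro i j l m
    have h0 := hn i j 0
    have h1 := hn i j 1
    simp only [secondFundForm, secondCovDeriv, Fin.sum_univ_two, ip_sub_right,
      ip_add_right, ip_smul_right] at h0 h1 ⊢
    rw [h0, h1]; ring
  have hsc := fun i j => sum_christoffel_mul hΩ hF hq (hdet q hq) i j 0
  simp only [Fin.sum_univ_two] at hsc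
  have h := congrArg (fun v => ip v (pd 0 F q)) hsym
  simp only [ip_add_left, ip_smul_left, hn', hnn, ← hsc,
    ← inducedMetric_apply] at h
  rw [secondFundForm_comm hΩ hF hq, ip_comm (secondFundForm F 1 1 q)] at h
  rw [metricGaussCurvature]
  congr 1
  simp only [Fin.sum_univ_two, riemann]
  linear_combination h

end Christoffel

/-! ### Change of coordinates -/

/-- The trace `gⁱʲ (∇²V)ᵢⱼ` of the second covariant derivative. -/
def lap (g : ℝ × ℝ → Matrix (Fin 2) (Fin 2) ℝ) (V : ℝ × ℝ → E42) (q : ℝ × ℝ) : E42 :=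
  ∑ i, ∑ j, (g q)⁻¹ i j • secondCovDeriv g V i j q

lemma meanCurvature_eq_lap (F : ℝ × ℝ → E42) :
    meanCurvature F = fun q => (1 / 2 : ℝ) • lap (inducedMetric F) F q := rfl

lemma tension_eq_lap (F : ℝ × ℝ → E42) : tension F = fun q => -lap (inducedMetric F) F q := rfl

lemma bitension_eq_lap (F : ℝ × ℝ → E42) (q : ℝ × ℝ) :
    bitension F q = lap (inducedMetric F) (tension F) q := by
  simp [bitension, roughLaplacian, lap]

lemma lap_const_smul (g : ℝ × ℝ → Matrix (Fin 2) (Fin 2) ℝ) (c : ℝ) (V : ℝ × ℝ → E42) (q : ℝ × ℝ) :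
    lap g (fun x => c • V x) q = c • lap g V q := by
  have h1 : ∀ i, pd i (fun x => c • V x) = fun x => c • pd i V x := fun i =>
    funext fun x => pd_const_smul c V i
  have h2 : ∀ i j, secondCovDeriv g (fun x => c • V x) i j q = c • secondCovDeriv g V i j q := by
    intro i j
    simp only [secondCovDeriv, h1, pd_const_smul, Fin.sum_univ_two]
    module
  simp only [lap, h2, Fin.sum_univ_two]
  module

/-- The bitension field is minus twice the trace Laplacian of the mean curvature vector. -/
lemma bitension_eq_lap_meanCurvature (F : ℝ × ℝ → E42) (q : ℝ × ℝ) :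
    bitension F q = (-2 : ℝ) • lap (inducedMetric F) (meanCurvature F) q := by
  have h : tension F = fun x => (-2 : ℝ) • meanCurvature F x := by
    funext x
    rw [meanCurvature_eq_lap, tension_eq_lap]
    module
  rw [bitension_eq_lap, h, lap_const_smul]

lemma lap_congr {g : ℝ × ℝ → Matrix (Fin 2) (Fin 2) ℝ} {V V' : ℝ × ℝ → E42} {Ω : Set (ℝ × ℝ)}
    (hΩ : IsOpen Ω) (h : EqOn V V' Ω) {q : ℝ × ℝ} (hq : q ∈ Ω) : lap g V q = lap g V' q := by
  simp only [lap, secondCovDeriv, pd_congr hΩ h _ hq,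
    pd_congr hΩ (pd_congr hΩ h _) _ hq]

lemma inducedMetric_congr {F G : ℝ × ℝ → E42} {Ω : Set (ℝ × ℝ)} (hΩ : IsOpen Ω) (h : EqOn F G Ω) :
    EqOn (inducedMetric F) (inducedMetric G) Ω := fun q hq => by
  simp only [inducedMetric, pd_congr hΩ h _ hq]

lemma christoffel_congr {g g' : ℝ × ℝ → Matrix (Fin 2) (Fin 2) ℝ} {Ω : Set (ℝ × ℝ)}
    (hΩ : IsOpen Ω) (h : EqOn g g' Ω) (k i j : Fin 2) :
    EqOn (christoffel g k i j) (christoffel g' k i j) Ω := fun q hq => by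
  have h' : ∀ i j, EqOn (fun x => g x i j) (fun x => g' x i j) Ω := fun i j x hx => by
    simp only [h hx]
  simp only [christoffel, pd_congr hΩ (h' _ _) _ hq, h hq]

lemma lap_congr_metric {g g' : ℝ × ℝ → Matrix (Fin 2) (Fin 2) ℝ} {V : ℝ × ℝ → E42}
    {Ω : Set (ℝ × ℝ)} (hΩ : IsOpen Ω) (h : EqOn g g' Ω) {q : ℝ × ℝ} (hq : q ∈ Ω) :
    lap g V q = lap g' V q := by
  simp only [lap, secondCovDeriv, christoffel_congr hΩ h _ _ _ hq, h hq]

lemma metricGaussCurvature_congr {g g' : ℝ × ℝ → Matrix (Fin 2) (Fin 2) ℝ} {Ω : Set (ℝ × ℝ)}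
    (hΩ : IsOpen Ω) (h : EqOn g g' Ω) :
    EqOn (metricGaussCurvature g) (metricGaussCurvature g') Ω := fun q hq => by
  simp only [metricGaussCurvature, riemann, christoffel_congr hΩ h _ _ _ hq,
    pd_congr hΩ (christoffel_congr hΩ h _ _ _) _ hq, h hq]

lemma meanCurvature_congr {F G : ℝ × ℝ → E42} {Ω : Set (ℝ × ℝ)} (hΩ : IsOpen Ω) (h : EqOn F G Ω) :
    EqOn (meanCurvature F) (meanCurvature G) Ω := fun q hq => by
  simp only [meanCurvature_eq_lap, lap_congr_metric hΩ (inducedMetric_congr hΩ h) hq,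
    lap_congr hΩ h hq]

lemma bitension_congr {F G : ℝ × ℝ → E42} {Ω : Set (ℝ × ℝ)} (hΩ : IsOpen Ω) (h : EqOn F G Ω) :
    EqOn (bitension F) (bitension G) Ω := fun q hq => by
  simp only [bitension_eq_lap_meanCurvature, lap_congr_metric hΩ (inducedMetric_congr hΩ h) hq,
    lap_congr hΩ (meanCurvature_congr hΩ h) hq]

/-- `x ↦ (a x, b x)` is a smooth map from the open set `Ω'` to the open set `Ω` with nowhere
vanishing Jacobian determinant. -/
structure IsCoordChange (Ω' Ω : Set (ℝ × ℝ)) (a b : ℝ × ℝ → ℝ) : Prop where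
  isOpen_source : IsOpen Ω'
  isOpen_target : IsOpen Ω
  smooth_fst : ContDiffOn ℝ ∞ a Ω'
  smooth_snd : ContDiffOn ℝ ∞ b Ω'
  mapsTo : ∀ x ∈ Ω', (a x, b x) ∈ Ω
  jac_ne_zero : ∀ x ∈ Ω', pd 0 a x * pd 1 b x - pd 1 a x * pd 0 b x ≠ 0

namespace IsCoordChange

variable {Ω' Ω : Set (ℝ × ℝ)} {a b : ℝ × ℝ → ℝ} (h : IsCoordChange Ω' Ω a b)
variable {F V : ℝ × ℝ → E42} {q : ℝ × ℝ}
include h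

lemma contDiffOn_comp {W : Type*} [NormedAddCommGroup W] [NormedSpace ℝ W] {V : ℝ × ℝ → W}
    (hV : ContDiffOn ℝ ∞ V Ω) : ContDiffOn ℝ ∞ (fun x => V (a x, b x)) Ω' :=
  hV.comp (h.smooth_fst.prodMk h.smooth_snd) h.mapsTo

lemma pd_comp_eq {W : Type*} [NormedAddCommGroup W] [NormedSpace ℝ W] {V : ℝ × ℝ → W}
    (hV : ContDiffOn ℝ ∞ V Ω) (hq : q ∈ Ω') (i : Fin 2) :
    pd i (fun x => V (a x, b x)) q
      = pd i a q • pd 0 V (a q, b q) + pd i b q • pd 1 V (a q, b q) :=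
  pd_comp (differentiableAt_of_contDiffOn h.isOpen_source h.smooth_fst hq)
    (differentiableAt_of_contDiffOn h.isOpen_source h.smooth_snd hq)
    (differentiableAt_of_contDiffOn h.isOpen_target hV (h.mapsTo q hq)) i

lemma pd_pd_comp_eq (hV : ContDiffOn ℝ ∞ V Ω) (hq : q ∈ Ω') (i j : Fin 2) :
    pd i (pd j (fun x => V (a x, b x))) q
      = pd i (pd j a) q • pd 0 V (a q, b q) + pd i (pd j b) q • pd 1 V (a q, b q)
        + pd j a q • (pd i a q • pd 0 (pd 0 V) (a q, b q) + pd i b q • pd 1 (pd 0 V) (a q, b q))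
        + pd j b q • (pd i a q • pd 0 (pd 1 V) (a q, b q) + pd i b q • pd 1 (pd 1 V) (a q, b q)) := by
  have hV1 := contDiffOn_pd h.isOpen_target hV
  have hd : ∀ {W : Type} [NormedAddCommGroup W] [NormedSpace ℝ W] {f : ℝ × ℝ → W},
      ContDiffOn ℝ ∞ f Ω' → DifferentiableAt ℝ f q := fun hf =>
    differentiableAt_of_contDiffOn h.isOpen_source hf hq
  have ha := hd (contDiffOn_pd h.isOpen_source h.smooth_fst j)
  have hb := hd (contDiffOn_pd h.isOpen_source h.smooth_snd j)
  have h0 := hd (h.contDiffOn_comp (hV1 0))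
  have h1 := hd (h.contDiffOn_comp (hV1 1))
  rw [pd_congr h.isOpen_source (fun x hx => h.pd_comp_eq hV hx j) i hq,
    pd_add (ha.fun_smul h0) (hb.fun_smul h1), pd_smul ha h0, pd_smul hb h1, h.pd_comp_eq (hV1 0) hq,
    h.pd_comp_eq (hV1 1) hq]
  abel

lemma inducedMetric_comp (hF : ContDiffOn ℝ ∞ F Ω) (hq : q ∈ Ω') (i j : Fin 2) :
    inducedMetric (fun x => F (a x, b x)) q i j
      = pd i a q * pd j a q * inducedMetric F (a q, b q) 0 0
        + (pd i a q * pd j b q + pd i b q * pd j a q) * inducedMetric F (a q, b q) 0 1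
        + pd i b q * pd j b q * inducedMetric F (a q, b q) 1 1 := by
  rw [inducedMetric_apply, h.pd_comp_eq hF hq, h.pd_comp_eq hF hq]
  simp only [ip_add_left, ip_add_right, ip_smul_left, ip_smul_right, inducedMetric_apply,
    ip_comm (pd 1 F (a q, b q)) (pd 0 F (a q, b q))]
  ring

lemma det_inducedMetric_comp (hF : ContDiffOn ℝ ∞ F Ω) (hq : q ∈ Ω') :
    (inducedMetric (fun x => F (a x, b x)) q).det
      = (pd 0 a q * pd 1 b q - pd 1 a q * pd 0 b q) ^ 2 * (inducedMetric F (a q, b q)).det := by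
  simp only [det_inducedMetric, h.inducedMetric_comp hF hq]
  ring

/-- The second covariant derivative with respect to the induced metric is a tensor. -/
lemma secondCovDeriv_comp (hF : ContDiffOn ℝ ∞ F Ω) (hV : ContDiffOn ℝ ∞ V Ω) (hq : q ∈ Ω')
    (hdet : (inducedMetric F (a q, b q)).det ≠ 0) (i j : Fin 2) :
    secondCovDeriv (inducedMetric fun x => F (a x, b x)) (fun x => V (a x, b x)) i j q
      = (pd i a q * pd j a q) • secondCovDeriv (inducedMetric F) V 0 0 (a q, b q)
        + (pd i a q * pd j b q) • secondCovDeriv (inducedMetric F) V 0 1 (a q, b q)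
        + (pd i b q * pd j a q) • secondCovDeriv (inducedMetric F) V 1 0 (a q, b q)
        + (pd i b q * pd j b q) • secondCovDeriv (inducedMetric F) V 1 1 (a q, b q) := by
  set p : ℝ × ℝ := (a q, b q) with hp
  have hpΩ : p ∈ Ω := h.mapsTo q hq
  set G : ℝ × ℝ → E42 := fun x => F (a x, b x) with hG
  have hjac := h.jac_ne_zero q hq
  have hGs : ContDiffOn ℝ ∞ G Ω' := h.contDiffOn_comp hF
  have hGdet : (inducedMetric G q).det ≠ 0 := by
    rw [h.det_inducedMetric_comp hF hq]
    exact mul_ne_zero (pow_ne_zero 2 hjac) hdet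
  set X : Fin 2 → ℝ := fun n => christoffel (inducedMetric G) n i j q with hX
  set Γ : Fin 2 → Fin 2 → Fin 2 → ℝ := fun k l m => christoffel (inducedMetric F) k l m p with hΓ
  -- the transformation law of the Christoffel symbols, up to the error `D`
  set D : (ℝ × ℝ → ℝ) → Fin 2 → ℝ := fun c k => pd i (pd j c) q
    + pd i a q * pd j a q * Γ k 0 0 + pd i a q * pd j b q * Γ k 0 1 + pd i b q * pd j a q * Γ k 1 0
    + pd i b q * pd j b q * Γ k 1 1 - X 0 * pd 0 c q - X 1 * pd 1 c q with hD
  have hE : ∀ r, ip (D a 0 • pd 0 F p + D b 1 • pd 1 F p) (pd r G q) = 0 := by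
    have hs := fun l m s => sum_christoffel_mul h.isOpen_target hF hpΩ hdet l m s
    simp only [Fin.sum_univ_two, inducedMetric_apply] at hs
    intro r
    have hr := sum_christoffel_mul h.isOpen_source hGs hq hGdet i j r
    simp only [Fin.sum_univ_two, inducedMetric_apply] at hr
    have hG1 : ∀ n, pd n G q = pd n a q • pd 0 F p + pd n b q • pd 1 F p := fun n =>
      h.pd_comp_eq hF hq n
    rw [h.pd_pd_comp_eq hF hq, hG1, hG1, hG1] at hr
    rw [hG1]
    simp only [ip_add_left, ip_add_right, ip_smul_left, ip_smul_right, ← hp, ← hs, hD, hX,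
      hΓ] at hr ⊢
    linear_combination -hr
  set U : E42 := D a 0 • pd 0 F p + D b 1 • pd 1 F p with hU
  have hE0 : ip U (pd 0 F p) = 0 ∧ ip U (pd 1 F p) = 0 := by
    have e0 := hE 0
    have e1 := hE 1
    rw [h.pd_comp_eq hF hq, ip_add_right, ip_smul_right, ip_smul_right, ← hp] at e0 e1
    constructor
    · refine (mul_eq_zero.1 ?_).resolve_left hjac
      linear_combination pd 1 b q * e0 - pd 0 b q * e1
    · refine (mul_eq_zero.1 ?_).resolve_left hjac
      linear_combination pd 0 a q * e1 - pd 1 a q * e0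
  have hD0 : D a 0 = 0 ∧ D b 1 = 0 := by
    obtain ⟨e0, e1⟩ := hE0
    rw [det_inducedMetric] at hdet
    simp only [hU, ip_add_left, ip_smul_left, ← inducedMetric_apply] at e0 e1
    rw [inducedMetric_symm F p 1 0] at e0
    constructor
    · refine (mul_eq_zero.1 ?_).resolve_right hdet
      linear_combination inducedMetric F p 1 1 * e0 - inducedMetric F p 0 1 * e1
    · refine (mul_eq_zero.1 ?_).resolve_right hdet
      linear_combination inducedMetric F p 0 0 * e1 - inducedMetric F p 0 1 * e0
  have hV1 : ∀ n, pd n (fun x => V (a x, b x)) q = pd n a q • pd 0 V p + pd n b q • pd 1 V p :=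
    fun n => h.pd_comp_eq hV hq n
  have ea : pd i (pd j a) q = X 0 * pd 0 a q + X 1 * pd 1 a q - (pd i a q * pd j a q * Γ 0 0 0
      + pd i a q * pd j b q * Γ 0 0 1 + pd i b q * pd j a q * Γ 0 1 0
      + pd i b q * pd j b q * Γ 0 1 1) := by
    have := hD0.1
    simp only [hD] at this
    linear_combination this
  have eb : pd i (pd j b) q = X 0 * pd 0 b q + X 1 * pd 1 b q - (pd i a q * pd j a q * Γ 1 0 0
      + pd i a q * pd j b q * Γ 1 0 1 + pd i b q * pd j a q * Γ 1 1 0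
      + pd i b q * pd j b q * Γ 1 1 1) := by
    have := hD0.2
    simp only [hD] at this
    linear_combination this
  simp only [secondCovDeriv, Fin.sum_univ_two, h.pd_pd_comp_eq hV hq, hV1, ← hp, ea, eb]
  module

/-- The trace Laplacian of the induced metric does not depend on the coordinates. -/
lemma lap_comp (hF : ContDiffOn ℝ ∞ F Ω) (hV : ContDiffOn ℝ ∞ V Ω) (hq : q ∈ Ω')
    (hdet : (inducedMetric F (a q, b q)).det ≠ 0) :
    lap (inducedMetric fun x => F (a x, b x)) (fun x => V (a x, b x)) q
      = lap (inducedMetric F) V (a q, b q) := by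
  set J : Matrix (Fin 2) (Fin 2) ℝ := !![pd 0 a q, pd 0 b q; pd 1 a q, pd 1 b q] with hJ
  have hJd : IsUnit J.det := by
    rw [isUnit_iff_ne_zero, hJ, Matrix.det_fin_two_of]
    have := h.jac_ne_zero q hq
    intro hc
    apply this
    linear_combination hc
  have hg : inducedMetric (fun x => F (a x, b x)) q = J * inducedMetric F (a q, b q) * J.transpose := by
    ext i j
    rw [h.inducedMetric_comp hF hq]
    simp only [Matrix.mul_apply, Fin.sum_univ_two, Matrix.transpose_apply,
      inducedMetric_symm F _ 1 0]
    fin_cases i <;> fin_cases j <;> simp [hJ] <;> ring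
  have hinv : (inducedMetric F (a q, b q))⁻¹
      = J.transpose * (inducedMetric (fun x => F (a x, b x)) q)⁻¹ * J := by
    rw [hg, Matrix.mul_inv_rev, Matrix.mul_inv_rev]
    have hJt : IsUnit J.transpose.det := by rwa [Matrix.det_transpose]
    rw [← Matrix.mul_assoc, Matrix.mul_nonsing_inv _ hJt, Matrix.one_mul, Matrix.mul_assoc,
      Matrix.nonsing_inv_mul _ hJd, Matrix.mul_one]
  simp only [lap, h.secondCovDeriv_comp hF hV hq hdet, hinv, Fin.sum_univ_two, Matrix.mul_apply,
    Matrix.transpose_apply]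
  simp only [hJ, Matrix.of_apply, Matrix.cons_val_zero, Matrix.cons_val_one, Matrix.cons_val',
    Matrix.cons_val_fin_one]
  module

lemma meanCurvature_comp (hF : ContDiffOn ℝ ∞ F Ω) (hq : q ∈ Ω')
    (hdet : (inducedMetric F (a q, b q)).det ≠ 0) :
    meanCurvature (fun x => F (a x, b x)) q = meanCurvature F (a q, b q) := by
  simp only [meanCurvature_eq_lap, h.lap_comp hF hF hq hdet]

end IsCoordChange

lemma contDiffOn_meanCurvature {F : ℝ × ℝ → E42} {Ω : Set (ℝ × ℝ)} (hΩ : IsOpen Ω)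
    (hF : ContDiffOn ℝ ∞ F Ω) (hdet : ∀ x ∈ Ω, (inducedMetric F x).det ≠ 0) :
    ContDiffOn ℝ ∞ (meanCurvature F) Ω := by
  refine ContDiffOn.const_smul (1 / 2 : ℝ) (ContDiffOn.sum fun i _ => ContDiffOn.sum fun j _ => ?_)
  exact (contDiffOn_inv_apply (contDiffOn_inducedMetric hΩ hF) hdet i j).smul
    (contDiffOn_secondFundForm hΩ hF hdet i j)

namespace IsCoordChange

variable {Ω' Ω : Set (ℝ × ℝ)} {a b : ℝ × ℝ → ℝ} (h : IsCoordChange Ω' Ω a b)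
variable {F V : ℝ × ℝ → E42} {q : ℝ × ℝ}
include h

lemma bitension_comp (hF : ContDiffOn ℝ ∞ F Ω) (hdet : ∀ x ∈ Ω, (inducedMetric F x).det ≠ 0)
    (hq : q ∈ Ω') : bitension (fun x => F (a x, b x)) q = bitension F (a q, b q) := by
  have hH : EqOn (meanCurvature fun x => F (a x, b x)) (fun x => meanCurvature F (a x, b x)) Ω' :=
    fun x hx => h.meanCurvature_comp hF hx (hdet _ (h.mapsTo x hx))
  rw [bitension_eq_lap_meanCurvature, bitension_eq_lap_meanCurvature,
    lap_congr h.isOpen_source hH hq, h.lap_comp hF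
      (contDiffOn_meanCurvature h.isOpen_target hF hdet) hq (hdet _ (h.mapsTo q hq))]

lemma metricGaussCurvature_comp (hF : ContDiffOn ℝ ∞ F Ω)
    (hdet : ∀ x ∈ Ω, (inducedMetric F x).det ≠ 0) (hq : q ∈ Ω') :
    metricGaussCurvature (inducedMetric fun x => F (a x, b x)) q
      = metricGaussCurvature (inducedMetric F) (a q, b q) := by
  have hGdet : ∀ x ∈ Ω', (inducedMetric (fun x => F (a x, b x)) x).det ≠ 0 := by
    intro x hx
    rw [h.det_inducedMetric_comp hF hx]
    exact mul_ne_zero (pow_ne_zero 2 (h.jac_ne_zero x hx)) (hdet _ (h.mapsTo x hx))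
  have hpΩ := h.mapsTo q hq
  have hjac := h.jac_ne_zero q hq
  rw [gauss_equation h.isOpen_source (h.contDiffOn_comp hF) hGdet hq,
    gauss_equation h.isOpen_target hF hdet hpΩ, h.det_inducedMetric_comp hF hq]
  have hs := fun i j => h.secondCovDeriv_comp hF hF hq (hdet _ hpΩ) i j
  simp only [secondFundForm, hs]
  have hcomm : secondCovDeriv (inducedMetric F) F 1 0 (a q, b q)
      = secondCovDeriv (inducedMetric F) F 0 1 (a q, b q) :=
    secondFundForm_comm h.isOpen_target hF hpΩ
  rw [hcomm, div_eq_div_iff (mul_ne_zero (pow_ne_zero 2 hjac) (hdet _ hpΩ)) (hdet _ hpΩ)]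
  simp only [ip_add_left, ip_add_right, ip_smul_left, ip_smul_right,
    ip_comm (secondCovDeriv (inducedMetric F) F 1 1 (a q, b q)),
    ip_comm (secondCovDeriv (inducedMetric F) F 0 1 (a q, b q))
      (secondCovDeriv (inducedMetric F) F 0 0 (a q, b q))]
  ring

end IsCoordChange

end QuasiMinimal
end

noncomputable section
namespace QuasiMinimal
open Set

/-! ### Null coordinates and semi-geodesic coordinates -/

section Formulas

variable {Ω : Set (ℝ × ℝ)} {q : ℝ × ℝ}

/-- The metric `φ (ds ⊗ dt + dt ⊗ ds)` of null coordinates. -/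
def nullMetric (φ : ℝ × ℝ → ℝ) (q : ℝ × ℝ) : Matrix (Fin 2) (Fin 2) ℝ := !![0, φ q; φ q, 0]

lemma inv_nullMetric {φ : ℝ × ℝ → ℝ} (h : φ q ≠ 0) :
    (nullMetric φ q)⁻¹ = !![0, (φ q)⁻¹; (φ q)⁻¹, 0] := by
  apply Matrix.inv_eq_right_inv
  ext i j
  fin_cases i <;> fin_cases j <;> simp [nullMetric, Matrix.mul_apply, Fin.sum_univ_two, h]

lemma det_nullMetric (φ : ℝ × ℝ → ℝ) : (nullMetric φ q).det = -(φ q * φ q) := by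
  simp [nullMetric, Matrix.det_fin_two]

lemma christoffel_nullMetric {φ : ℝ × ℝ → ℝ} (h : φ q ≠ 0) (k : Fin 2) :
    christoffel (nullMetric φ) k 0 1 q = 0 ∧ christoffel (nullMetric φ) k 1 0 q = 0 ∧
    christoffel (nullMetric φ) k 1 1 q = if k = 0 then 0 else pd 1 φ q / φ q := by
  simp only [christoffel, inv_nullMetric h, Fin.sum_univ_two]
  fin_cases k <;> simp [nullMetric, pd_const] <;> try (field_simp; ring)

lemma lap_nullMetric {φ : ℝ × ℝ → ℝ} (h : φ q ≠ 0) (hΩ : IsOpen Ω) {V : ℝ × ℝ → E42}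
    (hV : ContDiffOn ℝ ∞ V Ω) (hq : q ∈ Ω) :
    lap (nullMetric φ) V q = (2 / φ q) • pd 1 (pd 0 V) q := by
  have h1 := fun k => (christoffel_nullMetric h k).1
  have h2 := fun k => (christoffel_nullMetric h k).2.1
  simp only [lap, secondCovDeriv, inv_nullMetric h, Fin.sum_univ_two, h1, h2,
    pd_comm hΩ hV hq 0 1]
  simp only [Matrix.of_apply, Matrix.cons_val_zero, Matrix.cons_val_one, Matrix.cons_val',
    Matrix.cons_val_fin_one]
  module

lemma metricGaussCurvature_nullMetric {φ : ℝ × ℝ → ℝ} (hΩ : IsOpen Ω) (h : ∀ x ∈ Ω, φ x ≠ 0)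
    (hq : q ∈ Ω) :
    metricGaussCurvature (nullMetric φ) q = -pd 0 (fun x => pd 1 φ x / φ x) q / φ q := by
  have h01 : ∀ k, pd 1 (christoffel (nullMetric φ) k 0 1) q = 0 := fun k => by
    rw [pd_congr hΩ (g := fun _ => (0 : ℝ)) (fun x hx => (christoffel_nullMetric (h x hx) k).1) 1 hq,
      pd_const]
  have h11 : pd 0 (christoffel (nullMetric φ) 1 1 1) q = pd 0 (fun x => pd 1 φ x / φ x) q :=
    pd_congr hΩ (fun x hx => by simpa using (christoffel_nullMetric (h x hx) 1).2.2) 0 hq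
  have e1 := fun k => (christoffel_nullMetric (h q hq) k).1
  have e2 := fun k => (christoffel_nullMetric (h q hq) k).2.1
  have e3 := fun k => (christoffel_nullMetric (h q hq) k).2.2
  have hφ := h q hq
  simp only [metricGaussCurvature, riemann, Fin.sum_univ_two, det_nullMetric, h01, h11, e1, e2]
  rw [e3 0]
  simp [nullMetric]
  field_simp

lemma inv_semiGeodesicMetric (m : ℝ × ℝ → ℝ) :
    (semiGeodesicMetric m q)⁻¹ = !![-2 * m q, -1; -1, 0] := by
  apply Matrix.inv_eq_right_inv
  ext i j
  fin_cases i <;> fin_cases j <;>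
    simp [semiGeodesicMetric, Matrix.mul_apply, Fin.sum_univ_two]

lemma det_semiGeodesicMetric (m : ℝ × ℝ → ℝ) : (semiGeodesicMetric m q).det = -1 := by
  simp [semiGeodesicMetric, Matrix.det_fin_two]

lemma christoffel_semiGeodesicMetric {m : ℝ × ℝ → ℝ} (k : Fin 2) :
    christoffel (semiGeodesicMetric m) k 0 0 q = 0 ∧
    christoffel (semiGeodesicMetric m) k 0 1 q = (if k = 0 then -pd 0 m q else 0) ∧
    christoffel (semiGeodesicMetric m) k 1 0 q = (if k = 0 then -pd 0 m q else 0) ∧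
    christoffel (semiGeodesicMetric m) 1 1 1 q = pd 0 m q := by
  have h2 : ∀ i, pd i (fun x => 2 * m x) q = 2 * pd i m q := fun i =>
    pd_const_smul (2 : ℝ) m i
  simp only [christoffel, inv_semiGeodesicMetric, Fin.sum_univ_two]
  fin_cases k <;> simp [semiGeodesicMetric, pd_const, h2]

lemma lap_semiGeodesicMetric {m : ℝ × ℝ → ℝ} (hΩ : IsOpen Ω) {V : ℝ × ℝ → E42}
    (hV : ContDiffOn ℝ ∞ V Ω) (hq : q ∈ Ω) :
    lap (semiGeodesicMetric m) V q
      = (-2 : ℝ) • (pd 1 (pd 0 V) q + pd 0 m q • pd 0 V q + m q • pd 0 (pd 0 V) q) := by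
  have h0 := fun k => (christoffel_semiGeodesicMetric (q := q) (m := m) k).1
  have h1 := fun k => (christoffel_semiGeodesicMetric (q := q) (m := m) k).2.1
  have h2 := fun k => (christoffel_semiGeodesicMetric (q := q) (m := m) k).2.2.1
  simp only [lap, secondCovDeriv, inv_semiGeodesicMetric, Fin.sum_univ_two, h0, h1, h2,
    pd_comm hΩ hV hq 0 1]
  simp only [Matrix.of_apply, Matrix.cons_val_zero, Matrix.cons_val_one, Matrix.cons_val',
    Matrix.cons_val_fin_one, if_true, one_ne_zero, if_false]
  module

lemma metricGaussCurvature_semiGeodesicMetric {m : ℝ × ℝ → ℝ} :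
    metricGaussCurvature (semiGeodesicMetric m) = pd 0 (pd 0 m) := by
  funext q
  have h01 : pd 1 (christoffel (semiGeodesicMetric m) 1 0 1) q = 0 := by
    have : christoffel (semiGeodesicMetric m) 1 0 1 = fun _ => 0 := funext fun x => by
      simpa using (christoffel_semiGeodesicMetric (q := x) (m := m) 1).2.1
    rw [this, pd_const]
  have h11 : christoffel (semiGeodesicMetric m) 1 1 1 = pd 0 m := funext fun x =>
    (christoffel_semiGeodesicMetric (q := x) (m := m) 1).2.2.2
  have e0 := fun k => (christoffel_semiGeodesicMetric (q := q) (m := m) k).1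
  have e1 := fun k => (christoffel_semiGeodesicMetric (q := q) (m := m) k).2.1
  have e2 := fun k => (christoffel_semiGeodesicMetric (q := q) (m := m) k).2.2.1
  simp only [metricGaussCurvature, riemann, Fin.sum_univ_two, det_semiGeodesicMetric, h01, h11,
    e0, e1, e2]
  simp [semiGeodesicMetric]

variable {F : ℝ × ℝ → E42}

lemma inducedMetric_eq_nullMetric (h0 : ip (pd 0 F q) (pd 0 F q) = 0)
    (h1 : ip (pd 1 F q) (pd 1 F q) = 0) :
    inducedMetric F q = nullMetric (fun x => ip (pd 0 F x) (pd 1 F x)) q := by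
  ext i j
  fin_cases i <;> fin_cases j <;> simp [inducedMetric, nullMetric, h0, h1, ip_comm]

lemma inducedMetric_eq_semiGeodesicMetric {m : ℝ × ℝ → ℝ} (h0 : ip (pd 0 F q) (pd 0 F q) = 0)
    (h01 : ip (pd 0 F q) (pd 1 F q) = -1) (h1 : ip (pd 1 F q) (pd 1 F q) = 2 * m q) :
    inducedMetric F q = semiGeodesicMetric m q := by
  ext i j
  fin_cases i <;> fin_cases j <;>
    simp [inducedMetric, semiGeodesicMetric, h0, h1, h01, ip_comm (pd 1 F q) (pd 0 F q)]

lemma meanCurvature_of_null {φ : ℝ × ℝ → ℝ} (hΩ : IsOpen Ω) (hF : ContDiffOn ℝ ∞ F Ω)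
    (hg : EqOn (inducedMetric F) (nullMetric φ) Ω) (hφ : ∀ x ∈ Ω, φ x ≠ 0) (hq : q ∈ Ω) :
    meanCurvature F q = (φ q)⁻¹ • pd 1 (pd 0 F) q := by
  simp only [meanCurvature_eq_lap]
  rw [lap_congr_metric hΩ hg hq, lap_nullMetric (hφ q hq) hΩ hF hq, smul_smul]
  congr 1
  ring

lemma bitension_of_null {φ : ℝ × ℝ → ℝ} (hΩ : IsOpen Ω) (hF : ContDiffOn ℝ ∞ F Ω)
    (hg : EqOn (inducedMetric F) (nullMetric φ) Ω) (hφ : ∀ x ∈ Ω, φ x ≠ 0) (hq : q ∈ Ω) :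
    bitension F q = (-4 / φ q) • pd 1 (pd 0 (meanCurvature F)) q := by
  have hH := contDiffOn_meanCurvature hΩ hF fun x hx => by
    rw [hg hx, det_nullMetric]
    exact neg_ne_zero.2 (mul_self_ne_zero.2 (hφ x hx))
  rw [bitension_eq_lap_meanCurvature, lap_congr_metric hΩ hg hq,
    lap_nullMetric (hφ q hq) hΩ hH hq, smul_smul]
  congr 1
  ring

lemma meanCurvature_of_semiGeodesic {m : ℝ × ℝ → ℝ} (hΩ : IsOpen Ω) (hF : ContDiffOn ℝ ∞ F Ω)
    (hg : EqOn (inducedMetric F) (semiGeodesicMetric m) Ω) (hq : q ∈ Ω) :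
    meanCurvature F q = -(pd 1 (pd 0 F) q + pd 0 m q • pd 0 F q + m q • pd 0 (pd 0 F) q) := by
  simp only [meanCurvature_eq_lap]
  rw [lap_congr_metric hΩ hg hq, lap_semiGeodesicMetric hΩ hF hq]
  module

lemma bitension_of_semiGeodesic {m : ℝ × ℝ → ℝ} (hΩ : IsOpen Ω) (hF : ContDiffOn ℝ ∞ F Ω)
    (hg : EqOn (inducedMetric F) (semiGeodesicMetric m) Ω) (hq : q ∈ Ω) :
    bitension F q = (4 : ℝ) • (pd 1 (pd 0 (meanCurvature F)) q
      + pd 0 m q • pd 0 (meanCurvature F) q + m q • pd 0 (pd 0 (meanCurvature F)) q) := by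
  have hH := contDiffOn_meanCurvature hΩ hF fun x hx => by
    rw [hg hx, det_semiGeodesicMetric]; norm_num
  rw [bitension_eq_lap_meanCurvature, lap_congr_metric hΩ hg hq,
    lap_semiGeodesicMetric hΩ hH hq, smul_smul]
  norm_num

end Formulas

/-! ### Isometries -/

section Isometry

variable {T : E42 ≃ᵃ[ℝ] E42}

lemma pd_linear_comp (A : E42 ≃ₗ[ℝ] E42) (F : ℝ × ℝ → E42) (i : Fin 2) (q : ℝ × ℝ) :
    pd i (fun x => A (F x)) q = A (pd i F q) := by
  have := A.toContinuousLinearEquiv.comp_fderiv (f := F) (x := q)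
  have h2 : fderiv ℝ (fun x => A (F x)) q = (A.toContinuousLinearEquiv : E42 →L[ℝ] E42).comp (fderiv ℝ F q) := this
  simp [pd, h2]

lemma affine_apply (T : E42 ≃ᵃ[ℝ] E42) (x : E42) : T x = T.linear x + T 0 := by
  have := T.map_vadd 0 x
  simpa using this

lemma pd_affine_comp (T : E42 ≃ᵃ[ℝ] E42) (F : ℝ × ℝ → E42) (i : Fin 2) (q : ℝ × ℝ) :
    pd i (fun x => T (F x)) q = T.linear (pd i F q) := by
  have h : (fun x => T (F x)) = fun x => T.linear (F x) + T 0 := funext fun x => affine_apply T (F x)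
  have h2 : pd i (fun x => T.linear (F x) + T 0) q = pd i (fun x => T.linear (F x)) q := by
    simp [pd, fderiv_add_const]
  rw [h, h2, pd_linear_comp]

lemma inducedMetric_isometry (hT : IsIsometry T) (F : ℝ × ℝ → E42) :
    inducedMetric (fun x => T (F x)) = inducedMetric F := by
  funext q
  ext i j
  simp only [inducedMetric_apply, pd_affine_comp]
  exact hT _ _

lemma lap_linear (A : E42 ≃ₗ[ℝ] E42) (g : ℝ × ℝ → Matrix (Fin 2) (Fin 2) ℝ)
    {V W : ℝ × ℝ → E42} (h : ∀ i x, pd i W x = A (pd i V x)) (q : ℝ × ℝ) :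
    lap g W q = A (lap g V q) := by
  have h' : ∀ i, pd i W = fun x => A (pd i V x) := fun i => funext (h i)
  simp only [lap, secondCovDeriv, h', pd_linear_comp, map_sum, map_smul, map_sub]

lemma meanCurvature_isometry (hT : IsIsometry T) (F : ℝ × ℝ → E42) :
    meanCurvature (fun x => T (F x)) = fun q => T.linear (meanCurvature F q) := by
  funext q
  simp only [meanCurvature_eq_lap, inducedMetric_isometry hT]
  rw [lap_linear T.linear _ (fun i x => pd_affine_comp T F i x), map_smul]

lemma bitension_isometry (hT : IsIsometry T) (F : ℝ × ℝ → E42) (q : ℝ × ℝ) :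
    bitension (fun x => T (F x)) q = T.linear (bitension F q) := by
  rw [bitension_eq_lap_meanCurvature, bitension_eq_lap_meanCurvature, inducedMetric_isometry hT,
    meanCurvature_isometry hT, lap_linear T.linear _ (fun i x => pd_linear_comp _ _ i x),
    map_smul]

lemma isLightLike_isometry (hT : IsIsometry T) {x : E42} :
    IsLightLike (T.linear x) ↔ IsLightLike x := by
  simp [IsLightLike, hT x x]

lemma isIsometry_symm (hT : IsIsometry T) : IsIsometry T.symm := by
  intro x y
  have := hT (T.symm.linear x) (T.symm.linear y)
  have e : ∀ x, T.linear (T.symm.linear x) = x := fun x => by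
    rw [AffineEquiv.linear_symm]
    exact T.linear.apply_symm_apply x
  rw [e, e] at this
  exact this.symm

lemma contDiff_affine (T : E42 ≃ᵃ[ℝ] E42) : ContDiff ℝ ∞ T := by
  have h : (T : E42 → E42) = fun x => T.linear.toContinuousLinearEquiv x + T 0 :=
    funext fun x => affine_apply T x
  rw [h]
  exact T.linear.toContinuousLinearEquiv.contDiff.add contDiff_const

/-- Every null vector is carried to a multiple of `(1, 0, 0, 1)` by a linear isometry: rotate in the
negative definite and in the positive definite coordinate plane. -/
lemma exists_isometry_null {l : E42} (hl : IsLightLike l) :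
    ∃ A : E42 ≃ₗ[ℝ] E42, (∀ x y, ip (A x) (A y) = ip x y) ∧
      ∃ c : ℝ, c ≠ 0 ∧ A l = c • ![1, 0, 0, 1] := by
  obtain ⟨hl0, hll⟩ := hl
  have hsum : l 0 ^ 2 + l 1 ^ 2 = l 2 ^ 2 + l 3 ^ 2 := by
    simp only [ip] at hll; linear_combination -hll
  set r : ℝ := √(l 0 ^ 2 + l 1 ^ 2) with hr
  have hr2 : r ^ 2 = l 0 ^ 2 + l 1 ^ 2 := Real.sq_sqrt (by positivity)
  have hr0 : r ≠ 0 := by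
    intro h0
    rw [h0] at hr2
    apply hl0
    have e0 : l 0 = 0 := by nlinarith [sq_nonneg (l 0), sq_nonneg (l 1)]
    have e1 : l 1 = 0 := by nlinarith [sq_nonneg (l 0), sq_nonneg (l 1)]
    have e2 : l 2 = 0 := by nlinarith [sq_nonneg (l 2), sq_nonneg (l 3)]
    have e3 : l 3 = 0 := by nlinarith [sq_nonneg (l 2), sq_nonneg (l 3)]
    ext i; fin_cases i <;> simp [e0, e1, e2, e3]
  have hr2' : r ^ 2 = l 2 ^ 2 + l 3 ^ 2 := hr2.trans hsum
  let B : E42 →ₗ[ℝ] E42 :=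
    { toFun := fun x => ![(l 0 * x 0 + l 1 * x 1) / r, (l 0 * x 1 - l 1 * x 0) / r,
        (l 3 * x 2 - l 2 * x 3) / r, (l 2 * x 2 + l 3 * x 3) / r]
      map_add' := fun x y => by ext i; fin_cases i <;> simp <;> ring
      map_smul' := fun c x => by ext i; fin_cases i <;> simp <;> ring }
  have hB : ∀ x, B x = ![(l 0 * x 0 + l 1 * x 1) / r, (l 0 * x 1 - l 1 * x 0) / r,
      (l 3 * x 2 - l 2 * x 3) / r, (l 2 * x 2 + l 3 * x 3) / r] := fun _ => rfl
  have hBi : ∀ x y, ip (B x) (B y) = ip x y := by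
    intro x y
    simp [ip, hB]
    field_simp
    linear_combination (x 0 * y 0 + x 1 * y 1) * hr2 - (x 2 * y 2 + x 3 * y 3) * hr2'
  have hinj : Function.Injective B := by
    rw [← LinearMap.ker_eq_bot, LinearMap.ker_eq_bot']
    intro x hx
    exact eq_zero_of_ip fun y => by rw [← hBi, hx, ip_zero_left]
  refine ⟨LinearEquiv.ofInjectiveEndo B hinj, hBi, r, hr0, ?_⟩
  change B l = _
  rw [hB]
  ext i
  fin_cases i <;> simp <;> field_simp
  · linear_combination -hr2
  · left; ring
  · left; ring
  · linear_combination -hr2'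

end Isometry

end QuasiMinimal
end

noncomputable section
namespace QuasiMinimal
open Set

/-! ### The three families consist of quasi-minimal biharmonic surfaces -/

/-- `F` is, on the open set `D`, a quasi-minimal biharmonic surface. -/
structure IsQMBiharmonicOn (D : Set (ℝ × ℝ)) (F : ℝ × ℝ → E42) : Prop where
  isOpen : IsOpen D
  smooth : ContDiffOn ℝ ∞ F D
  det_ne_zero : ∀ q ∈ D, (inducedMetric F q).det ≠ 0
  isLightLike : ∀ q ∈ D, IsLightLike (meanCurvature F q)
  bitension_eq_zero : ∀ q ∈ D, bitension F q = 0

section Families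

variable {V : Type*} [NormedAddCommGroup V] [NormedSpace ℝ V]
variable {D : Set (ℝ × ℝ)} {F : ℝ × ℝ → E42} {q : ℝ × ℝ}

lemma pd_comp_fst {z : ℝ → V} (hz : DifferentiableAt ℝ z q.1) (i : Fin 2) :
    pd i (fun x : ℝ × ℝ => z x.1) q = if i = 0 then deriv z q.1 else 0 := by
  have h : HasFDerivAt (fun x : ℝ × ℝ => z x.1)
      ((ContinuousLinearMap.toSpanSingleton ℝ (deriv z q.1)).comp (ContinuousLinearMap.fst ℝ ℝ ℝ)) q :=
    hz.hasDerivAt.hasFDerivAt.comp q hasFDerivAt_fst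
  rw [pd, h.fderiv]
  fin_cases i <;> simp [coordVec]

lemma pd_comp_snd {z : ℝ → V} (hz : DifferentiableAt ℝ z q.2) (i : Fin 2) :
    pd i (fun x : ℝ × ℝ => z x.2) q = if i = 0 then 0 else deriv z q.2 := by
  have h : HasFDerivAt (fun x : ℝ × ℝ => z x.2)
      ((ContinuousLinearMap.toSpanSingleton ℝ (deriv z q.2)).comp (ContinuousLinearMap.snd ℝ ℝ ℝ)) q :=
    hz.hasDerivAt.hasFDerivAt.comp q hasFDerivAt_snd
  rw [pd, h.fderiv]
  fin_cases i <;> simp [coordVec]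

lemma pd_smul_const {c : ℝ × ℝ → ℝ} (hc : DifferentiableAt ℝ c q) (v : V) (i : Fin 2) :
    pd i (fun x => c x • v) q = pd i c q • v := by
  rw [pd_smul hc (differentiableAt_const _), pd_const, smul_zero, add_zero]

/-- The coordinates of a surface `(ψ, (s - t) / √2, (s + t) / √2, ψ)` are null coordinates in which
the metric is flat. -/
lemma graph_facts (hD : IsOpen D) {ψ : ℝ × ℝ → ℝ} (hψ : ContDiffOn ℝ ∞ ψ D)
    (hF : ∀ q ∈ D, F q = ![ψ q, (q.1 - q.2) / √2, (q.1 + q.2) / √2, ψ q]) :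
    ContDiffOn ℝ ∞ F D ∧ EqOn (inducedMetric F) (nullMetric fun _ => 1) D ∧
      EqOn (meanCurvature F) (pd 1 (pd 0 F)) D ∧
      ∀ x ∈ D, pd 1 (pd 0 F) x = pd 1 (pd 0 ψ) x • ![1, 0, 0, 1] := by
  set l : E42 := ![1, 0, 0, 1] with hl
  set v : E42 := ![0, 1 / √2, 1 / √2, 0] with hv
  set w : E42 := ![0, -1 / √2, 1 / √2, 0] with hw
  have h2 : (√2 : ℝ) * √2 = 2 := Real.mul_self_sqrt (by norm_num)
  have h20 : (√2 : ℝ) ≠ 0 := by positivity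
  have hFe : EqOn F (fun x => ψ x • l + x.1 • v + x.2 • w) D := by
    intro x hx
    rw [hF x hx]
    ext i
    fin_cases i <;> simp [hl, hv, hw] <;> ring
  have hFs : ContDiffOn ℝ ∞ F D := by
    refine ContDiffOn.congr ?_ hFe
    exact ((hψ.smul contDiffOn_const).add (contDiffOn_fst.smul contDiffOn_const)).add
      (contDiffOn_snd.smul contDiffOn_const)
  have hpd : ∀ i, EqOn (pd i F) (fun x => pd i ψ x • l + (if i = 0 then v else w)) D := by
    intro i x hx
    have d0 := differentiableAt_of_contDiffOn hD hψ hx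
    rw [pd_congr hD hFe i hx, pd_add (by fun_prop) (by fun_prop), pd_add (by fun_prop) (by fun_prop),
      pd_smul_const d0, pd_smul_const (by fun_prop), pd_smul_const (by fun_prop), pd_fst, pd_snd]
    fin_cases i <;> simp
  have hg : EqOn (inducedMetric F) (nullMetric fun _ => 1) D := by
    intro x hx
    ext i j
    rw [inducedMetric_apply, hpd i hx, hpd j hx]
    fin_cases i <;> fin_cases j <;> simp [nullMetric, ip, hl, hv, hw] <;> field_simp <;>
      first | ring1 | linear_combination -h2
  have hH : EqOn (meanCurvature F) (pd 1 (pd 0 F)) D := by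
    intro x hx
    rw [meanCurvature_of_null hD hFs hg (fun _ _ => one_ne_zero) hx]
    simp
  have h10 : ∀ x ∈ D, pd 1 (pd 0 F) x = pd 1 (pd 0 ψ) x • l := by
    intro x hx
    have d0 := differentiableAt_of_contDiffOn hD (contDiffOn_pd hD hψ 0) hx
    rw [pd_congr hD (hpd 0) 1 hx, pd_add (by fun_prop) (by fun_prop), pd_smul_const d0, pd_const,
      add_zero]
  exact ⟨hFs, hg, hH, h10⟩

lemma isQMBiharmonicOn_of_isGraphType (h : IsGraphType D F) :
    IsQMBiharmonicOn D F ∧ ∀ q ∈ D, metricGaussCurvature (inducedMetric F) q = 0 := by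
  obtain ⟨hD, ψ, hψ, hF⟩ := h
  obtain ⟨hFs, hg, hH, h10⟩ := graph_facts hD hψ fun q hq => (hF q hq).1
  refine ⟨⟨hD, hFs, ?_, ?_, ?_⟩, ?_⟩
  · intro x hx
    rw [hg hx, det_nullMetric]; norm_num
  · intro x hx
    rw [hH hx]
    refine ⟨(hF x hx).2.1, ?_⟩
    rw [h10 x hx, ip_smul_left, ip_smul_right]
    simp [ip]
  · intro x hx
    have hF0 := contDiffOn_pd hD hFs 0
    have hc : EqOn (pd 0 (pd 1 (pd 0 F))) (pd 1 (pd 0 (pd 0 F))) D := fun y hy =>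
      pd_comm hD hF0 hy 0 1
    rw [bitension_of_null hD hFs hg (fun _ _ => one_ne_zero) hx,
      pd_congr hD ((pd_congr hD hH 0).trans hc) 1 hx, (hF x hx).2.2, smul_zero]
  · intro x hx
    rw [metricGaussCurvature_congr hD hg hx,
      metricGaussCurvature_nullMetric hD (fun _ _ => one_ne_zero) hx]
    simp [pd_const]

lemma isQMBiharmonicOn_of_isRuledType (h : IsRuledType D F) :
    IsQMBiharmonicOn D F ∧ ∀ q ∈ D, metricGaussCurvature (inducedMetric F) q = 0 := by
  obtain ⟨I, J, hI, hJ, rfl, z, w, hz, hw, hzw, hF⟩ := h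
  have hD : IsOpen (I ×ˢ J) := hI.1.prod hJ.1
  have hz1 : ContDiffOn ℝ ∞ (deriv z) I := ((contDiffOn_infty_iff_deriv_of_isOpen hI.1).1 hz).2
  have hw1 : ContDiffOn ℝ ∞ (deriv w) I := ((contDiffOn_infty_iff_deriv_of_isOpen hI.1).1 hw).2
  have toD : ∀ {f : ℝ → E42}, ContDiffOn ℝ ∞ f I →
      ContDiffOn ℝ ∞ (fun x : ℝ × ℝ => f x.1) (I ×ˢ J) := fun hf =>
    hf.comp contDiffOn_fst fun x hx => hx.1
  have dI : ∀ {f : ℝ → E42}, ContDiffOn ℝ ∞ f I → ∀ x ∈ I ×ˢ J, DifferentiableAt ℝ f x.1 :=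
    fun hf x hx => (hf.contDiffAt (hI.1.mem_nhds hx.1)).differentiableAt (by simp)
  have dD : ∀ {f : ℝ × ℝ → E42}, ContDiffOn ℝ ∞ f (I ×ˢ J) → ∀ x ∈ I ×ˢ J,
      DifferentiableAt ℝ f x := fun hf x hx => differentiableAt_of_contDiffOn hD hf hx
  have hsz : ∀ {f : ℝ → E42}, ContDiffOn ℝ ∞ f I →
      ContDiffOn ℝ ∞ (fun x : ℝ × ℝ => x.2 • f x.1) (I ×ˢ J) := fun hf =>
    contDiffOn_snd.smul (toD hf)
  have hFe : EqOn F (fun x => x.2 • z x.1 + w x.1) (I ×ˢ J) := hF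
  have hFs : ContDiffOn ℝ ∞ F (I ×ˢ J) := ((hsz hz).add (toD hw)).congr hF
  have h0 : EqOn (pd 0 F) (fun x => x.2 • deriv z x.1 + deriv w x.1) (I ×ˢ J) := by
    intro x hx
    rw [pd_congr hD hFe 0 hx, pd_add (dD (hsz hz) x hx) (dD (toD hw) x hx),
      pd_smul differentiableAt_snd (dD (toD hz) x hx), pd_comp_fst (dI hz x hx),
      pd_comp_fst (dI hw x hx), pd_snd]
    simp
  have h1 : EqOn (pd 1 F) (fun x => z x.1) (I ×ˢ J) := by
    intro x hx
    rw [pd_congr hD hFe 1 hx, pd_add (dD (hsz hz) x hx) (dD (toD hw) x hx),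
      pd_smul differentiableAt_snd (dD (toD hz) x hx), pd_comp_fst (dI hz x hx),
      pd_comp_fst (dI hw x hx), pd_snd]
    simp
  have h10 : EqOn (pd 1 (pd 0 F)) (fun x => deriv z x.1) (I ×ˢ J) := by
    intro x hx
    rw [pd_congr hD h0 1 hx, pd_add (dD (hsz hz1) x hx) (dD (toD hw1) x hx),
      pd_smul differentiableAt_snd (dD (toD hz1) x hx), pd_comp_fst (dI hz1 x hx),
      pd_comp_fst (dI hw1 x hx), pd_snd]
    simp
  have hzz' : ∀ x ∈ I ×ˢ J, ip (z x.1) (deriv z x.1) = 0 := by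
    intro x hx
    have := pd_ip_of_const hD (toD hz) (toD hz) (c := 0) (fun y hy => (hzw y.1 hy.1).1) hx 0
    rw [pd_comp_fst (dI hz x hx), if_pos rfl, ip_comm (deriv z x.1)] at this
    linarith
  have hg : EqOn (inducedMetric F) (nullMetric fun _ => -1) (I ×ˢ J) := by
    intro x hx
    obtain ⟨e1, e2, e3, e4, e5⟩ := hzw x.1 hx.1
    have e6 := hzz' x hx
    have e1' : ip (z x.1) (z x.1) = 0 := e1
    have e4' : ip (deriv w x.1) (deriv z x.1) = 0 := by rw [ip_comm]; exact e4
    have e5' : ip (deriv w x.1) (z x.1) = -1 := by rw [ip_comm]; exact e5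
    have e6' : ip (deriv z x.1) (z x.1) = 0 := by rw [ip_comm]; exact e6
    ext i j
    rw [inducedMetric_apply]
    fin_cases i <;> fin_cases j <;>
      simp [nullMetric, h0 hx, h1 hx, ip_add_left, ip_add_right, ip_smul_left, ip_smul_right,
        e1', e2.2, e3.2, e4, e5, e6, e4', e5', e6']
  have hH : EqOn (meanCurvature F) (fun x => -deriv z x.1) (I ×ˢ J) := by
    intro x hx
    rw [meanCurvature_of_null hD hFs hg (fun _ _ => by norm_num) hx, h10 hx]
    norm_num
  refine ⟨⟨hD, hFs, ?_, ?_, ?_⟩, ?_⟩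
  · intro x hx
    rw [hg hx, det_nullMetric]; norm_num
  · intro x hx
    rw [hH hx]
    obtain ⟨-, e2, -⟩ := hzw x.1 hx.1
    exact ⟨neg_ne_zero.2 e2.1, by rw [ip_neg_left, ip_neg_right, neg_neg]; exact e2.2⟩
  · intro x hx
    have hH1 : EqOn (pd 1 (meanCurvature F)) (fun _ => 0) (I ×ˢ J) := by
      intro y hy
      rw [pd_congr hD hH 1 hy, pd_neg, pd_comp_fst (dI hz1 y hy)]
      simp
    have hHs : ContDiffOn ℝ ∞ (meanCurvature F) (I ×ˢ J) := (toD hz1).neg.congr hH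
    rw [bitension_of_null hD hFs hg (fun _ _ => by norm_num) hx, pd_comm hD hHs hx,
      pd_congr hD hH1 0 hx, pd_const, smul_zero]
  · intro x hx
    rw [metricGaussCurvature_congr hD hg hx,
      metricGaussCurvature_nullMetric hD (fun _ _ => by norm_num) hx]
    simp [pd_const]

lemma contDiffOn_intrinsicL (hD : IsOpen D) {m : ℝ × ℝ → ℝ} (hm : ContDiffOn ℝ ∞ m D)
    (hK : ∀ x ∈ D, metricGaussCurvature (semiGeodesicMetric m) x ≠ 0) :
    ContDiffOn ℝ ∞ (intrinsicL m) D := by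
  have hm0 := contDiffOn_pd hD hm 0
  have hk := contDiffOn_pd hD hm0 0
  rw [metricGaussCurvature_semiGeodesicMetric] at hK
  unfold intrinsicL
  rw [metricGaussCurvature_semiGeodesicMetric]
  exact ((((contDiffOn_pd hD hk 1).add (hm.mul (contDiffOn_pd hD hk 0))).add
    ((contDiffOn_const.mul hm0).mul hk)).neg).div hk hK

lemma isQMBiharmonicOn_of_isNonFlatType (h : IsNonFlatType D F) :
    IsQMBiharmonicOn D F ∧ ∀ q ∈ D, metricGaussCurvature (inducedMetric F) q ≠ 0 := by
  obtain ⟨I, J, hI, hJ, rfl, m, L, a, α, η, hm, ha, hα, hη, hKL, hJs, hF, hH0⟩ := h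
  have hD : IsOpen (I ×ˢ J) := hI.1.prod hJ.1
  rcases I.eq_empty_or_nonempty with rfl | ⟨s₀, hs₀⟩
  · simp only [empty_prod]
    exact ⟨⟨isOpen_empty, contDiffOn_empty, by simp, by simp, by simp⟩, by simp⟩
  have hLs : ContDiffOn ℝ ∞ L J := by
    have h1 : ContDiffOn ℝ ∞ (fun t => intrinsicL m (s₀, t)) J :=
      (contDiffOn_intrinsicL hD hm fun x hx => (hKL x hx).1).comp (by fun_prop)
        fun t ht => ⟨hs₀, ht⟩
    exact h1.congr fun t ht => ((hKL (s₀, t) ⟨hs₀, ht⟩).2).symm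
  have der : ∀ {V : Type} [NormedAddCommGroup V] [NormedSpace ℝ V] {f : ℝ → V},
      ContDiffOn ℝ ∞ f J → ContDiffOn ℝ ∞ (deriv f) J := fun hf =>
    ((contDiffOn_infty_iff_deriv_of_isOpen hJ.1).1 hf).2
  have toD : ∀ {V : Type} [NormedAddCommGroup V] [NormedSpace ℝ V] {f : ℝ → V},
      ContDiffOn ℝ ∞ f J → ContDiffOn ℝ ∞ (fun x : ℝ × ℝ => f x.2) (I ×ˢ J) := fun hf =>
    hf.comp contDiffOn_snd fun x hx => hx.2
  have dJ : ∀ {V : Type} [NormedAddCommGroup V] [NormedSpace ℝ V] {f : ℝ → V},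
      ContDiffOn ℝ ∞ f J → ∀ x ∈ I ×ˢ J, DifferentiableAt ℝ f x.2 :=
    fun hf x hx => (hf.contDiffAt (hJ.1.mem_nhds hx.2)).differentiableAt (by simp)
  have dD : ∀ {V : Type} [NormedAddCommGroup V] [NormedSpace ℝ V] {f : ℝ × ℝ → V},
      ContDiffOn ℝ ∞ f (I ×ˢ J) → ∀ x ∈ I ×ˢ J, DifferentiableAt ℝ f x := fun hf x hx =>
    differentiableAt_of_contDiffOn hD hf hx
  -- a function of the second coordinate only
  have p0 : ∀ {V : Type} [NormedAddCommGroup V] [NormedSpace ℝ V] {f : ℝ → V},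
      ContDiffOn ℝ ∞ f J → ∀ x ∈ I ×ˢ J, pd 0 (fun y : ℝ × ℝ => f y.2) x = 0 := fun hf x hx => by
    rw [pd_comp_snd (dJ hf x hx), if_pos rfl]
  have p1 : ∀ {V : Type} [NormedAddCommGroup V] [NormedSpace ℝ V] {f : ℝ → V},
      ContDiffOn ℝ ∞ f J → ∀ x ∈ I ×ˢ J, pd 1 (fun y : ℝ × ℝ => f y.2) x = deriv f x.2 :=
    fun hf x hx => by rw [pd_comp_snd (dJ hf x hx), if_neg (by decide)]
  have hα1 := der hα
  have hα2 := der hα1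
  have ha1 := der ha
  have hη1 := der hη
  have hm0 := contDiffOn_pd hD hm 0
  set k := pd 0 (pd 0 m) with hk
  have hks : ContDiffOn ℝ ∞ k (I ×ˢ J) := contDiffOn_pd hD hm0 0
  -- scalar products of the derivatives of `α`
  have hαα : ∀ x ∈ I ×ˢ J, ip (α x.2) (α x.2) = 0 := fun x hx => (hJs x.2 hx.2).2.1
  have hα11 : ∀ x ∈ I ×ˢ J, ip (deriv α x.2) (deriv α x.2) = 0 := fun x hx =>
    (hJs x.2 hx.2).2.2.1.2
  have hα01 : ∀ x ∈ I ×ˢ J, ip (α x.2) (deriv α x.2) = 0 := by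
    intro x hx
    have := pd_ip_of_const hD (toD hα) (toD hα) hαα hx 1
    rw [p1 hα x hx, ip_comm (deriv α x.2)] at this
    linarith
  have hα02 : ∀ x ∈ I ×ˢ J, ip (α x.2) (deriv (deriv α) x.2) = 0 := by
    intro x hx
    have := pd_ip_of_const hD (toD hα) (toD hα1) hα01 hx 1
    rw [p1 hα x hx, p1 hα1 x hx, hα11 x hx, zero_add] at this
    exact this
  have hα12 : ∀ x ∈ I ×ˢ J, ip (deriv α x.2) (deriv (deriv α) x.2) = 0 := by
    intro x hx
    have := pd_ip_of_const hD (toD hα1) (toD hα1) hα11 hx 1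
    rw [p1 hα1 x hx, ip_comm (deriv (deriv α) x.2)] at this
    linarith
  -- `α, α'` span a maximal isotropic plane, so `α''` lies in it
  have hspan : ∀ x ∈ I ×ˢ J, ∃ c₀ c₁ : ℝ,
      deriv (deriv α) x.2 = c₀ • α x.2 + c₁ • deriv α x.2 := fun x hx =>
    exists_eq_smul_add_smul (hJs x.2 hx.2).2.2.2.1 (hαα x hx) (hα01 x hx) (hα11 x hx)
      (by rw [ip_comm]; exact hα02 x hx) (by rw [ip_comm]; exact hα12 x hx)
  have hα22 : ∀ x ∈ I ×ˢ J, ip (deriv (deriv α) x.2) (deriv (deriv α) x.2) = 0 := by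
    intro x hx
    obtain ⟨c₀, c₁, hc⟩ := hspan x hx
    have h1 := hα02 x hx
    have h2 := hα12 x hx
    nth_rewrite 1 [hc]
    rw [ip_add_left, ip_smul_left, ip_smul_left, h1, h2]
    ring
  -- first derivatives of `F`
  set B : ℝ × ℝ → ℝ := fun q => q.1 * deriv a q.2 - a q.2 * (m q + q.1 * L q.2) with hB
  set b : ℝ × ℝ → ℝ := fun q => deriv a q.2 - a q.2 * (pd 0 m q + L q.2) with hb
  have hfst : ContDiffOn ℝ ∞ (fun q : ℝ × ℝ => q.1) (I ×ˢ J) := contDiffOn_fst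
  have hfL : ContDiffOn ℝ ∞ (fun q : ℝ × ℝ => q.1 * L q.2) (I ×ˢ J) := hfst.mul (toD hLs)
  have hfa : ContDiffOn ℝ ∞ (fun q : ℝ × ℝ => q.1 * a q.2) (I ×ˢ J) := hfst.mul (toD ha)
  have hmL : ContDiffOn ℝ ∞ (fun q : ℝ × ℝ => m q + q.1 * L q.2) (I ×ˢ J) := hm.add hfL
  have hBs : ContDiffOn ℝ ∞ B (I ×ˢ J) :=
    (hfst.mul (toD ha1)).sub ((toD ha).mul hmL)
  have hm0L : ContDiffOn ℝ ∞ (fun q : ℝ × ℝ => pd 0 m q + L q.2) (I ×ˢ J) := hm0.add (toD hLs)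
  have hbs : ContDiffOn ℝ ∞ b (I ×ˢ J) := (toD ha1).sub ((toD ha).mul hm0L)
  have hFe : EqOn F (fun q => η q.2 + B q • α q.2 + (q.1 * a q.2) • deriv α q.2) (I ×ˢ J) := hF
  have hBα : ContDiffOn ℝ ∞ (fun q : ℝ × ℝ => B q • α q.2) (I ×ˢ J) := hBs.smul (toD hα)
  have hfα : ContDiffOn ℝ ∞ (fun q : ℝ × ℝ => (q.1 * a q.2) • deriv α q.2) (I ×ˢ J) :=
    hfa.smul (toD hα1)
  have hFs : ContDiffOn ℝ ∞ F (I ×ˢ J) := (((toD hη).add hBα).add hfα).congr hF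
  have hB0 : EqOn (pd 0 B) b (I ×ˢ J) := by
    intro x hx
    rw [hB, pd_sub (dD (hfst.mul (toD ha1)) x hx) (dD ((toD ha).mul hmL) x hx),
      pd_mul differentiableAt_fst (dD (toD ha1) x hx), pd_mul (dD (toD ha) x hx) (dD hmL x hx),
      pd_add (dD hm x hx) (dD hfL x hx), pd_mul differentiableAt_fst (dD (toD hLs) x hx),
      p0 ha1 x hx, p0 ha x hx, p0 hLs x hx, pd_fst]
    simp [hb]
  have h0 : EqOn (pd 0 F) (fun x => b x • α x.2 + a x.2 • deriv α x.2) (I ×ˢ J) := by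
    intro x hx
    rw [pd_congr hD hFe 0 hx, pd_add (dD ((toD hη).add hBα) x hx) (dD hfα x hx),
      pd_add (dD (toD hη) x hx) (dD hBα x hx), pd_smul (dD hBs x hx) (dD (toD hα) x hx),
      pd_smul (dD hfa x hx) (dD (toD hα1) x hx), pd_mul differentiableAt_fst (dD (toD ha) x hx),
      p0 hη x hx, p0 hα x hx, p0 hα1 x hx, p0 ha x hx, pd_fst, hB0 hx]
    simp
  have h1 : EqOn (pd 1 F) (fun x => deriv η x.2 + pd 1 B x • α x.2
      + (B x + x.1 * deriv a x.2) • deriv α x.2 + (x.1 * a x.2) • deriv (deriv α) x.2) (I ×ˢ J) := by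
    intro x hx
    rw [pd_congr hD hFe 1 hx, pd_add (dD ((toD hη).add hBα) x hx) (dD hfα x hx),
      pd_add (dD (toD hη) x hx) (dD hBα x hx), pd_smul (dD hBs x hx) (dD (toD hα) x hx),
      pd_smul (dD hfa x hx) (dD (toD hα1) x hx), pd_mul differentiableAt_fst (dD (toD ha) x hx),
      p1 hη x hx, p1 hα x hx, p1 hα1 x hx, p1 ha x hx, pd_fst]
    simp only [one_ne_zero, if_false, zero_mul, zero_add]
    module
  have hg : EqOn (inducedMetric F) (semiGeodesicMetric m) (I ×ˢ J) := by
    intro x hx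
    obtain ⟨ha0, -, -, -, e1, e2, e3, e4⟩ := hJs x.2 hx.2
    have s1 := hα01 x hx
    have s2 := hα02 x hx
    have s3 := hα12 x hx
    have s1' : ip (deriv α x.2) (α x.2) = 0 := by rw [ip_comm]; exact s1
    have s2' : ip (deriv (deriv α) x.2) (α x.2) = 0 := by rw [ip_comm]; exact s2
    have s3' : ip (deriv (deriv α) x.2) (deriv α x.2) = 0 := by rw [ip_comm]; exact s3
    have e2' : ip (deriv η x.2) (α x.2) = 0 := by rw [ip_comm]; exact e2
    have e3' : ip (deriv α x.2) (deriv η x.2) = -(1 / a x.2) := by rw [ip_comm]; exact e3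
    have e4' := e4
    rw [ip_comm] at e4'
    apply inducedMetric_eq_semiGeodesicMetric
    · rw [h0 hx]
      simp only [ip_add_left, ip_add_right, ip_smul_left, ip_smul_right, hαα x hx, hα11 x hx, s1, s1']
      ring
    · rw [h0 hx, h1 hx]
      simp only [ip_add_left, ip_add_right, ip_smul_left, ip_smul_right, hαα x hx, hα11 x hx, s1,
        s1', s2, s3, e2, e3']
      field_simp
      ring
    · rw [h1 hx]
      simp only [ip_add_left, ip_add_right, ip_smul_left, ip_smul_right, hαα x hx, hα11 x hx, s1,
        s1', s2, s3, s2', s3', e1, e2, e3', e2', e3, e4, e4', hα22 x hx, hB]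
      field_simp
      ring
  have hKg : ∀ x, metricGaussCurvature (semiGeodesicMetric m) x = k x := fun x => by
    rw [metricGaussCurvature_semiGeodesicMetric]
  have hk0 : ∀ x ∈ I ×ˢ J, k x ≠ 0 := fun x hx => by rw [← hKg]; exact (hKL x hx).1
  -- the mean curvature vector
  have hb0 : EqOn (pd 0 b) (fun x => -(a x.2 * k x)) (I ×ˢ J) := by
    intro x hx
    rw [hb, pd_sub (dD (toD ha1) x hx) (dD ((toD ha).mul hm0L) x hx),
      pd_mul (dD (toD ha) x hx) (dD hm0L x hx), pd_add (dD hm0 x hx) (dD (toD hLs) x hx),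
      p0 ha1 x hx, p0 ha x hx, p0 hLs x hx]
    simp [hk]
  have hbα : ContDiffOn ℝ ∞ (fun q : ℝ × ℝ => b q • α q.2) (I ×ˢ J) := hbs.smul (toD hα)
  have haα : ContDiffOn ℝ ∞ (fun q : ℝ × ℝ => a q.2 • deriv α q.2) (I ×ˢ J) :=
    (toD ha).smul (toD hα1)
  have h00 : EqOn (pd 0 (pd 0 F)) (fun x => -(a x.2 * k x) • α x.2) (I ×ˢ J) := by
    intro x hx
    rw [pd_congr hD h0 0 hx, pd_add (dD hbα x hx) (dD haα x hx),
      pd_smul (dD hbs x hx) (dD (toD hα) x hx), pd_smul (dD (toD ha) x hx) (dD (toD hα1) x hx),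
      p0 hα x hx, p0 hα1 x hx, p0 ha x hx, hb0 hx]
    simp
  have h10 : EqOn (pd 1 (pd 0 F)) (fun x => pd 1 b x • α x.2 + (b x + deriv a x.2) • deriv α x.2
      + a x.2 • deriv (deriv α) x.2) (I ×ˢ J) := by
    intro x hx
    rw [pd_congr hD h0 1 hx, pd_add (dD hbα x hx) (dD haα x hx),
      pd_smul (dD hbs x hx) (dD (toD hα) x hx), pd_smul (dD (toD ha) x hx) (dD (toD hα1) x hx),
      p1 hα x hx, p1 hα1 x hx, p1 ha x hx]
    module
  set c : ℝ × ℝ → ℝ := fun x => pd 1 b x + pd 0 m x * b x + m x * -(a x.2 * k x) with hc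
  have hH : EqOn (meanCurvature F) (fun x => -(c x • α x.2
      + ((2 * deriv a x.2 - a x.2 * L x.2) • deriv α x.2 + a x.2 • deriv (deriv α) x.2)))
      (I ×ˢ J) := by
    intro x hx
    rw [meanCurvature_of_semiGeodesic hD hFs hg hx, h0 hx, h00 hx, h10 hx]
    simp only [hc, hb]
    module
  refine ⟨⟨hD, hFs, ?_, ?_, ?_⟩, ?_⟩
  · intro x hx
    rw [hg hx, det_semiGeodesicMetric]; norm_num
  · intro x hx
    refine ⟨?_, ?_⟩
    · rw [meanCurvature_of_semiGeodesic hD hFs hg hx]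
      exact neg_ne_zero.2 (hH0 x hx)
    · obtain ⟨c₀, c₁, hcc⟩ := hspan x hx
      obtain ⟨ha0, -, -, -, e1, e2, e3, e4⟩ := hJs x.2 hx.2
      rw [hcc, ip_add_right, ip_smul_right, ip_smul_right, e3, ip_comm, e2] at e4
      have hc1 : a x.2 * c₁ = -(2 * deriv a x.2 - a x.2 * L x.2) := by
        field_simp at e4
        linear_combination -e4
      have : meanCurvature F x = -(c x + a x.2 * c₀) • α x.2 := by
        have e : 2 * deriv a x.2 - a x.2 * L x.2 = -(a x.2 * c₁) := by rw [hc1]; ring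
        rw [hH hx]
        simp only [hcc, e]
        module
      rw [this, ip_smul_left, ip_smul_right, hαα x hx]
      ring
  · intro x hx
    have hb1s := contDiffOn_pd hD hbs 1
    have hak := (toD ha).mul hks
    have hcs : ContDiffOn ℝ ∞ c (I ×ˢ J) := (hb1s.add (hm0.mul hbs)).add (hm.mul hak.neg)
    have hc0 : EqOn (pd 0 c) (fun _ => 0) (I ×ˢ J) := by
      intro y hy
      have hb10 : pd 0 (pd 1 b) y = -(deriv a y.2 * k y + a y.2 * pd 1 k y) := by
        rw [pd_comm hD hbs hy, pd_congr hD hb0 1 hy, pd_neg,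
          pd_mul (dD (toD ha) y hy) (dD hks y hy), p1 ha y hy]
      have hLy := (hKL y hy).2
      rw [intrinsicL, metricGaussCurvature_semiGeodesicMetric, ← hk, div_eq_iff (hk0 y hy)] at hLy
      rw [hc, pd_add (dD (hb1s.add (hm0.mul hbs)) y hy) (dD (hm.mul hak.neg) y hy),
        pd_add (dD hb1s y hy) (dD (hm0.mul hbs) y hy), pd_mul (dD hm0 y hy) (dD hbs y hy),
        pd_mul (dD hm y hy) (dD hak.neg y hy), pd_neg, pd_mul (dD (toD ha) y hy) (dD hks y hy),
        hb10, hb0 hy, p0 ha y hy, ← hk]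
      simp only [hb]
      linear_combination a y.2 * hLy
    have hw : ContDiffOn ℝ ∞ (fun t => (2 * deriv a t - a t * L t) • deriv α t
        + a t • deriv (deriv α) t) J :=
      (((contDiffOn_const.mul ha1).sub (ha.mul hLs)).smul hα1).add (ha.smul hα2)
    have hH0' : EqOn (pd 0 (meanCurvature F)) (fun _ => 0) (I ×ˢ J) := by
      intro y hy
      have hcα : ContDiffOn ℝ ∞ (fun x : ℝ × ℝ => c x • α x.2) (I ×ˢ J) := hcs.smul (toD hα)
      rw [pd_congr hD hH 0 hy, pd_neg, pd_add (dD hcα y hy) (dD (toD hw) y hy),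
        p0 hw y hy, pd_smul (dD hcs y hy) (dD (toD hα) y hy), hc0 hy, p0 hα y hy]
      simp
    rw [bitension_of_semiGeodesic hD hFs hg hx, pd_congr hD hH0' 1 hx, pd_congr hD hH0' 0 hx,
      hH0' hx, pd_const, pd_const]
    simp
  · intro x hx
    rw [metricGaussCurvature_congr hD hg hx, hKg]
    exact hk0 x hx

end Families

end QuasiMinimal
end

noncomputable section
namespace QuasiMinimal
open Set

/-! ### Congruence up to a change of parameters -/

section Diffeo

variable {Ω Ω' : Set (ℝ × ℝ)} {F : ℝ × ℝ → E42}

/-- `φ` is a diffeomorphism between open subsets of the plane. -/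
def IsDiffeo (φ : OpenPartialHomeomorph (ℝ × ℝ) (ℝ × ℝ)) : Prop :=
  ContDiffOn ℝ ∞ φ φ.source ∧ ContDiffOn ℝ ∞ φ.symm φ.target

lemma IsDiffeo.symm {φ : OpenPartialHomeomorph (ℝ × ℝ) (ℝ × ℝ)} (h : IsDiffeo φ) :
    IsDiffeo φ.symm := ⟨h.2, h.1⟩

lemma IsDiffeo.trans {φ ψ : OpenPartialHomeomorph (ℝ × ℝ) (ℝ × ℝ)} (h : IsDiffeo φ)
    (h' : IsDiffeo ψ) : IsDiffeo (φ.trans ψ) :=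
  ⟨h'.1.comp (h.1.mono (by simp)) fun x hx => by simpa using hx.2,
    h.2.comp (h'.2.mono (by simp)) fun x hx => by simpa using hx.2⟩

lemma IsDiffeo.isCoordChange {φ : OpenPartialHomeomorph (ℝ × ℝ) (ℝ × ℝ)} (h : IsDiffeo φ) :
    IsCoordChange φ.source φ.target (fun x => (φ x).1) (fun x => (φ x).2) := by
  have h1 : ContDiffOn ℝ ∞ (fun x => (φ x).1) φ.source := contDiff_fst.comp_contDiffOn h.1
  have h2 : ContDiffOn ℝ ∞ (fun x => (φ x).2) φ.source := contDiff_snd.comp_contDiffOn h.1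
  refine ⟨φ.open_source, φ.open_target, h1, h2, fun x hx => φ.map_source hx, fun x hx hj => ?_⟩
  have e1 : ∀ (u : ℝ × ℝ → ℝ), ContDiffOn ℝ ∞ u φ.target → ∀ i,
      pd i (fun x => u (φ x)) x = pd i (fun x => (φ x).1) x * pd 0 u (φ x)
        + pd i (fun x => (φ x).2) x * pd 1 u (φ x) := fun u hu i =>
    pd_comp (f := u) (differentiableAt_of_contDiffOn φ.open_source h1 hx)
      (differentiableAt_of_contDiffOn φ.open_source h2 hx)
      (differentiableAt_of_contDiffOn φ.open_target hu (φ.map_source hx)) i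
  have a := e1 (fun y => (φ.symm y).1) (contDiff_fst.comp_contDiffOn h.2)
  have b := e1 (fun y => (φ.symm y).2) (contDiff_snd.comp_contDiffOn h.2)
  have a' : EqOn (fun x => (φ.symm (φ x)).1) (fun x => x.1) φ.source := fun y hy => by
    simp [φ.left_inv hy]
  have b' : EqOn (fun x => (φ.symm (φ x)).2) (fun x => x.2) φ.source := fun y hy => by
    simp [φ.left_inv hy]
  have a0 := a 0
  have a1 := a 1
  have b0 := b 0
  have b1 := b 1
  simp only [pd_congr φ.open_source a' _ hx, pd_congr φ.open_source b' _ hx, pd_fst, pd_snd,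
    if_true, one_ne_zero, if_false] at a0 a1 b0 b1
  set A0 := pd 0 (fun x => (φ x).1) x
  set A1 := pd 1 (fun x => (φ x).1) x
  set B0 := pd 0 (fun x => (φ x).2) x
  set B1 := pd 1 (fun x => (φ x).2) x
  set U0 := pd 0 (fun y => (φ.symm y).1) (φ x)
  set U1 := pd 1 (fun y => (φ.symm y).1) (φ x)
  set V0 := pd 0 (fun y => (φ.symm y).2) (φ x)
  set V1 := pd 1 (fun y => (φ.symm y).2) (φ x)
  have : (1 : ℝ) = 0 := by
    linear_combination (1 : ℝ) * a0 + (A0 * U0 + B0 * U1) * b1 - (A1 * U0 + B1 * U1) * b0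
      + (U0 * V1 - U1 * V0) * hj
  exact one_ne_zero this

namespace IsQMBiharmonicOn

lemma mono (h : IsQMBiharmonicOn Ω F) (hΩ' : IsOpen Ω') (hs : Ω' ⊆ Ω) : IsQMBiharmonicOn Ω' F :=
  ⟨hΩ', h.smooth.mono hs, fun q hq => h.det_ne_zero q (hs hq), fun q hq => h.isLightLike q (hs hq),
    fun q hq => h.bitension_eq_zero q (hs hq)⟩

lemma congr {G : ℝ × ℝ → E42} (h : IsQMBiharmonicOn Ω F) (hFG : EqOn G F Ω) :
    IsQMBiharmonicOn Ω G :=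
  ⟨h.isOpen, h.smooth.congr hFG,
    fun q hq => by rw [inducedMetric_congr h.isOpen hFG hq]; exact h.det_ne_zero q hq,
    fun q hq => by rw [meanCurvature_congr h.isOpen hFG hq]; exact h.isLightLike q hq,
    fun q hq => by rw [bitension_congr h.isOpen hFG hq]; exact h.bitension_eq_zero q hq⟩

lemma comp {a b : ℝ × ℝ → ℝ} (h : IsQMBiharmonicOn Ω F) (hc : IsCoordChange Ω' Ω a b) :
    IsQMBiharmonicOn Ω' (fun x => F (a x, b x)) :=
  ⟨hc.isOpen_source, hc.contDiffOn_comp h.smooth,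
    fun q hq => by
      rw [hc.det_inducedMetric_comp h.smooth hq]
      exact mul_ne_zero (pow_ne_zero 2 (hc.jac_ne_zero q hq)) (h.det_ne_zero _ (hc.mapsTo q hq)),
    fun q hq => by
      rw [hc.meanCurvature_comp h.smooth hq (h.det_ne_zero _ (hc.mapsTo q hq))]
      exact h.isLightLike _ (hc.mapsTo q hq),
    fun q hq => by
      rw [hc.bitension_comp h.smooth h.det_ne_zero hq]
      exact h.bitension_eq_zero _ (hc.mapsTo q hq)⟩

lemma isometry {T : E42 ≃ᵃ[ℝ] E42} (hT : IsIsometry T) (h : IsQMBiharmonicOn Ω F) :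
    IsQMBiharmonicOn Ω (fun x => T (F x)) :=
  ⟨h.isOpen, (contDiff_affine T).comp_contDiffOn h.smooth,
    fun q hq => by rw [inducedMetric_isometry hT]; exact h.det_ne_zero q hq,
    fun q hq => by
      rw [meanCurvature_isometry hT, isLightLike_isometry hT]; exact h.isLightLike q hq,
    fun q hq => by rw [bitension_isometry hT, h.bitension_eq_zero q hq, map_zero]⟩

lemma symm_diffeo {φ : OpenPartialHomeomorph (ℝ × ℝ) (ℝ × ℝ)} (h : IsQMBiharmonicOn Ω F)
    (hφ : IsDiffeo φ) (hs : φ.source ⊆ Ω) : IsQMBiharmonicOn φ.target (fun x => F (φ.symm x)) :=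
  (h.mono φ.open_source hs).comp hφ.symm.isCoordChange

lemma metricGaussCurvature_symm_diffeo {φ : OpenPartialHomeomorph (ℝ × ℝ) (ℝ × ℝ)}
    (h : IsQMBiharmonicOn Ω F) (hφ : IsDiffeo φ) (hs : φ.source ⊆ Ω) {x : ℝ × ℝ}
    (hx : x ∈ φ.target) :
    metricGaussCurvature (inducedMetric fun x => F (φ.symm x)) x
      = metricGaussCurvature (inducedMetric F) (φ.symm x) :=
  hφ.symm.isCoordChange.metricGaussCurvature_comp (h.mono φ.open_source hs).smooth
    (h.mono φ.open_source hs).det_ne_zero hx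

lemma continuousOn_metricGaussCurvature (h : IsQMBiharmonicOn Ω F) :
    ContinuousOn (metricGaussCurvature (inducedMetric F)) Ω := by
  have hα := contDiffOn_secondFundForm h.isOpen h.smooth h.det_ne_zero
  have hd : ContDiffOn ℝ ∞ (fun x => (inducedMetric F x).det) Ω := by
    simp only [Matrix.det_fin_two]
    have hg := contDiffOn_inducedMetric h.isOpen h.smooth
    exact ((hg 0 0).mul (hg 1 1)).sub ((hg 0 1).mul (hg 1 0))
  exact (ContDiffOn.congr (f := fun x => (ip (secondFundForm F 0 0 x) (secondFundForm F 1 1 x)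
      - ip (secondFundForm F 0 1 x) (secondFundForm F 0 1 x)) / (inducedMetric F x).det)
    (((contDiffOn_ip (hα 0 0) (hα 1 1)).sub (contDiffOn_ip (hα 0 1) (hα 0 1))).div hd h.det_ne_zero)
    fun x hx => gauss_equation h.isOpen h.smooth h.det_ne_zero hx).continuousOn

end IsQMBiharmonicOn

/-- Near `q₀`, the parametrized surface `F`, given on `Ω`, is congruent to a member of the class
`P`, up to a change of the parameters. -/
def CoordCongruent (P : Set (ℝ × ℝ) → (ℝ × ℝ → E42) → Prop) (Ω : Set (ℝ × ℝ)) (F : ℝ × ℝ → E42)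
    (q₀ : ℝ × ℝ) : Prop :=
  ∃ φ : OpenPartialHomeomorph (ℝ × ℝ) (ℝ × ℝ), IsDiffeo φ ∧ q₀ ∈ φ.source ∧ φ.source ⊆ Ω ∧
    ∃ T : E42 ≃ᵃ[ℝ] E42, IsIsometry T ∧
      ∃ G : ℝ × ℝ → E42, P φ.target G ∧ ∀ x ∈ φ.target, T (F (φ.symm x)) = G x

variable {P : Set (ℝ × ℝ) → (ℝ × ℝ → E42) → Prop} {q₀ : ℝ × ℝ}

lemma CoordCongruent.of_diffeo {φ : OpenPartialHomeomorph (ℝ × ℝ) (ℝ × ℝ)} (hφ : IsDiffeo φ)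
    (hq₀ : q₀ ∈ φ.source) (hs : φ.source ⊆ Ω)
    (h : CoordCongruent P φ.target (fun x => F (φ.symm x)) (φ q₀)) : CoordCongruent P Ω F q₀ := by
  obtain ⟨ψ, hψ, hψ0, hψs, T, hT, G, hG, hTG⟩ := h
  have ht : (φ.trans ψ).target = ψ.target := by
    rw [OpenPartialHomeomorph.trans_target]
    exact inter_eq_left.2 fun x hx => hψs (ψ.map_target hx)
  refine ⟨φ.trans ψ, hφ.trans hψ, ?_, ?_, T, hT, G, by rwa [ht], fun x hx => hTG x (ht ▸ hx)⟩
  · rw [OpenPartialHomeomorph.trans_source]; exact ⟨hq₀, hψ0⟩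
  · rw [OpenPartialHomeomorph.trans_source]; exact inter_subset_left.trans hs

lemma CoordCongruent.refl (hΩ : IsOpen Ω) (h : P Ω F) (hq₀ : q₀ ∈ Ω) : CoordCongruent P Ω F q₀ :=
  ⟨OpenPartialHomeomorph.ofSet Ω hΩ, ⟨contDiffOn_id, contDiffOn_id⟩, hq₀, subset_rfl,
    AffineEquiv.refl ℝ E42, fun _ _ => rfl, F, h, fun _ _ => rfl⟩

lemma CoordCongruent.mono (h : CoordCongruent P Ω F q₀) (hs : Ω ⊆ Ω') :
    CoordCongruent P Ω' F q₀ := by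
  obtain ⟨ψ, hψ, hψ0, hψs, S⟩ := h
  exact ⟨ψ, hψ, hψ0, hψs.trans hs, S⟩

/-- A diffeomorphism of the plane can be shrunk so that its range is a product of open intervals
inside a given neighbourhood of a point of the range. -/
lemma exists_restr_box {φ : OpenPartialHomeomorph (ℝ × ℝ) (ℝ × ℝ)} (hφ : IsDiffeo φ)
    (hq₀ : q₀ ∈ φ.source) :
    ∃ ψ : OpenPartialHomeomorph (ℝ × ℝ) (ℝ × ℝ), IsDiffeo ψ ∧ q₀ ∈ ψ.source ∧
      ψ.source ⊆ φ.source ∧ ⇑ψ = φ ∧ ⇑ψ.symm = φ.symm ∧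
      ∃ I J : Set ℝ, IsOpenInterval I ∧ IsOpenInterval J ∧ ψ.target = I ×ˢ J := by
  obtain ⟨r, hr, hB⟩ := Metric.isOpen_iff.1 φ.open_target _ (φ.map_source hq₀)
  have hball : Metric.ball (φ q₀) r = Ioo ((φ q₀).1 - r) ((φ q₀).1 + r)
      ×ˢ Ioo ((φ q₀).2 - r) ((φ q₀).2 + r) := by
    rw [← ball_prod_same, Real.ball_eq_Ioo, Real.ball_eq_Ioo]
  set B := Metric.ball (φ q₀) r
  have hBo : IsOpen B := Metric.isOpen_ball
  refine ⟨(φ.symm.restrOpen B hBo).symm, ⟨hφ.1.mono ?_, hφ.2.mono ?_⟩, ?_, ?_, rfl, rfl,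
    Ioo ((φ q₀).1 - r) ((φ q₀).1 + r), Ioo ((φ q₀).2 - r) ((φ q₀).2 + r),
    isOpenInterval_Ioo _ _, isOpenInterval_Ioo _ _, ?_⟩
  · rw [OpenPartialHomeomorph.symm_source]
    intro x hx; simp at hx; exact hx.1
  · rw [OpenPartialHomeomorph.symm_target, OpenPartialHomeomorph.restrOpen_source]
    exact inter_subset_left
  · simp [hq₀, B, hr]
  · intro x hx; simp at hx; exact hx.1
  · rw [OpenPartialHomeomorph.symm_target, OpenPartialHomeomorph.restrOpen_source, ← hball]
    exact inter_eq_right.2 hB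

/-- The interchange of the two parameters. -/
def swapDiffeo (hΩ : IsOpen Ω) : OpenPartialHomeomorph (ℝ × ℝ) (ℝ × ℝ) :=
  (OpenPartialHomeomorph.ofSet Ω hΩ).trans (Homeomorph.prodComm ℝ ℝ).toOpenPartialHomeomorph

lemma isDiffeo_swapDiffeo (hΩ : IsOpen Ω) : IsDiffeo (swapDiffeo hΩ) :=
  ⟨(contDiff_snd.prodMk contDiff_fst).contDiffOn, (contDiff_snd.prodMk contDiff_fst).contDiffOn⟩

lemma swapDiffeo_source (hΩ : IsOpen Ω) : (swapDiffeo hΩ).source = Ω := by simp [swapDiffeo]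

lemma swapDiffeo_target (hΩ : IsOpen Ω) : (swapDiffeo hΩ).target = Prod.swap ⁻¹' Ω := by
  simp [swapDiffeo]

lemma CoordCongruent.of_swap (hΩ : IsOpen Ω) (hq₀ : q₀ ∈ Ω)
    (h : CoordCongruent P (Prod.swap ⁻¹' Ω) (fun x => F x.swap) q₀.swap) :
    CoordCongruent P Ω F q₀ :=
  CoordCongruent.of_diffeo (isDiffeo_swapDiffeo hΩ) (by rwa [swapDiffeo_source])
    (by rw [swapDiffeo_source]) (by rw [swapDiffeo_target]; exact h)

end Diffeo

end QuasiMinimal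
end

noncomputable section
namespace QuasiMinimal
open Set

/-! ### Existence of null coordinates -/

section NullCoordinates

variable {Ω : Set (ℝ × ℝ)} {F : ℝ × ℝ → E42} {q₀ : ℝ × ℝ}

lemma ip_meanCurvature_pd {q : ℝ × ℝ} (hΩ : IsOpen Ω) (hF : ContDiffOn ℝ ∞ F Ω)
    (hdet : ∀ x ∈ Ω, (inducedMetric F x).det ≠ 0) (hq : q ∈ Ω) (i : Fin 2) :
    ip (meanCurvature F q) (pd i F q) = 0 := by
  have h := fun j k => ip_secondFundForm_pd hΩ hF hq (hdet q hq) j k i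
  simp only [meanCurvature, Fin.sum_univ_two, ip_smul_left, ip_add_left, h]
  ring

/-- A light-like normal vector forces the tangent planes to be indefinite. -/
lemma IsQMBiharmonicOn.det_neg (h : IsQMBiharmonicOn Ω F) {q : ℝ × ℝ} (hq : q ∈ Ω) :
    (inducedMetric F q).det < 0 := by
  refine lt_of_le_of_ne ?_ (h.det_ne_zero q hq)
  have hn := ip_meanCurvature_pd h.isOpen h.smooth h.det_ne_zero hq
  have := gram_nonpos_of_null_normal (h.isLightLike q hq).1 (h.isLightLike q hq).2 (hn 0) (hn 1)
  rw [det_inducedMetric]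
  exact this

/-- Near each point there are coordinates whose coordinate lines are light-like: they are first
integrals of the two null direction fields. -/
lemma IsQMBiharmonicOn.exists_null_coordinates (h : IsQMBiharmonicOn Ω F) (hq₀ : q₀ ∈ Ω) :
    ∃ φ : OpenPartialHomeomorph (ℝ × ℝ) (ℝ × ℝ), IsDiffeo φ ∧ q₀ ∈ φ.source ∧ φ.source ⊆ Ω ∧
      ∀ x ∈ φ.target,
        ip (pd 0 (fun y => F (φ.symm y)) x) (pd 0 (fun y => F (φ.symm y)) x) = 0 ∧
        ip (pd 1 (fun y => F (φ.symm y)) x) (pd 1 (fun y => F (φ.symm y)) x) = 0 := by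
  have hΩ := h.isOpen
  have hp := contDiffOn_pd hΩ h.smooth
  set E : ℝ × ℝ → ℝ := fun x => ip (pd 0 F x) (pd 0 F x) with hE
  set f : ℝ × ℝ → ℝ := fun x => ip (pd 0 F x) (pd 1 F x) with hf
  set g : ℝ × ℝ → ℝ := fun x => ip (pd 1 F x) (pd 1 F x) with hg
  have hEs : ContDiffOn ℝ ∞ E Ω := contDiffOn_ip (hp 0) (hp 0)
  have hfs : ContDiffOn ℝ ∞ f Ω := contDiffOn_ip (hp 0) (hp 1)
  have hgs : ContDiffOn ℝ ∞ g Ω := contDiffOn_ip (hp 1) (hp 1)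
  set D : ℝ × ℝ → ℝ := fun x => f x ^ 2 - E x * g x with hD
  have hDpos : ∀ x ∈ Ω, 0 < D x := by
    intro x hx
    have h1 := h.det_neg hx
    simp only [det_inducedMetric, inducedMetric_apply] at h1
    simp only [hD, hE, hf, hg]
    nlinarith
  have hDs : ContDiffOn ℝ ∞ (fun x => √(D x)) Ω :=
    ((hfs.pow 2).sub (hEs.mul hgs)).sqrt fun x hx => (hDpos x hx).ne'
  -- the sign is chosen so that `A` does not vanish at `q₀`
  obtain ⟨σ, hσ, hσ0⟩ : ∃ σ : ℝ, σ ^ 2 = 1 ∧ f q₀ + σ * √(D q₀) ≠ 0 := by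
    have := Real.sqrt_pos.2 (hDpos q₀ hq₀)
    rcases le_or_gt 0 (f q₀) with h0 | h0
    · exact ⟨1, by norm_num, by positivity⟩
    · exact ⟨-1, by norm_num, by linarith⟩
  set A : ℝ × ℝ → ℝ := fun x => f x + σ * √(D x) with hA
  have hAs : ContDiffOn ℝ ∞ A Ω := hfs.add (contDiffOn_const.mul hDs)
  have hAq : ∀ x ∈ Ω, A x ^ 2 - 2 * f x * A x + E x * g x = 0 := by
    intro x hx
    have := Real.sq_sqrt (hDpos x hx).le
    simp only [hA]
    have e : D x = f x ^ 2 - E x * g x := rfl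
    linear_combination σ ^ 2 * this + D x * hσ + e
  have hAE : ∀ x ∈ Ω, A x ≠ 0 → A x ^ 2 - E x * g x ≠ 0 := by
    intro x hx h0
    have h1 : A x ^ 2 - E x * g x = 2 * A x * (σ * √(D x)) := by
      have := hAq x hx
      simp only [hA] at this ⊢
      linear_combination -this
    have h2 := (Real.sqrt_pos.2 (hDpos x hx)).ne'
    have h3 : σ ≠ 0 := fun h => by simp [h] at hσ
    rw [h1]
    positivity
  set Ω₁ : Set (ℝ × ℝ) := Ω ∩ A ⁻¹' {0}ᶜ with hΩ₁
  have hΩ₁o : IsOpen Ω₁ := hAs.continuousOn.isOpen_inter_preimage hΩ isOpen_compl_singleton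
  have hΩ₁s : Ω₁ ⊆ Ω := inter_subset_left
  set l : ℝ × ℝ → ℝ := fun x => -E x / A x with hl
  set μ : ℝ × ℝ → ℝ := fun x => -g x / A x with hμ
  have hls : ContDiffOn ℝ ∞ l Ω₁ := ((hEs.mono hΩ₁s).neg).div (hAs.mono hΩ₁s) fun x hx => hx.2
  have hμs : ContDiffOn ℝ ∞ μ Ω₁ := ((hgs.mono hΩ₁s).neg).div (hAs.mono hΩ₁s) fun x hx => hx.2
  have hswap : ContDiff ℝ ∞ (Prod.swap : ℝ × ℝ → ℝ × ℝ) := contDiff_snd.prodMk contDiff_fst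
  obtain ⟨N₁, u, hN₁, hqN₁, hN₁s, hu, hu0⟩ := exists_firstIntegral hΩ₁o hls ⟨hq₀, hσ0⟩
  obtain ⟨N₂, v', hN₂, hqN₂, hN₂s, hv', hv0'⟩ := exists_firstIntegral (q₀ := q₀.swap)
    (hΩ₁o.preimage continuous_swap) (l := fun x => μ x.swap)
    (hμs.comp hswap.contDiffOn fun x hx => hx) (by simpa using ⟨hq₀, hσ0⟩)
  set N := N₁ ∩ Prod.swap ⁻¹' N₂ with hN
  have hNo : IsOpen N := hN₁.inter (hN₂.preimage continuous_swap)
  have hvs : ContDiffOn ℝ ∞ (fun x => v' (x.2, x.1)) N :=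
    hv'.comp hswap.contDiffOn fun x hx => hx.2
  have hus : ContDiffOn ℝ ∞ u N := hu.mono inter_subset_left
  set v : ℝ × ℝ → ℝ := fun x => v' (x.2, x.1) with hv
  have hpv : ∀ x ∈ N, pd 1 v x + μ x * pd 0 v x = 0 ∧ pd 0 v x ≠ 0 := by
    intro x hx
    have hd : DifferentiableAt ℝ v' (x.2, x.1) := differentiableAt_of_contDiffOn hN₂ hv' hx.2
    have e : ∀ i, pd i v x = pd i (fun y : ℝ × ℝ => y.2) x • pd 0 v' (x.2, x.1)
        + pd i (fun y : ℝ × ℝ => y.1) x • pd 1 v' (x.2, x.1) := fun i =>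
      pd_comp differentiableAt_snd differentiableAt_fst hd i
    have := hv0' (x.2, x.1) hx.2
    rw [e 0, e 1]
    simpa [pd_fst, pd_snd] using this
  have hlμ : ∀ x ∈ N, 1 - l x * μ x ≠ 0 := by
    intro x hx
    obtain ⟨hxΩ, hxA⟩ := hN₁s hx.1
    have hxA' : A x ≠ 0 := hxA
    have : 1 - l x * μ x = (A x ^ 2 - E x * g x) / A x ^ 2 := by
      simp only [hl, hμ]; field_simp
    rw [this]
    exact div_ne_zero (hAE x hxΩ hxA') (pow_ne_zero 2 hxA')
  obtain ⟨φ, hφ0, hφs, hφ, hφi⟩ := exists_localDiffeo hNo hus hvs (fun x hx => by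
    obtain ⟨e1, e2⟩ := hu0 x hx.1
    obtain ⟨e3, e4⟩ := hpv x hx
    have : pd 0 u x * pd 1 v x - pd 1 u x * pd 0 v x
        = -(1 - l x * μ x) * (pd 1 u x * pd 0 v x) := by
      linear_combination pd 1 v x * e1 - l x * pd 1 u x * e3
    rw [this]
    exact mul_ne_zero (neg_ne_zero.2 (hlμ x hx)) (mul_ne_zero e2 e4)) ⟨hqN₁, by simpa using hqN₂⟩
  have hdiff : IsDiffeo φ := ⟨((hus.prodMk hvs).mono hφs).congr fun x _ => hφ x, hφi⟩
  have hφΩ : φ.source ⊆ Ω := hφs.trans (inter_subset_left.trans (hN₁s.trans hΩ₁s))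
  refine ⟨φ, hdiff, hφ0, hφΩ, fun x hx => ?_⟩
  set G : ℝ × ℝ → E42 := fun y => F (φ.symm y) with hG
  have hGs : ContDiffOn ℝ ∞ G φ.target := (h.symm_diffeo hdiff hφΩ).smooth
  set q := φ.symm x with hq
  have hqs : q ∈ φ.source := φ.map_target hx
  have hφq : φ q = x := φ.right_inv hx
  have hqN := hφs hqs
  have hFG : EqOn F (fun y => G (u y, v y)) φ.source := by
    intro y hy
    simp only [hG]
    rw [← hφ y, φ.left_inv hy]
  have hx' : (u q, v q) = x := by rw [← hφ q, hφq]
  have hpF : ∀ i, pd i F q = pd i u q • pd 0 G x + pd i v q • pd 1 G x := by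
    intro i
    rw [pd_congr φ.open_source hFG i hqs]
    have := pd_comp (f := G) (differentiableAt_of_contDiffOn hNo hus hqN)
      (differentiableAt_of_contDiffOn hNo hvs hqN)
      (differentiableAt_of_contDiffOn φ.open_target hGs (by rw [hx']; exact hx)) i
    rw [hx'] at this
    exact this
  obtain ⟨e1, e2⟩ := hu0 q hqN.1
  obtain ⟨e3, e4⟩ := hpv q hqN
  obtain ⟨hqΩ, hqA⟩ := hN₁s hqN.1
  have hqA' : A q ≠ 0 := hqA
  have hquad := hAq q hqΩ
  have hlA : l q * A q = -E q := by simp only [hl]; field_simp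
  have hμA : μ q * A q = -g q := by simp only [hμ]; field_simp
  have k1 : pd 0 F q + l q • pd 1 F q = ((1 - l q * μ q) * pd 0 v q) • pd 1 G x := by
    rw [hpF, hpF]
    have e1' : pd 0 u q = -(l q * pd 1 u q) := by linear_combination e1
    have e3' : pd 1 v q = -(μ q * pd 0 v q) := by linear_combination e3
    rw [e1', e3']
    module
  have k2 : μ q • pd 0 F q + pd 1 F q = ((1 - l q * μ q) * pd 1 u q) • pd 0 G x := by
    rw [hpF, hpF]
    have e1' : pd 0 u q = -(l q * pd 1 u q) := by linear_combination e1
    have e3' : pd 1 v q = -(μ q * pd 0 v q) := by linear_combination e3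
    rw [e1', e3']
    module
  have n1 : ip (pd 0 F q + l q • pd 1 F q) (pd 0 F q + l q • pd 1 F q) = 0 := by
    simp only [ip_add_left, ip_add_right, ip_smul_left, ip_smul_right, ip_comm (pd 1 F q) (pd 0 F q)]
    change E q + l q * f q + l q * (f q + l q * g q) = 0
    have : A q ^ 2 * (E q + l q * f q + l q * (f q + l q * g q)) = 0 := by
      linear_combination E q * hquad + (2 * A q * f q + g q * (l q * A q - E q)) * hlA
    exact (mul_eq_zero.1 this).resolve_left (pow_ne_zero 2 hqA')
  have n2 : ip (μ q • pd 0 F q + pd 1 F q) (μ q • pd 0 F q + pd 1 F q) = 0 := by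
    simp only [ip_add_left, ip_add_right, ip_smul_left, ip_smul_right, ip_comm (pd 1 F q) (pd 0 F q)]
    change μ q * (μ q * E q + f q) + (μ q * f q + g q) = 0
    have : A q ^ 2 * (μ q * (μ q * E q + f q) + (μ q * f q + g q)) = 0 := by
      linear_combination g q * hquad + (2 * A q * f q + E q * (μ q * A q - g q)) * hμA
    exact (mul_eq_zero.1 this).resolve_left (pow_ne_zero 2 hqA')
  have c1 := mul_ne_zero (hlμ q hqN) e4
  have c2 := mul_ne_zero (hlμ q hqN) e2
  rw [k1, ip_smul_left, ip_smul_right] at n1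
  rw [k2, ip_smul_left, ip_smul_right] at n2
  exact ⟨((mul_eq_zero.1 n2).resolve_left c2 |> mul_eq_zero.1).resolve_left c2,
    ((mul_eq_zero.1 n1).resolve_left c1 |> mul_eq_zero.1).resolve_left c1⟩

end NullCoordinates

end QuasiMinimal
end

noncomputable section
namespace QuasiMinimal
open Set

/-! ### Quasi-minimal biharmonic surfaces in null coordinates -/

lemma eq_of_pd_zero {I J : Set ℝ} {V : Type*} [NormedAddCommGroup V] [NormedSpace ℝ V] {f : ℝ × ℝ → V}
    (hI : IsOpenInterval I) (hJ : IsOpenInterval J) (hf : ContDiffOn ℝ ∞ f (I ×ˢ J))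
    (h0 : ∀ x ∈ I ×ˢ J, pd 0 f x = 0) {u u' v : ℝ} (hu : u ∈ I) (hu' : u' ∈ I) (hv : v ∈ J) :
    f (u, v) = f (u', v) :=
  eq_of_hasDerivAt_zero hI (F := fun u => f (u, v)) (fun x hx => by
    have := hasDerivAt_slice_zero (q := (x, v))
      (differentiableAt_of_contDiffOn (hI.1.prod hJ.1) hf ⟨hx, hv⟩)
    rwa [h0 _ ⟨hx, hv⟩] at this) hu hu'

lemma eq_of_pd_one {I J : Set ℝ} {V : Type*} [NormedAddCommGroup V] [NormedSpace ℝ V] {f : ℝ × ℝ → V}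
    (hI : IsOpenInterval I) (hJ : IsOpenInterval J) (hf : ContDiffOn ℝ ∞ f (I ×ˢ J))
    (h0 : ∀ x ∈ I ×ˢ J, pd 1 f x = 0) {u v v' : ℝ} (hu : u ∈ I) (hv : v ∈ J) (hv' : v' ∈ J) :
    f (u, v) = f (u, v') :=
  eq_of_hasDerivAt_zero hJ (F := fun v => f (u, v)) (fun x hx => by
    have := hasDerivAt_slice_one (q := (u, x))
      (differentiableAt_of_contDiffOn (hI.1.prod hJ.1) hf ⟨hu, hx⟩)
    rwa [h0 _ ⟨hu, hx⟩] at this) hv hv'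

/-- `F` is a quasi-minimal biharmonic surface on the product `I × J` of open intervals, and the
coordinates are null coordinates. -/
structure IsNullParametrized (I J : Set ℝ) (F : ℝ × ℝ → E42) : Prop where
  isOpenInterval_fst : IsOpenInterval I
  isOpenInterval_snd : IsOpenInterval J
  surface : IsQMBiharmonicOn (I ×ˢ J) F
  null : ∀ q ∈ I ×ˢ J, ∀ i, ip (pd i F q) (pd i F q) = 0

namespace IsNullParametrized

variable {I J : Set ℝ} {F : ℝ × ℝ → E42} (h : IsNullParametrized I J F) {q : ℝ × ℝ}
include h

lemma isOpen : IsOpen (I ×ˢ J) := h.surface.isOpen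

lemma swap : IsNullParametrized J I (fun x => F x.swap) := by
  have hc : IsCoordChange (J ×ˢ I) (I ×ˢ J) (fun x => x.2) (fun x => x.1) :=
    ⟨h.isOpenInterval_snd.1.prod h.isOpenInterval_fst.1, h.isOpen, contDiffOn_snd, contDiffOn_fst,
      fun x hx => ⟨hx.2, hx.1⟩, fun x _ => by simp [pd_fst, pd_snd]⟩
  refine ⟨h.isOpenInterval_snd, h.isOpenInterval_fst, h.surface.comp hc, fun x hx i => ?_⟩
  have e := hc.pd_comp_eq h.surface.smooth hx i
  have hx' : (x.2, x.1) ∈ I ×ˢ J := ⟨hx.2, hx.1⟩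
  change pd i (fun x => F x.swap) x = _ at e
  rw [e]
  fin_cases i
  · simpa [pd_fst, pd_snd] using h.null _ hx' 1
  · simpa [pd_fst, pd_snd] using h.null _ hx' 0

lemma contDiffOn_ip_pd : ContDiffOn ℝ ∞ (fun x => ip (pd 0 F x) (pd 1 F x)) (I ×ˢ J) :=
  contDiffOn_ip (contDiffOn_pd h.isOpen h.surface.smooth 0)
    (contDiffOn_pd h.isOpen h.surface.smooth 1)

lemma inducedMetric_eq : EqOn (inducedMetric F)
    (nullMetric fun x => ip (pd 0 F x) (pd 1 F x)) (I ×ˢ J) := fun q hq =>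
  inducedMetric_eq_nullMetric (h.null q hq 0) (h.null q hq 1)

lemma ip_pd_ne_zero : ∀ q ∈ I ×ˢ J, ip (pd 0 F q) (pd 1 F q) ≠ 0 := by
  intro q hq h0
  have := h.surface.det_ne_zero q hq
  rw [h.inducedMetric_eq hq, det_nullMetric, h0] at this
  simp at this

lemma contDiffOn_meanCurvature : ContDiffOn ℝ ∞ (meanCurvature F) (I ×ˢ J) :=
  QuasiMinimal.contDiffOn_meanCurvature h.isOpen h.surface.smooth h.surface.det_ne_zero

lemma pd_pd_eq : EqOn (pd 1 (pd 0 F))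
    (fun x => ip (pd 0 F x) (pd 1 F x) • meanCurvature F x) (I ×ˢ J) := by
  intro q hq
  simp only
  rw [meanCurvature_of_null h.isOpen h.surface.smooth h.inducedMetric_eq h.ip_pd_ne_zero hq,
    smul_smul, mul_inv_cancel₀ (h.ip_pd_ne_zero q hq), one_smul]

lemma pd_pd_meanCurvature : EqOn (pd 1 (pd 0 (meanCurvature F))) (fun _ => 0) (I ×ˢ J) := by
  intro q hq
  have := h.surface.bitension_eq_zero q hq
  rw [bitension_of_null h.isOpen h.surface.smooth h.inducedMetric_eq h.ip_pd_ne_zero hq,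
    smul_eq_zero] at this
  exact this.resolve_left (div_ne_zero (by norm_num) (h.ip_pd_ne_zero q hq))

lemma ip_meanCurvature_pd : ∀ q ∈ I ×ˢ J, ∀ i, ip (meanCurvature F q) (pd i F q) = 0 := fun _ hq i =>
  QuasiMinimal.ip_meanCurvature_pd h.isOpen h.surface.smooth h.surface.det_ne_zero hq i

lemma ip_pd_meanCurvature_self (hq : q ∈ I ×ˢ J) (i : Fin 2) :
    ip (pd i (meanCurvature F) q) (meanCurvature F q) = 0 := by
  have := pd_ip_of_const h.isOpen h.contDiffOn_meanCurvature h.contDiffOn_meanCurvature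
    (fun x hx => (h.surface.isLightLike x hx).2) hq i
  rw [ip_comm (meanCurvature F q)] at this
  linarith

lemma ip_pd_meanCurvature_pd (hq : q ∈ I ×ˢ J) (i j : Fin 2) :
    ip (pd i (meanCurvature F) q) (pd j F q) = -ip (meanCurvature F q) (pd i (pd j F) q) := by
  have := pd_ip_of_const h.isOpen h.contDiffOn_meanCurvature
    (contDiffOn_pd h.isOpen h.surface.smooth j) (fun x hx => h.ip_meanCurvature_pd x hx j) hq i
  linarith

lemma ip_pd_meanCurvature_pd_of_ne (hq : q ∈ I ×ˢ J) {i j : Fin 2} (hij : i ≠ j) :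
    ip (pd i (meanCurvature F) q) (pd j F q) = 0 := by
  have e : pd i (pd j F) q = ip (pd 0 F q) (pd 1 F q) • meanCurvature F q := by
    refine Eq.trans ?_ (h.pd_pd_eq hq)
    fin_cases i <;> fin_cases j
    · exact absurd rfl hij
    · exact pd_comm h.isOpen h.surface.smooth hq 0 1
    · rfl
    · exact absurd rfl hij
  rw [h.ip_pd_meanCurvature_pd hq, e, ip_smul_right, (h.surface.isLightLike q hq).2]
  simp

/-- `∂ᵢ H` is orthogonal to the isotropic plane spanned by `∂ⱼ F` and `H`, hence lies in it. -/
lemma exists_pd_meanCurvature (hq : q ∈ I ×ˢ J) {i j : Fin 2} (hij : i ≠ j) :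
    ∃ b c : ℝ, pd i (meanCurvature F) q = b • pd j F q + c • meanCurvature F q ∧
      b * ip (pd 0 F q) (pd 1 F q) = -ip (meanCurvature F q) (pd i (pd i F) q) := by
  have hφ : ip (pd j F q) (pd i F q) = ip (pd 0 F q) (pd 1 F q) := by
    fin_cases i <;> fin_cases j
    · exact absurd rfl hij
    · exact ip_comm _ _
    · rfl
    · exact absurd rfl hij
  have hn := h.ip_meanCurvature_pd q hq
  obtain ⟨b, c, hbc⟩ := exists_eq_smul_add_smul
    (linearIndependent_of_null (hφ ▸ h.ip_pd_ne_zero q hq) (h.surface.isLightLike q hq).1 (hn i))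
    (h.null q hq j) (by rw [ip_comm]; exact hn j) (h.surface.isLightLike q hq).2
    (h.ip_pd_meanCurvature_pd_of_ne hq hij) (h.ip_pd_meanCurvature_self hq i)
  refine ⟨b, c, hbc, ?_⟩
  rw [← h.ip_pd_meanCurvature_pd hq i i, hbc, ip_add_left, ip_smul_left, ip_smul_left, hn, hφ]
  ring

lemma ip_pd_pd_eq_zero_or (hq : q ∈ I ×ˢ J) :
    ip (meanCurvature F q) (pd 0 (pd 0 F) q) = 0 ∨
      ip (meanCurvature F q) (pd 1 (pd 1 F) q) = 0 := by
  have hH0 := contDiffOn_pd h.isOpen h.contDiffOn_meanCurvature 0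
  have h01 : ip (pd 0 (meanCurvature F) q) (pd 1 (meanCurvature F) q) = 0 := by
    have := pd_ip_of_const h.isOpen hH0 h.contDiffOn_meanCurvature
      (fun x hx => h.ip_pd_meanCurvature_self hx 0) hq 1
    rwa [h.pd_pd_meanCurvature hq, ip_zero_left, zero_add] at this
  obtain ⟨b, c, hbc, hb⟩ := h.exists_pd_meanCurvature hq (i := 0) (j := 1) (by decide)
  rw [hbc, ip_add_left, ip_smul_left, ip_smul_left, ip_comm (pd 1 F q), h.ip_pd_meanCurvature_pd hq,
    ip_comm (meanCurvature F q) (pd 1 (meanCurvature F) q), h.ip_pd_meanCurvature_self hq] at h01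
  have : ip (meanCurvature F q) (pd 0 (pd 0 F) q) * ip (meanCurvature F q) (pd 1 (pd 1 F) q) = 0 := by
    linear_combination ip (pd 0 F q) (pd 1 F q) * h01
      + ip (meanCurvature F q) (pd 1 (pd 1 F) q) * hb
  exact mul_eq_zero.1 this

lemma contDiffOn_ip_meanCurvature (i : Fin 2) :
    ContDiffOn ℝ ∞ (fun x => ip (meanCurvature F x) (pd i (pd i F) x)) (I ×ˢ J) :=
  contDiffOn_ip h.contDiffOn_meanCurvature
    (contDiffOn_pd h.isOpen (contDiffOn_pd h.isOpen h.surface.smooth i) i)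

/-- `⟨H, ∂₁∂₁F⟩ = -⟨∂₁H, ∂₁F⟩` depends on the second coordinate only. -/
lemma pd_ip_meanCurvature (hq : q ∈ I ×ˢ J) :
    pd 0 (fun x => ip (meanCurvature F x) (pd 1 (pd 1 F) x)) q = 0 := by
  have hH1 := contDiffOn_pd h.isOpen h.contDiffOn_meanCurvature 1
  have hF1 := contDiffOn_pd h.isOpen h.surface.smooth 1
  have e : EqOn (fun x => ip (meanCurvature F x) (pd 1 (pd 1 F) x))
      (fun x => -ip (pd 1 (meanCurvature F) x) (pd 1 F x)) (I ×ˢ J) := fun x hx => by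
    simp only; rw [h.ip_pd_meanCurvature_pd hx, neg_neg]
  rw [pd_congr h.isOpen e 0 hq, pd_neg, pd_ip (differentiableAt_of_contDiffOn h.isOpen hH1 hq)
    (differentiableAt_of_contDiffOn h.isOpen hF1 hq),
    pd_comm h.isOpen h.contDiffOn_meanCurvature hq, h.pd_pd_meanCurvature hq,
    pd_comm h.isOpen h.surface.smooth hq, h.pd_pd_eq hq, ip_zero_left, ip_smul_right,
    h.ip_pd_meanCurvature_self hq]
  simp

/-- The component of `∂₀ H` along `H` vanishes where `⟨H, ∂₁∂₁F⟩` does not. -/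
lemma pd_meanCurvature_eq_zero_of_ne (hq : q ∈ I ×ˢ J)
    (h1 : ip (meanCurvature F q) (pd 1 (pd 1 F) q) ≠ 0) : pd 0 (meanCurvature F) q = 0 := by
  have h0 := (h.ip_pd_pd_eq_zero_or hq).resolve_right h1
  obtain ⟨b, c, hbc, hb⟩ := h.exists_pd_meanCurvature hq (i := 0) (j := 1) (by decide)
  rw [h0, neg_zero, mul_eq_zero] at hb
  rw [hb.resolve_right (h.ip_pd_ne_zero q hq), zero_smul, zero_add] at hbc
  have hF1 := contDiffOn_pd h.isOpen h.surface.smooth 1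
  have hF11 := contDiffOn_pd h.isOpen hF1 1
  -- differentiate `⟨H, ∂₁∂₁F⟩`, which does not depend on the first coordinate
  have h2 := h.pd_ip_meanCurvature hq
  rw [pd_ip (differentiableAt_of_contDiffOn h.isOpen h.contDiffOn_meanCurvature hq)
    (differentiableAt_of_contDiffOn h.isOpen hF11 hq), hbc, ip_smul_left] at h2
  have e : EqOn (pd 0 (pd 1 F)) (fun x => ip (pd 0 F x) (pd 1 F x) • meanCurvature F x) (I ×ˢ J) :=
    fun x hx => by rw [pd_comm h.isOpen h.surface.smooth hx, h.pd_pd_eq hx]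
  rw [pd_comm h.isOpen hF1 hq, pd_congr h.isOpen e 1 hq,
    pd_smul (differentiableAt_of_contDiffOn h.isOpen h.contDiffOn_ip_pd hq)
      (differentiableAt_of_contDiffOn h.isOpen h.contDiffOn_meanCurvature hq), ip_add_right,
    ip_smul_right, ip_smul_right, (h.surface.isLightLike q hq).2,
    ip_comm (meanCurvature F q) (pd 1 (meanCurvature F) q), h.ip_pd_meanCurvature_self hq] at h2
  have hc : c = 0 := by
    simpa [h1] using h2
  rw [hbc, hc, zero_smul]

lemma ip_meanCurvature_ne_zero_line {u v : ℝ} (huv : (u, v) ∈ I ×ˢ J)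
    (h1 : ip (meanCurvature F (u, v)) (pd 1 (pd 1 F) (u, v)) ≠ 0) {u' : ℝ} (hu' : u' ∈ I) :
    ip (meanCurvature F (u', v)) (pd 1 (pd 1 F) (u', v)) ≠ 0 := by
  have := eq_of_pd_zero h.isOpenInterval_fst h.isOpenInterval_snd (h.contDiffOn_ip_meanCurvature 1)
    (fun x hx => h.pd_ip_meanCurvature hx) hu' huv.1 huv.2
  simp only at this
  rwa [this]

/-- If `⟨H, ∂₁∂₁F⟩` does not vanish identically, then `H` depends on the second coordinate only:
`∂₀H` vanishes along a line, and it does not depend on the second coordinate. -/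
lemma pd_meanCurvature_eq_zero {q₁ : ℝ × ℝ} (hq₁ : q₁ ∈ I ×ˢ J)
    (h1 : ip (meanCurvature F q₁) (pd 1 (pd 1 F) q₁) ≠ 0) :
    ∀ q ∈ I ×ˢ J, pd 0 (meanCurvature F) q = 0 := by
  intro q hq
  have hm : (q.1, q₁.2) ∈ I ×ˢ J := ⟨hq.1, hq₁.2⟩
  have e := eq_of_pd_one h.isOpenInterval_fst h.isOpenInterval_snd
    (contDiffOn_pd h.isOpen h.contDiffOn_meanCurvature 0) (fun x hx => h.pd_pd_meanCurvature hx)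
    hq.1 hq.2 hq₁.2
  rw [show q = (q.1, q.2) from rfl, e]
  exact h.pd_meanCurvature_eq_zero_of_ne hm (h.ip_meanCurvature_ne_zero_line (v := q₁.2) hq₁ h1 hq.1)

/-- `∂₀F / ⟨∂₀F, ∂₁F⟩`, a null vector field along the first family of coordinate lines. -/
lemma contDiffOn_normalized :
    ContDiffOn ℝ ∞ (fun x => (ip (pd 0 F x) (pd 1 F x))⁻¹ • pd 0 F x) (I ×ˢ J) :=
  (h.contDiffOn_ip_pd.inv h.ip_pd_ne_zero).smul (contDiffOn_pd h.isOpen h.surface.smooth 0)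

lemma contDiffOn_logDeriv : ContDiffOn ℝ ∞ (fun x => pd 1 (fun y => ip (pd 0 F y) (pd 1 F y)) x
    / ip (pd 0 F x) (pd 1 F x)) (I ×ˢ J) :=
  (contDiffOn_pd h.isOpen h.contDiffOn_ip_pd 1).div h.contDiffOn_ip_pd h.ip_pd_ne_zero

lemma pd_one_normalized (hq : q ∈ I ×ˢ J) :
    pd 1 (fun x => (ip (pd 0 F x) (pd 1 F x))⁻¹ • pd 0 F x) q
      = meanCurvature F q - (pd 1 (fun x => ip (pd 0 F x) (pd 1 F x)) q / ip (pd 0 F q) (pd 1 F q))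
        • ((ip (pd 0 F q) (pd 1 F q))⁻¹ • pd 0 F q) := by
  set φ : ℝ × ℝ → ℝ := fun x => ip (pd 0 F x) (pd 1 F x) with hφ
  have hφ0 : φ q ≠ 0 := h.ip_pd_ne_zero q hq
  have dφ := differentiableAt_of_contDiffOn h.isOpen h.contDiffOn_ip_pd hq
  have hB := differentiableAt_of_contDiffOn h.isOpen h.contDiffOn_normalized hq
  have e : EqOn (pd 0 F) (fun x => φ x • ((φ x)⁻¹ • pd 0 F x)) (I ×ˢ J) := fun x hx => by
    simp only
    rw [smul_smul, mul_inv_cancel₀ (h.ip_pd_ne_zero x hx), one_smul]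
  have h1 := pd_congr h.isOpen e 1 hq
  rw [h.pd_pd_eq hq, pd_smul dφ hB] at h1
  change φ q • meanCurvature F q = _ at h1
  have h2 : (φ q)⁻¹ • (φ q • meanCurvature F q) = (φ q)⁻¹ • (pd 1 φ q • ((φ q)⁻¹ • pd 0 F q)
      + φ q • pd 1 (fun x => (φ x)⁻¹ • pd 0 F x) q) := congrArg _ h1
  rw [smul_smul, inv_mul_cancel₀ hφ0, one_smul, smul_add, smul_smul (φ q)⁻¹ (φ q),
    inv_mul_cancel₀ hφ0, one_smul, smul_smul (φ q)⁻¹] at h2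
  rw [h2]
  change _ = _ - (pd 1 φ q / φ q) • ((φ q)⁻¹ • pd 0 F q)
  rw [div_eq_inv_mul]
  abel

/-- If `H` depends on the second coordinate only, then `∂₀F / ⟨∂₀F, ∂₁F⟩` varies along the first
coordinate lines in the direction of `H` only, and the speed is the Gaussian curvature up to known
factors. -/
lemma exists_pd_zero_normalized (hH : ∀ q ∈ I ×ˢ J, pd 0 (meanCurvature F) q = 0)
    (hq : q ∈ I ×ˢ J) :
    ∃ x : ℝ, pd 0 (fun x => (ip (pd 0 F x) (pd 1 F x))⁻¹ • pd 0 F x) q = x • meanCurvature F q ∧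
      x * ip (meanCurvature F q) (pd 1 (pd 1 F) q)
        = pd 0 (fun x => pd 1 (fun y => ip (pd 0 F y) (pd 1 F y)) x / ip (pd 0 F x) (pd 1 F x)) q := by
  have hΩ := h.isOpen
  have hB1 := fun x hx => h.pd_one_normalized (q := x) hx
  have hBs := h.contDiffOn_normalized
  have hθs := h.contDiffOn_logDeriv
  have hφ0 := h.ip_pd_ne_zero
  have hF1 := contDiffOn_pd hΩ h.surface.smooth 1
  set φ : ℝ × ℝ → ℝ := fun x => ip (pd 0 F x) (pd 1 F x) with hφ
  set B : ℝ × ℝ → E42 := fun x => (φ x)⁻¹ • pd 0 F x with hB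
  set θ : ℝ × ℝ → ℝ := fun x => pd 1 φ x / φ x with hθ
  have hBF : ∀ x ∈ I ×ˢ J, ip (B x) (pd 1 F x) = 1 := fun x hx => by
    simp only [hB, ip_smul_left]; exact inv_mul_cancel₀ (hφ0 x hx)
  have hBB : ∀ x ∈ I ×ˢ J, ip (B x) (B x) = 0 := fun x hx => by
    simp only [hB, ip_smul_left, ip_smul_right, h.null x hx 0]; simp
  have hBH : ∀ x ∈ I ×ˢ J, ip (B x) (meanCurvature F x) = 0 := fun x hx => by
    simp only [hB, ip_smul_left, ip_comm (pd 0 F x), h.ip_meanCurvature_pd x hx]; simp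
  have hFφ : ∀ x ∈ I ×ˢ J, pd 0 F x = φ x • B x := fun x hx => by
    simp only [hB]
    rw [smul_smul, mul_inv_cancel₀ (h.ip_pd_ne_zero x hx), one_smul]
  have z1 : ∀ x ∈ I ×ˢ J, ip (pd 0 B x) (pd 1 F x) = 0 := fun x hx => by
    have := pd_ip_of_const hΩ hBs hF1 hBF hx 0
    rw [pd_comm hΩ h.surface.smooth hx, h.pd_pd_eq hx, ip_smul_right, hBH x hx] at this
    linarith
  have z0 : ip (pd 0 B q) (pd 0 F q) = 0 := by
    have := pd_ip_of_const hΩ hBs hBs hBB hq 0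
    rw [ip_comm (B q)] at this
    rw [hFφ q hq, ip_smul_right]
    have h2 : ip (pd 0 B q) (B q) = 0 := by linarith
    rw [h2, mul_zero]
  have zH : ip (pd 0 B q) (meanCurvature F q) = 0 := by
    have := pd_ip_of_const hΩ hBs h.contDiffOn_meanCurvature hBH hq 0
    rw [hH q hq, ip_zero_right] at this
    linarith
  obtain ⟨x, hx⟩ := exists_eq_smul_of_null (h.null q hq 0) (hφ0 q hq)
    (h.surface.isLightLike q hq).1 (h.surface.isLightLike q hq).2 (h.ip_meanCurvature_pd q hq 0)
    (h.ip_meanCurvature_pd q hq 1) z0 (z1 q hq) zH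
  refine ⟨x, hx, ?_⟩
  have h1 := pd_ip_of_const hΩ (contDiffOn_pd hΩ hBs 0) hF1 z1 hq 1
  have dθ := differentiableAt_of_contDiffOn hΩ hθs hq
  have dB := differentiableAt_of_contDiffOn hΩ hBs hq
  have dH := differentiableAt_of_contDiffOn hΩ h.contDiffOn_meanCurvature hq
  have hB10 : pd 1 (pd 0 B) q = -(pd 0 θ q • B q) - θ q • pd 0 B q := by
    have e : EqOn (pd 1 B) (fun x => meanCurvature F x - θ x • B x) (I ×ˢ J) := hB1
    rw [pd_comm hΩ hBs hq, pd_congr hΩ e 0 hq, pd_sub dH (dθ.fun_smul dB), pd_smul dθ dB, hH q hq]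
    abel
  rw [hB10, hx, ip_sub_left, ip_neg_left, ip_smul_left, hBF q hq, ip_smul_left, ip_smul_left,
    ip_smul_left, h.ip_meanCurvature_pd q hq 1] at h1
  linear_combination h1

lemma metricGaussCurvature_eq (hq : q ∈ I ×ˢ J) :
    metricGaussCurvature (inducedMetric F) q
      = -pd 0 (fun x => pd 1 (fun y => ip (pd 0 F y) (pd 1 F y)) x / ip (pd 0 F x) (pd 1 F x)) q
        / ip (pd 0 F q) (pd 1 F q) := by
  rw [metricGaussCurvature_congr h.isOpen h.inducedMetric_eq hq,
    metricGaussCurvature_nullMetric h.isOpen h.ip_pd_ne_zero hq]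

lemma pd_logDeriv_eq_zero (hK : ∀ q ∈ I ×ˢ J, metricGaussCurvature (inducedMetric F) q = 0)
    (hq : q ∈ I ×ˢ J) :
    pd 0 (fun x => pd 1 (fun y => ip (pd 0 F y) (pd 1 F y)) x / ip (pd 0 F x) (pd 1 F x)) q = 0 := by
  have h1 := h.metricGaussCurvature_eq hq
  rw [hK q hq, eq_comm, div_eq_zero_iff, neg_eq_zero] at h1
  exact h1.resolve_right (h.ip_pd_ne_zero q hq)

/-- In the flat case, `∂₀F / ⟨∂₀F, ∂₁F⟩` is constant along the first coordinate lines: its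
derivative vanishes on the line where `⟨H, ∂₁∂₁F⟩ ≠ 0`, and satisfies a linear differential
equation in the second coordinate. -/
lemma pd_zero_normalized_eq_zero {q₁ : ℝ × ℝ} (hq₁ : q₁ ∈ I ×ˢ J)
    (h1 : ip (meanCurvature F q₁) (pd 1 (pd 1 F) q₁) ≠ 0)
    (hK : ∀ q ∈ I ×ˢ J, metricGaussCurvature (inducedMetric F) q = 0) (hq : q ∈ I ×ˢ J) :
    pd 0 (fun x => (ip (pd 0 F x) (pd 1 F x))⁻¹ • pd 0 F x) q = 0 := by
  have hΩ := h.isOpen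
  have hH := h.pd_meanCurvature_eq_zero hq₁ h1
  have hB1 := fun x hx => h.pd_one_normalized (q := x) hx
  have hBs := h.contDiffOn_normalized
  have hθs := h.contDiffOn_logDeriv
  have hθ0 := fun x hx => h.pd_logDeriv_eq_zero hK (q := x) hx
  have hx0 : pd 0 (fun x => (ip (pd 0 F x) (pd 1 F x))⁻¹ • pd 0 F x) (q.1, q₁.2) = 0 := by
    have hm : (q.1, q₁.2) ∈ I ×ˢ J := ⟨hq.1, hq₁.2⟩
    obtain ⟨x, hx, hx'⟩ := h.exists_pd_zero_normalized hH hm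
    rw [hθ0 _ hm, mul_eq_zero] at hx'
    rw [hx, hx'.resolve_right (h.ip_meanCurvature_ne_zero_line (v := q₁.2) hq₁ h1 hq.1), zero_smul]
  set φ : ℝ × ℝ → ℝ := fun x => ip (pd 0 F x) (pd 1 F x) with hφ
  set B : ℝ × ℝ → E42 := fun x => (φ x)⁻¹ • pd 0 F x with hB
  set θ : ℝ × ℝ → ℝ := fun x => pd 1 φ x / φ x with hθ
  have e : EqOn (pd 1 B) (fun x => meanCurvature F x - θ x • B x) (I ×ˢ J) := hB1
  refine eq_zero_of_linearODE h.isOpenInterval_snd (F := fun v => pd 0 B (q.1, v))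
    (k := fun v => -θ (q.1, v)) ?_ (fun v hv => ?_) hq₁.2 hx0 hq.2
  · have h2 : ContinuousOn (fun v => θ (q.1, v)) J :=
      hθs.continuousOn.comp (by fun_prop) fun v hv => ⟨hq.1, hv⟩
    exact h2.neg
  · have hm : (q.1, v) ∈ I ×ˢ J := ⟨hq.1, hv⟩
    have dθ := differentiableAt_of_contDiffOn hΩ hθs hm
    have dB := differentiableAt_of_contDiffOn hΩ hBs hm
    have dH := differentiableAt_of_contDiffOn hΩ h.contDiffOn_meanCurvature hm
    have h2 := hasDerivAt_slice_one (differentiableAt_of_contDiffOn hΩ (contDiffOn_pd hΩ hBs 0) hm)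
    rw [pd_comm hΩ hBs hm, pd_congr hΩ e 0 hm, pd_sub dH (dθ.fun_smul dB), pd_smul dθ dB,
      hH _ hm, hθ0 _ hm] at h2
    simpa using h2

/-- If `⟨H, ∂₀∂₀F⟩` and `⟨H, ∂₁∂₁F⟩` vanish identically, then `H` has a constant direction. -/
lemma exists_meanCurvature_eq_smul
    (h0 : ∀ q ∈ I ×ˢ J, ∀ i, ip (meanCurvature F q) (pd i (pd i F) q) = 0)
    {q₀ : ℝ × ℝ} (hq₀ : q₀ ∈ I ×ˢ J) (hq : q ∈ I ×ˢ J) :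
    ∃ c : ℝ, meanCurvature F q = c • meanCurvature F q₀ := by
  have hpar : ∀ i, ∃ k : ℝ × ℝ → ℝ, ContDiffOn ℝ ∞ k (I ×ˢ J) ∧
      ∀ x ∈ I ×ˢ J, pd i (meanCurvature F) x = k x • meanCurvature F x := by
    intro i
    obtain ⟨j, hij⟩ : ∃ j : Fin 2, i ≠ j := by fin_cases i; exacts [⟨1, by decide⟩, ⟨0, by decide⟩]
    refine ⟨fun x => coeffAlong (pd i (meanCurvature F) x) (meanCurvature F x), ?_, ?_⟩
    · exact contDiffOn_coeffAlong (contDiffOn_pd h.isOpen h.contDiffOn_meanCurvature i)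
        h.contDiffOn_meanCurvature fun x hx => (h.surface.isLightLike x hx).1
    · intro x hx
      obtain ⟨b, c, hbc, hb⟩ := h.exists_pd_meanCurvature hx hij
      rw [h0 x hx, neg_zero, mul_eq_zero] at hb
      rw [hb.resolve_right (h.ip_pd_ne_zero x hx), zero_smul, zero_add] at hbc
      exact (coeffAlong_smul_eq (h.surface.isLightLike x hx).1 ⟨c, hbc⟩).symm
  obtain ⟨k, hk, hk'⟩ := hpar 0
  obtain ⟨l, hl, hl'⟩ := hpar 1
  have hd : ∀ x ∈ I ×ˢ J, DifferentiableAt ℝ (meanCurvature F) x := fun x hx =>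
    differentiableAt_of_contDiffOn h.isOpen h.contDiffOn_meanCurvature hx
  have e1 := eq_exp_smul_of_linearODE h.isOpenInterval_fst (k := fun u => k (u, q.2))
    (hk.continuousOn.comp (by fun_prop) fun u hu => ⟨hu, hq.2⟩)
    (F := fun u => meanCurvature F (u, q.2)) (fun u hu => by
      rw [← hk' (u, q.2) ⟨hu, hq.2⟩]
      exact hasDerivAt_slice_zero (q := (u, q.2)) (hd _ ⟨hu, hq.2⟩)) hq₀.1 hq.1
  have e2 := eq_exp_smul_of_linearODE h.isOpenInterval_snd (k := fun v => l (q₀.1, v))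
    (hl.continuousOn.comp (by fun_prop) fun v hv => ⟨hq₀.1, hv⟩)
    (F := fun v => meanCurvature F (q₀.1, v)) (fun v hv => by
      rw [← hl' (q₀.1, v) ⟨hq₀.1, hv⟩]
      exact hasDerivAt_slice_one (q := (q₀.1, v)) (hd _ ⟨hq₀.1, hv⟩)) hq₀.2 hq.2
  rw [e2, smul_smul] at e1
  exact ⟨_, e1⟩

end IsNullParametrized

end QuasiMinimal
end

noncomputable section
namespace QuasiMinimal
open Set

/-! ### Semi-geodesic coordinates -/

/-- `G` is a quasi-minimal biharmonic surface on the product `I × J` of open intervals, the metric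
is `g_m` for some function `m`, and `∂₀H = 0`, `∂₀∂₀G ∥ H`. -/
structure IsAdapted (I J : Set ℝ) (G : ℝ × ℝ → E42) : Prop where
  isOpenInterval_fst : IsOpenInterval I
  isOpenInterval_snd : IsOpenInterval J
  surface : IsQMBiharmonicOn (I ×ˢ J) G
  ip_zero_zero : ∀ q ∈ I ×ˢ J, ip (pd 0 G q) (pd 0 G q) = 0
  ip_zero_one : ∀ q ∈ I ×ˢ J, ip (pd 0 G q) (pd 1 G q) = -1
  pd_meanCurvature : ∀ q ∈ I ×ˢ J, pd 0 (meanCurvature G) q = 0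
  exists_smul : ∀ q ∈ I ×ˢ J, ∃ r : ℝ, pd 0 (pd 0 G) q = r • meanCurvature G q

/-- Null coordinates `(u, v)` with `∂_u H = 0` are turned into semi-geodesic ones by rescaling: the
new coordinates are `s = ∫ φ(ξ, v) / φ(u₀, v) dξ`, an affine parameter of the null geodesics
`v = const`, and `t = -∫ φ(u₀, v) dv`, where `φ = ⟨∂_u F, ∂_v F⟩`. -/
lemma IsNullParametrized.exists_adapted {I J : Set ℝ} {F : ℝ × ℝ → E42}
    (h : IsNullParametrized I J F) (hH : ∀ q ∈ I ×ˢ J, pd 0 (meanCurvature F) q = 0)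
    {q₀ : ℝ × ℝ} (hq₀ : q₀ ∈ I ×ˢ J) :
    ∃ ψ : OpenPartialHomeomorph (ℝ × ℝ) (ℝ × ℝ), IsDiffeo ψ ∧ q₀ ∈ ψ.source ∧
      ψ.source ⊆ I ×ˢ J ∧ ∃ I' J' : Set ℝ, ψ.target = I' ×ˢ J' ∧
        IsAdapted I' J' (fun x => F (ψ.symm x)) ∧
        ((∀ q ∈ I ×ˢ J,
            pd 0 (fun x => (ip (pd 0 F x) (pd 1 F x))⁻¹ • pd 0 F x) q = 0 ∧
            pd 0 (fun x => pd 1 (fun y => ip (pd 0 F y) (pd 1 F y)) x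
              / ip (pd 0 F x) (pd 1 F x)) q = 0) →
          ∀ x ∈ I' ×ˢ J', pd 0 (pd 0 fun x => F (ψ.symm x)) x = 0 ∧
            ip (pd 1 (fun x => F (ψ.symm x)) x) (pd 1 (fun x => F (ψ.symm x)) x) = 0) := by
  obtain ⟨u₀, v₀⟩ := q₀
  have hI := h.isOpenInterval_fst
  have hJ := h.isOpenInterval_snd
  have hD := h.isOpen
  have hφs := h.contDiffOn_ip_pd
  have hφ0 := h.ip_pd_ne_zero
  have hBs := h.contDiffOn_normalized
  have hBx := fun x hx => h.exists_pd_zero_normalized hH (q := x) hx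
  have hθs := h.contDiffOn_logDeriv
  set φ : ℝ × ℝ → ℝ := fun x => ip (pd 0 F x) (pd 1 F x) with hφ
  set B : ℝ × ℝ → E42 := fun x => (φ x)⁻¹ • pd 0 F x with hB
  set θ : ℝ × ℝ → ℝ := fun x => pd 1 φ x / φ x with hθ
  -- the values of `φ` on the line `u = u₀`
  set f : ℝ → ℝ := fun v => φ (u₀, v) with hf
  have hfs : ContDiffOn ℝ ∞ f J := hφs.comp (by fun_prop) fun v hv => ⟨hq₀.1, hv⟩
  have hf0 : ∀ v ∈ J, f v ≠ 0 := fun v hv => hφ0 _ ⟨hq₀.1, hv⟩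
  have hf2s : ContDiffOn ℝ ∞ (fun x : ℝ × ℝ => f x.2) (I ×ˢ J) :=
    hfs.comp contDiffOn_snd fun x hx => hx.2
  have hfd : ∀ v ∈ J, DifferentiableAt ℝ f v := fun v hv =>
    (hfs.contDiffAt (hJ.1.mem_nhds hv)).differentiableAt (by simp)
  set k : ℝ × ℝ → ℝ := fun x => φ x / f x.2 with hk
  have hks : ContDiffOn ℝ ∞ k (I ×ˢ J) := hφs.div hf2s fun x hx => hf0 _ hx.2
  have hk0 : ∀ x ∈ I ×ˢ J, k x ≠ 0 := fun x hx => div_ne_zero (hφ0 x hx) (hf0 _ hx.2)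
  -- the two coordinate functions
  set s : ℝ × ℝ → ℝ := fun x => ∫ ξ in u₀..x.1, k (ξ, x.2) with hs
  have hss : ContDiffOn ℝ ∞ s (I ×ˢ J) := contDiffOn_infty.2 fun n =>
    contDiffOn_primitive_nat hI.1 hI.2 hJ.1 hq₀.1 n (hks.of_le (by exact_mod_cast le_top))
  have hs0 : ∀ x ∈ I ×ˢ J, pd 0 s x = k x := fun x hx =>
    (hasDerivAt_slice_zero (differentiableAt_of_contDiffOn hD hss hx)).unique
      (hasDerivAt_integral_of_continuousOn hI (k := fun ξ => k (ξ, x.2))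
        (hks.continuousOn.comp (by fun_prop) fun ξ hξ => ⟨hξ, hx.2⟩) hq₀.1 hx.1)
  set t' : ℝ → ℝ := fun v => ∫ ξ in v₀..v, -f ξ with ht'
  have ht'd : ∀ v ∈ J, HasDerivAt t' (-f v) v := fun v hv =>
    hasDerivAt_integral_of_continuousOn hJ (k := fun ξ => -f ξ) hfs.continuousOn.neg hq₀.2 hv
  have ht's : ContDiffOn ℝ ∞ t' J := by
    rw [contDiffOn_infty_iff_deriv_of_isOpen hJ.1]
    exact ⟨fun v hv => (ht'd v hv).differentiableAt.differentiableWithinAt,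
      hfs.neg.congr fun v hv => (ht'd v hv).deriv⟩
  set t : ℝ × ℝ → ℝ := fun x => t' x.2 with ht
  have hts : ContDiffOn ℝ ∞ t (I ×ˢ J) := ht's.comp contDiffOn_snd fun x hx => hx.2
  have ht0 : ∀ x ∈ I ×ˢ J, pd 0 t x = 0 := fun x hx => by
    rw [ht, pd_comp_snd (ht'd x.2 hx.2).differentiableAt, if_pos rfl]
  have ht1 : ∀ x ∈ I ×ˢ J, pd 1 t x = -f x.2 := fun x hx => by
    rw [ht, pd_comp_snd (ht'd x.2 hx.2).differentiableAt, if_neg (by decide), (ht'd x.2 hx.2).deriv]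
  obtain ⟨ψ₀, hψ₀q, hψ₀s, hψ₀, hψ₀i⟩ := exists_localDiffeo hD hss hts (fun x hx => by
    rw [hs0 x hx, ht0 x hx, ht1 x hx, mul_zero, sub_zero]
    exact mul_ne_zero (hk0 x hx) (neg_ne_zero.2 (hf0 _ hx.2))) hq₀
  obtain ⟨ψ, hψd, hψq, hψs', hψe, -, I', J', hI', hJ', hψt⟩ := exists_restr_box (φ := ψ₀)
    ⟨((hss.prodMk hts).mono hψ₀s).congr fun x _ => hψ₀ x, hψ₀i⟩ hψ₀q
  have hψs : ψ.source ⊆ I ×ˢ J := hψs'.trans hψ₀s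
  have hψ : ∀ x, ψ x = (s x, t x) := fun x => by rw [hψe, hψ₀]
  have hS : IsOpen ψ.source := ψ.open_source
  have hcc : IsCoordChange ψ.source (I' ×ˢ J') s t := by
    have := hψd.isCoordChange
    simp only [hψ, hψt] at this
    exact this
  have hGsurf := h.surface.symm_diffeo hψd hψs
  rw [hψt] at hGsurf
  set G : ℝ × ℝ → E42 := fun x => F (ψ.symm x) with hG
  have hG's := hGsurf.isOpen
  have hFG : EqOn F (fun y => G (s y, t y)) ψ.source := fun y hy => by
    simp only [hG]
    rw [← hψ y, ψ.left_inv hy]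
  -- every point of the new box is `(s q, t q)`
  have hsurj : ∀ x ∈ I' ×ˢ J', ∃ q ∈ ψ.source, x = (s q, t q) := fun x hx => by
    rw [← hψt] at hx
    exact ⟨ψ.symm x, ψ.map_target hx, by rw [← hψ, ψ.right_inv hx]⟩
  have hGs := hGsurf.smooth
  have p0 : ∀ q ∈ ψ.source, pd 0 F q = k q • pd 0 G (s q, t q) := fun q hq => by
    rw [pd_congr hS hFG 0 hq, hcc.pd_comp_eq hGs hq, hs0 q (hψs hq), ht0 q (hψs hq), zero_smul,
      add_zero]
  have p1 : ∀ q ∈ ψ.source, pd 1 F q = pd 1 s q • pd 0 G (s q, t q) - f q.2 • pd 1 G (s q, t q) :=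
    fun q hq => by
    rw [pd_congr hS hFG 1 hq, hcc.pd_comp_eq hGs hq, ht1 q (hψs hq), neg_smul, sub_eq_add_neg]
  have hHs := QuasiMinimal.contDiffOn_meanCurvature hG's hGs hGsurf.det_ne_zero
  have hHc : EqOn (meanCurvature F) (fun y => meanCurvature G (s y, t y)) ψ.source := fun q hq => by
    rw [meanCurvature_congr hS hFG hq]
    exact hcc.meanCurvature_comp hGs hq (hGsurf.det_ne_zero _ (hcc.mapsTo q hq))
  have n0 : ∀ q ∈ ψ.source, ip (pd 0 G (s q, t q)) (pd 0 G (s q, t q)) = 0 := fun q hq => by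
    have := h.null q (hψs hq) 0
    rw [p0 q hq, ip_smul_left, ip_smul_right] at this
    simpa [hk0 q (hψs hq)] using this
  have n01 : ∀ q ∈ ψ.source, ip (pd 0 G (s q, t q)) (pd 1 G (s q, t q)) = -1 := fun q hq => by
    have e : φ q = ip (pd 0 F q) (pd 1 F q) := rfl
    have hφq := hφ0 q (hψs hq)
    have hfq := hf0 q.2 (hψs hq).2
    have hkf : k q * f q.2 = φ q := div_mul_cancel₀ _ hfq
    rw [p0 q hq, p1 q hq, ip_smul_left, ip_sub_right, ip_smul_right, ip_smul_right, n0 q hq] at e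
    have : φ q * ip (pd 0 G (s q, t q)) (pd 1 G (s q, t q)) = φ q * (-1) := by
      rw [← hkf] at e ⊢
      linear_combination e
    exact mul_left_cancel₀ hφq this
  -- `∂₀G` is a multiple of the normalized vector field, by a function of `t`
  have hGB : EqOn (fun q => pd 0 G (s q, t q)) (fun q => f q.2 • B q) ψ.source := fun q hq => by
    have hfq := hf0 q.2 (hψs hq).2
    have hφq : φ q ≠ 0 := hφ0 q (hψs hq)
    have hkf : k q * f q.2 = φ q := div_mul_cancel₀ _ hfq
    simp only [hB]
    rw [p0 q hq, smul_smul, smul_smul]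
    have : f q.2 * ((φ q)⁻¹ * k q) = 1 := by
      calc f q.2 * ((φ q)⁻¹ * k q) = (φ q)⁻¹ * (k q * f q.2) := by ring
        _ = 1 := by rw [hkf, inv_mul_cancel₀ hφq]
    rw [mul_assoc, this, one_smul]
  have p00 : ∀ q ∈ ψ.source, k q • pd 0 (pd 0 G) (s q, t q) = f q.2 • pd 0 B q := fun q hq => by
    have hqD := hψs hq
    have e := pd_congr hS hGB 0 hq
    rw [hcc.pd_comp_eq (contDiffOn_pd hG's hGs 0) hq, hs0 q hqD, ht0 q hqD, zero_smul, add_zero,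
      pd_smul (differentiableAt_of_contDiffOn hD hf2s hqD)
        (differentiableAt_of_contDiffOn hD hBs hqD), pd_comp_snd (hfd q.2 hqD.2), if_pos rfl,
      zero_smul, zero_add] at e
    exact e
  refine ⟨ψ, hψd, hψq, hψs, I', J', hψt, ⟨hI', hJ', hGsurf, ?_, ?_, ?_, ?_⟩, ?_⟩
  · intro x hx
    obtain ⟨q, hq, rfl⟩ := hsurj x hx
    exact n0 q hq
  · intro x hx
    obtain ⟨q, hq, rfl⟩ := hsurj x hx
    exact n01 q hq
  · intro x hx
    obtain ⟨q, hq, rfl⟩ := hsurj x hx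
    have e := hH q (hψs hq)
    rw [pd_congr hS hHc 0 hq, hcc.pd_comp_eq hHs hq, hs0 q (hψs hq), ht0 q (hψs hq), zero_smul,
      add_zero] at e
    exact (smul_eq_zero.1 e).resolve_left (hk0 q (hψs hq))
  · intro x hx
    obtain ⟨q, hq, rfl⟩ := hsurj x hx
    obtain ⟨r, hr, -⟩ := hBx q (hψs hq)
    have e := p00 q hq
    rw [hr, hHc hq] at e
    refine ⟨(k q)⁻¹ * (f q.2 * r), ?_⟩
    rw [mul_smul, mul_smul, ← e, smul_smul, inv_mul_cancel₀ (hk0 q (hψs hq)), one_smul]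
  · intro hflat x hx
    obtain ⟨q, hq, rfl⟩ := hsurj x hx
    have hqD := hψs hq
    have hθ0 := fun x hx => (hflat x hx).2
    have hfq := hf0 q.2 hqD.2
    refine ⟨?_, ?_⟩
    · have e := p00 q hq
      rw [(hflat q hqD).1, smul_zero] at e
      exact (smul_eq_zero.1 e).resolve_left (hk0 q hqD)
    · -- `∂₁ s` is independent of the first coordinate and vanishes at `u₀`
      have hk1 : ∀ y ∈ I ×ˢ J, pd 0 (pd 1 s) y = 0 := by
        intro y hy
        have hyf := hf0 y.2 hy.2
        have hyφ := hφ0 y hy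
        have e0 : EqOn (pd 0 s) k (I ×ˢ J) := hs0
        have hm : (u₀, y.2) ∈ I ×ˢ J := ⟨hq₀.1, hy.2⟩
        have hθc : θ y = θ (u₀, y.2) :=
          eq_of_pd_zero hI hJ hθs hθ0 hy.1 hq₀.1 hy.2
        have hfder : deriv f y.2 = pd 1 φ (u₀, y.2) :=
          (hasDerivAt_slice_one (q := (u₀, y.2)) (differentiableAt_of_contDiffOn hD hφs hm)).deriv
        rw [pd_comm hD hss hy, pd_congr hD e0 1 hy, hk,
          pd_div (differentiableAt_of_contDiffOn hD hφs hy)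
            (differentiableAt_of_contDiffOn hD hf2s hy) hyf, pd_comp_snd (hfd y.2 hy.2),
          if_neg (by decide), hfder]
        have e1 : pd 1 φ y * f y.2 = pd 1 φ (u₀, y.2) * φ y := by
          have e2 : pd 1 φ y / φ y = pd 1 φ (u₀, y.2) / f y.2 := hθc
          rwa [div_eq_div_iff hyφ hyf] at e2
        rw [div_eq_zero_iff]
        left
        linear_combination e1
      have hs1 : pd 1 s q = 0 := by
        have hm : (u₀, q.2) ∈ I ×ˢ J := ⟨hq₀.1, hqD.2⟩
        have e1 : pd 1 s (u₀, q.2) = 0 := by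
          have e2 := hasDerivAt_slice_one (q := (u₀, q.2)) (differentiableAt_of_contDiffOn hD hss hm)
          simp only [hs, intervalIntegral.integral_same] at e2
          exact e2.unique (hasDerivAt_const _ _)
        rw [← e1]
        exact eq_of_pd_zero hI hJ (contDiffOn_pd hD hss 1) hk1 hqD.1 hq₀.1 hqD.2
      have e := h.null q hqD 1
      rw [p1 q hq, hs1, zero_smul, zero_sub, ip_neg_left, ip_neg_right, ip_smul_left,
        ip_smul_right] at e
      simpa [hfq] using e

end QuasiMinimal
end

noncomputable section
namespace QuasiMinimal
open Set

/-! ### Surfaces with a mean curvature vector of constant direction -/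

/-- If `H` has a constant direction `ℓ`, which may be taken to be `(1, 0, 0, 1)`, then `⟨F, ℓ⟩` is
constant, because `H` is normal. So the surface is a graph over the plane of the two middle
coordinates, and null coordinates of that plane serve as parameters. -/
lemma IsNullParametrized.coordCongruent_isGraphType {I J : Set ℝ} {F : ℝ × ℝ → E42}
    (h : IsNullParametrized I J F)
    (h0 : ∀ q ∈ I ×ˢ J, ∀ i, ip (meanCurvature F q) (pd i (pd i F) q) = 0)
    {q₀ : ℝ × ℝ} (hq₀ : q₀ ∈ I ×ˢ J) : CoordCongruent IsGraphType (I ×ˢ J) F q₀ := by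
  have hD := h.isOpen
  obtain ⟨A, hA, c, hc, hAc⟩ := exists_isometry_null (h.surface.isLightLike q₀ hq₀)
  have hFs := h.surface.smooth
  have hA1s : ContDiffOn ℝ ∞ (fun x => A (F x)) (I ×ˢ J) :=
    A.toContinuousLinearEquiv.contDiff.comp_contDiffOn hFs
  -- the scalar product of `A F` with `(1, 0, 0, 1)` is constant
  have hperp : ∀ x ∈ I ×ˢ J, ∀ i, A (pd i F x) 0 = A (pd i F x) 3 := by
    intro x hx i
    obtain ⟨k, hk⟩ := h.exists_meanCurvature_eq_smul h0 hq₀ hx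
    have hk0 : k ≠ 0 := fun hk0 => (h.surface.isLightLike x hx).1 (by rw [hk, hk0, zero_smul])
    have e := h.ip_meanCurvature_pd x hx i
    rw [hk, ← hA, map_smul, hAc, ip_smul_left, ip_smul_left] at e
    have e' := ((mul_eq_zero.1 e).resolve_left hk0 |> mul_eq_zero.1).resolve_left hc
    simp [ip] at e'
    linarith
  have happ : ∀ (i j : _) (x : ℝ × ℝ), x ∈ I ×ˢ J →
      pd i (fun y => A (F y) j) x = A (pd i F x) j := by
    intro i j x hx
    rw [← pd_linear_comp]
    exact pd_apply (differentiableAt_of_contDiffOn hD hA1s hx) i j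
  have hAj : ∀ j, ContDiffOn ℝ ∞ (fun y => A (F y) j) (I ×ˢ J) := contDiffOn_pi.1 hA1s
  set d : ℝ := A (F q₀) 0 - A (F q₀) 3 with hd
  have hconst : ∀ x ∈ I ×ˢ J, A (F x) 0 - A (F x) 3 = d := by
    intro x hx
    have hs : ContDiffOn ℝ ∞ (fun y => A (F y) 0 - A (F y) 3) (I ×ˢ J) := (hAj 0).sub (hAj 3)
    have hz : ∀ i, ∀ y ∈ I ×ˢ J, pd i (fun y => A (F y) 0 - A (F y) 3) y = 0 := fun i y hy => by
      rw [pd_sub (differentiableAt_of_contDiffOn hD (hAj 0) hy)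
        (differentiableAt_of_contDiffOn hD (hAj 3) hy), happ i 0 y hy, happ i 3 y hy, hperp y hy,
        sub_self]
    have e1 := eq_of_pd_zero h.isOpenInterval_fst h.isOpenInterval_snd hs (hz 0) hx.1 hq₀.1 hx.2
    have e2 := eq_of_pd_one h.isOpenInterval_fst h.isOpenInterval_snd hs (hz 1) hq₀.1 hx.2 hq₀.2
    exact e1.trans e2
  set T : E42 ≃ᵃ[ℝ] E42 :=
    A.toAffineEquiv.trans (AffineEquiv.constVAdd ℝ E42 ![0, 0, 0, d]) with hTdef
  have hTA : ∀ x, T x = ![0, 0, 0, d] + A x := fun x => rfl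
  have hT : IsIsometry T := by
    intro x y
    have e : ∀ x, T.linear x = A x := fun _ => rfl
    rw [e, e]
    exact hA x y
  -- null coordinates of the plane of the two middle coordinates
  have h2 : (√2 : ℝ) * √2 = 2 := Real.mul_self_sqrt (by norm_num)
  have h20 : (√2 : ℝ) ≠ 0 := by positivity
  set s : ℝ × ℝ → ℝ := fun x => (A (F x) 1 + A (F x) 2) / √2 with hs
  set t : ℝ × ℝ → ℝ := fun x => (A (F x) 2 - A (F x) 1) / √2 with ht
  have hss : ContDiffOn ℝ ∞ s (I ×ˢ J) := ((hAj 1).add (hAj 2)).div_const _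
  have hts : ContDiffOn ℝ ∞ t (I ×ˢ J) := ((hAj 2).sub (hAj 1)).div_const _
  have hdj : ∀ j, ∀ x ∈ I ×ˢ J, DifferentiableAt ℝ (fun y => A (F y) j) x := fun j x hx =>
    differentiableAt_of_contDiffOn hD (hAj j) hx
  have hps : ∀ i, ∀ x ∈ I ×ˢ J, √2 * pd i s x = A (pd i F x) 1 + A (pd i F x) 2 := by
    intro i x hx
    rw [hs, pd_div ((hdj 1 x hx).fun_add (hdj 2 x hx)) (by fun_prop) h20,
      pd_add (hdj 1 x hx) (hdj 2 x hx), pd_const, happ i 1 x hx, happ i 2 x hx]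
    field_simp
    ring
  have hpt : ∀ i, ∀ x ∈ I ×ˢ J, √2 * pd i t x = A (pd i F x) 2 - A (pd i F x) 1 := by
    intro i x hx
    rw [ht, pd_div ((hdj 2 x hx).fun_sub (hdj 1 x hx)) (by fun_prop) h20,
      pd_sub (hdj 2 x hx) (hdj 1 x hx), pd_const, happ i 1 x hx, happ i 2 x hx]
    field_simp
    ring
  -- the metric is `ds dt` in these coordinates
  have hst : ∀ i j, ∀ x ∈ I ×ˢ J,
      ip (pd i F x) (pd j F x) = pd i s x * pd j t x + pd j s x * pd i t x := by
    intro i j x hx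
    rw [← hA]
    simp only [ip, hperp x hx]
    have e1 := hps i x hx
    have e2 := hps j x hx
    have e3 := hpt i x hx
    have e4 := hpt j x hx
    have : 2 * (pd i s x * pd j t x + pd j s x * pd i t x)
        = (√2 * pd i s x) * (√2 * pd j t x) + (√2 * pd j s x) * (√2 * pd i t x) := by
      linear_combination -(pd i s x * pd j t x + pd j s x * pd i t x) * h2
    rw [e1, e2, e3, e4] at this
    linear_combination (-1 / 2) * this
  obtain ⟨ψ, hψq, hψs, hψ, hψi⟩ := exists_localDiffeo hD hss hts (fun x hx hj => by
    have e1 := h.null x hx 0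
    have e2 := h.null x hx 1
    have e3 := h.ip_pd_ne_zero x hx
    rw [hst 0 0 x hx] at e1
    rw [hst 1 1 x hx] at e2
    rw [hst 0 1 x hx] at e3
    apply e3
    have : (pd 0 s x * pd 1 t x + pd 1 s x * pd 0 t x) ^ 2 = 0 := by
      linear_combination (pd 0 s x * pd 1 t x - pd 1 s x * pd 0 t x) * hj
        + 2 * (pd 1 s x * pd 1 t x) * e1
    exact pow_eq_zero_iff (two_ne_zero) |>.1 this) hq₀
  have hψd : IsDiffeo ψ := ⟨((hss.prodMk hts).mono hψs).congr fun x _ => hψ x, hψi⟩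
  have hG := (h.surface.symm_diffeo hψd hψs).isometry hT
  set G : ℝ × ℝ → E42 := fun x => T (F (ψ.symm x)) with hGdef
  refine ⟨ψ, hψd, hψq, hψs, T, hT, G, ?_, fun x _ => rfl⟩
  set Ψ : ℝ × ℝ → ℝ := fun x => G x 0 with hΨ
  have hΨs : ContDiffOn ℝ ∞ Ψ ψ.target := contDiffOn_pi.1 hG.smooth 0
  have hGe : ∀ x ∈ ψ.target, G x = ![Ψ x, (x.1 - x.2) / √2, (x.1 + x.2) / √2, Ψ x] := by
    intro x hx
    set y := ψ.symm x with hy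
    have hyD : y ∈ I ×ˢ J := hψs (ψ.map_target hx)
    have hxy : x = (s y, t y) := by rw [← hψ, ψ.right_inv hx]
    have e0 := hconst y hyD
    have e1 : x.1 = s y := by rw [hxy]
    have e2 : x.2 = t y := by rw [hxy]
    rw [e1, e2]
    simp only [hΨ, hGdef, ← hy, hTA, hs, ht]
    ext i
    fin_cases i
    · simp
    · simp
      field_simp
      linear_combination A (F y) 1 * h2
    · simp
      field_simp
      linear_combination A (F y) 2 * h2
    · simp
      linear_combination -e0
  obtain ⟨-, hg, hH, -⟩ := graph_facts ψ.open_target hΨs hGe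
  refine ⟨ψ.open_target, Ψ, hΨs, fun x hx => ⟨hGe x hx, ?_, ?_⟩⟩
  · rw [← hH hx]
    exact (hG.isLightLike x hx).1
  · have e := hG.bitension_eq_zero x hx
    have hG0 := contDiffOn_pd ψ.open_target hG.smooth 0
    have hcm : EqOn (pd 0 (pd 1 (pd 0 G))) (pd 1 (pd 0 (pd 0 G))) ψ.target := fun y hy =>
      pd_comm ψ.open_target hG0 hy 0 1
    rw [bitension_of_null ψ.open_target hG.smooth hg (fun _ _ => one_ne_zero) hx,
      pd_congr ψ.open_target ((pd_congr ψ.open_target hH 0).trans hcm) 1 hx] at e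
    exact (smul_eq_zero.1 e).resolve_left (by norm_num)

end QuasiMinimal
end

noncomputable section
namespace QuasiMinimal
open Set

/-! ### Surfaces in adapted coordinates -/

section SecondCoordinate

variable {V : Type*} [NormedAddCommGroup V] [NormedSpace ℝ V] {I J : Set ℝ} {f : ℝ × ℝ → V}

lemma contDiffOn_line (hf : ContDiffOn ℝ ∞ f (I ×ˢ J)) {s : ℝ} (hs : s ∈ I) :
    ContDiffOn ℝ ∞ (fun t => f (s, t)) J :=
  hf.comp (by fun_prop) fun _ ht => ⟨hs, ht⟩

lemma deriv_line (hI : IsOpenInterval I) (hJ : IsOpenInterval J) (hf : ContDiffOn ℝ ∞ f (I ×ˢ J))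
    {s t : ℝ} (hs : s ∈ I) (ht : t ∈ J) : deriv (fun t => f (s, t)) t = pd 1 f (s, t) :=
  (hasDerivAt_slice_one (q := (s, t))
    (differentiableAt_of_contDiffOn (hI.1.prod hJ.1) hf ⟨hs, ht⟩)).deriv

end SecondCoordinate

namespace IsAdapted

variable {I J : Set ℝ} {G : ℝ × ℝ → E42} (h : IsAdapted I J G)
include h

lemma isOpen : IsOpen (I ×ˢ J) := h.surface.isOpen

lemma inducedMetric_eq : EqOn (inducedMetric G)
    (semiGeodesicMetric fun x => ip (pd 1 G x) (pd 1 G x) / 2) (I ×ˢ J) := fun q hq =>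
  inducedMetric_eq_semiGeodesicMetric (h.ip_zero_zero q hq) (h.ip_zero_one q hq) (by ring)

lemma ip_meanCurvature_pd {q : ℝ × ℝ} (hq : q ∈ I ×ˢ J) (i : Fin 2) :
    ip (meanCurvature G q) (pd i G q) = 0 :=
  QuasiMinimal.ip_meanCurvature_pd h.isOpen h.surface.smooth h.surface.det_ne_zero hq i

lemma contDiffOn_meanCurvature : ContDiffOn ℝ ∞ (meanCurvature G) (I ×ˢ J) :=
  QuasiMinimal.contDiffOn_meanCurvature h.isOpen h.surface.smooth h.surface.det_ne_zero

/-- If the second family of coordinate lines is light-like as well and the first one consists of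
straight lines, then the surface is a null scroll. -/
lemma isRuledType (hne : I.Nonempty) (h00 : ∀ q ∈ I ×ˢ J, pd 0 (pd 0 G) q = 0)
    (h11 : ∀ q ∈ I ×ˢ J, ip (pd 1 G q) (pd 1 G q) = 0) :
    IsRuledType (J ×ˢ I) (fun x => G x.swap) := by
  obtain ⟨s₀, hs₀⟩ := hne
  have hI := h.isOpenInterval_fst
  have hJ := h.isOpenInterval_snd
  have hD := h.isOpen
  have hGs := h.surface.smooth
  have hG0 := contDiffOn_pd hD hGs 0
  have hg : EqOn (inducedMetric G) (semiGeodesicMetric fun _ => 0) (I ×ˢ J) := fun q hq =>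
    inducedMetric_eq_semiGeodesicMetric (h.ip_zero_zero q hq) (h.ip_zero_one q hq)
      (by rw [h11 q hq]; ring)
  have h10 : ∀ q ∈ I ×ˢ J, pd 1 (pd 0 G) q = -meanCurvature G q := fun q hq => by
    rw [meanCurvature_of_semiGeodesic hD hGs hg hq, pd_const]
    simp
  have hz := contDiffOn_line hG0 hs₀
  have hw : ContDiffOn ℝ ∞ (fun t => G (s₀, t) - s₀ • pd 0 G (s₀, t)) J :=
    (contDiffOn_line hGs hs₀).sub (hz.const_smul s₀)
  have dz : ∀ t ∈ J, deriv (fun t => pd 0 G (s₀, t)) t = -meanCurvature G (s₀, t) := fun t ht => by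
    rw [deriv_line hI hJ hG0 hs₀ ht, h10 _ ⟨hs₀, ht⟩]
  have dw : ∀ t ∈ J, deriv (fun t => G (s₀, t) - s₀ • pd 0 G (s₀, t)) t
      = pd 1 G (s₀, t) + s₀ • meanCurvature G (s₀, t) := fun t ht => by
    have d0 := ((contDiffOn_line hGs hs₀).contDiffAt (hJ.1.mem_nhds ht)).differentiableAt (by simp)
    have d1 := (hz.contDiffAt (hJ.1.mem_nhds ht)).differentiableAt (by simp)
    rw [deriv_fun_sub d0 (d1.fun_const_smul s₀), deriv_fun_const_smul s₀ d1, dz t ht,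
      deriv_line hI hJ hGs hs₀ ht]
    simp
  refine ⟨J, I, hJ, hI, rfl, fun t => pd 0 G (s₀, t), fun t => G (s₀, t) - s₀ • pd 0 G (s₀, t),
    hz, hw, fun t ht => ?_, fun q hq => ?_⟩
  · have hq : (s₀, t) ∈ I ×ˢ J := ⟨hs₀, ht⟩
    obtain ⟨l1, l2⟩ := h.surface.isLightLike _ hq
    have e01 := h.ip_zero_one _ hq
    have n0 := h.ip_meanCurvature_pd hq 0
    have n1 := h.ip_meanCurvature_pd hq 1
    have n0' := n0
    have n1' := n1
    rw [ip_comm] at n0' n1'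
    rw [dz t ht, dw t ht]
    have hzw : ip (pd 0 G (s₀, t)) (pd 1 G (s₀, t) + s₀ • meanCurvature G (s₀, t)) = -1 := by
      rw [ip_add_right, ip_smul_right, e01, n0']; ring
    refine ⟨h.ip_zero_zero _ hq, ⟨neg_ne_zero.2 l1, by rw [ip_neg_left, ip_neg_right, l2]; simp⟩,
      ⟨fun h0 => ?_, ?_⟩, ?_, hzw⟩
    · rw [h0, ip_zero_right] at hzw
      norm_num at hzw
    · simp only [ip_add_left, ip_add_right, ip_smul_left, ip_smul_right, h11 _ hq, n1, n1', l2]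
      ring
    · simp only [ip_neg_left, ip_add_right, ip_smul_right, n1, l2]
      ring
  · -- both `∂₀G` and `G - s ∂₀G` depend on `t` only
    have hq' : q.swap ∈ I ×ˢ J := ⟨hq.2, hq.1⟩
    have hf : ContDiffOn ℝ ∞ (fun x => G x - x.1 • pd 0 G x) (I ×ˢ J) :=
      hGs.sub (contDiffOn_fst.smul hG0)
    have e1 := eq_of_pd_zero hI hJ hG0 h00 hq.2 hs₀ hq.1
    have e2 := eq_of_pd_zero hI hJ hf (fun x hx => by
      have d0 := differentiableAt_of_contDiffOn hD hGs hx
      have d1 := differentiableAt_of_contDiffOn hD hG0 hx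
      rw [pd_sub d0 (differentiableAt_fst.fun_smul d1), pd_smul differentiableAt_fst d1, pd_fst,
        h00 x hx]
      simp) hq.2 hs₀ hq.1
    change G q.swap = q.2 • pd 0 G (s₀, q.1) + (G (s₀, q.1) - s₀ • pd 0 G (s₀, q.1))
    change G q.swap - q.2 • pd 0 G q.swap = G (s₀, q.1) - s₀ • pd 0 G (s₀, q.1) at e2
    rw [← e2, ← e1]
    simp [Prod.swap]

/-- If the Gaussian curvature `K` does not vanish, then `∂₀∂₀G = -c K H` for a function `c` of `t`,
and differentiating the formula for `H` in semi-geodesic coordinates expresses `∂₀G` through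
`H = H(t)` and its derivative; an integration gives the parametrization. -/
lemma isNonFlatType (hne : I.Nonempty)
    (hK : ∀ q ∈ I ×ˢ J, metricGaussCurvature (inducedMetric G) q ≠ 0) :
    IsNonFlatType (I ×ˢ J) G := by
  obtain ⟨s₀, hs₀⟩ := hne
  have hI := h.isOpenInterval_fst
  have hJ := h.isOpenInterval_snd
  have hD := h.isOpen
  have hGs := h.surface.smooth
  have hG0 := contDiffOn_pd hD hGs 0
  have hG1 := contDiffOn_pd hD hGs 1
  have hG00 := contDiffOn_pd hD hG0 0
  have hHs := h.contDiffOn_meanCurvature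
  have hg := h.inducedMetric_eq
  have hLL := h.surface.isLightLike
  have hn := fun q hq => h.ip_meanCurvature_pd (q := q) hq
  have hH0 := h.pd_meanCurvature
  have dD : ∀ {V : Type} [NormedAddCommGroup V] [NormedSpace ℝ V] {f : ℝ × ℝ → V},
      ContDiffOn ℝ ∞ f (I ×ˢ J) → ∀ x ∈ I ×ˢ J, DifferentiableAt ℝ f x := fun hf x hx =>
    differentiableAt_of_contDiffOn hD hf hx
  set m : ℝ × ℝ → ℝ := fun x => ip (pd 1 G x) (pd 1 G x) / 2 with hm
  set H := meanCurvature G with hHdef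
  have hms : ContDiffOn ℝ ∞ m (I ×ˢ J) := (contDiffOn_ip hG1 hG1).div_const _
  have hH := fun q hq => meanCurvature_of_semiGeodesic hD hGs hg (q := q) hq
  have hm0 := contDiffOn_pd hD hms 0
  have hKk : ∀ q, metricGaussCurvature (semiGeodesicMetric m) q = pd 0 (pd 0 m) q := fun q => by
    rw [metricGaussCurvature_semiGeodesicMetric]
  set k := pd 0 (pd 0 m) with hk
  have hks : ContDiffOn ℝ ∞ k (I ×ˢ J) := contDiffOn_pd hD hm0 0
  have hk0 : ∀ q ∈ I ×ˢ J, k q ≠ 0 := fun q hq => by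
    rw [← hKk, ← metricGaussCurvature_congr hD hg hq]
    exact hK q hq
  have hH1 := contDiffOn_pd hD hHs 1
  have hH11 := contDiffOn_pd hD hH1 1
  have hH10 : ∀ q ∈ I ×ˢ J, pd 0 (pd 1 H) q = 0 := fun q hq => by
    rw [pd_comm hD hHs hq, pd_congr hD hH0 1 hq]
    exact pd_const _ _
  -- `∂₀∂₀G = r H`
  set r : ℝ × ℝ → ℝ := fun q => coeffAlong (pd 0 (pd 0 G) q) (H q) with hr
  have hrs : ContDiffOn ℝ ∞ r (I ×ˢ J) := contDiffOn_coeffAlong hG00 hHs fun x hx => (hLL x hx).1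
  have hrH : EqOn (pd 0 (pd 0 G)) (fun q => r q • H q) (I ×ˢ J) := fun q hq =>
    (coeffAlong_smul_eq (hLL q hq).1 (h.exists_smul q hq)).symm
  have hG10 : EqOn (pd 1 (pd 0 G)) (fun q => -H q - pd 0 m q • pd 0 G q - (m q * r q) • H q)
      (I ×ˢ J) := fun q hq => by
    have e := hH q hq
    rw [hrH hq] at e
    linear_combination (norm := module) e
  have hm0G : ContDiffOn ℝ ∞ (fun q => pd 0 m q • pd 0 G q) (I ×ˢ J) := hm0.smul hG0
  have hmr : ContDiffOn ℝ ∞ (fun q => m q * r q) (I ×ˢ J) := hms.mul hrs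
  have hmrH : ContDiffOn ℝ ∞ (fun q => (m q * r q) • H q) (I ×ˢ J) := hmr.smul hHs
  have hHm : ContDiffOn ℝ ∞ (fun q => -H q - pd 0 m q • pd 0 G q) (I ×ˢ J) := hHs.neg.sub hm0G
  have key : ∀ q ∈ I ×ˢ J, k q • pd 0 G q = -(r q • pd 1 H q)
      - (pd 1 r q + 2 * pd 0 m q * r q + m q * pd 0 r q) • H q := fun q hq => by
    have e1 : pd 0 (pd 1 (pd 0 G)) q = pd 1 r q • H q + r q • pd 1 H q := by
      rw [pd_comm hD hG0 hq, pd_congr hD hrH 1 hq, pd_smul (dD hrs q hq) (dD hHs q hq)]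
    rw [pd_congr hD hG10 0 hq, pd_sub (dD hHm q hq) (dD hmrH q hq),
      pd_sub (dD hHs.neg q hq) (dD hm0G q hq), pd_neg, hH0 q hq, pd_smul (dD hm0 q hq) (dD hG0 q hq),
      pd_smul (dD hmr q hq) (dD hHs q hq), pd_mul (dD hms q hq) (dD hrs q hq), hrH hq, hH0 q hq,
      ← hk] at e1
    beta_reduce at e1
    linear_combination (norm := module) (-1 : ℝ) • e1
  -- scalar products of `∂₁H` and `∂₁G`
  have hrk : ∀ q ∈ I ×ˢ J, r q * ip (pd 1 H q) (pd 1 G q) = k q := fun q hq => by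
    have e := congrArg (fun z => ip z (pd 1 G q)) (key q hq)
    simp only [ip_sub_left, ip_neg_left, ip_smul_left, h.ip_zero_one q hq, hn q hq 1] at e
    linear_combination e
  have hr0 : ∀ q ∈ I ×ˢ J, r q ≠ 0 := fun q hq h0 => hk0 q hq (by rw [← hrk q hq, h0, zero_mul])
  have hi0 : ∀ q ∈ I ×ˢ J, ip (pd 1 H q) (pd 1 G q) ≠ 0 := fun q hq h0 =>
    hk0 q hq (by rw [← hrk q hq, h0, mul_zero])
  -- `∂₀G = c ∂₁H + e H`
  set c : ℝ × ℝ → ℝ := fun q => -r q / k q with hc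
  have hcs : ContDiffOn ℝ ∞ c (I ×ˢ J) := hrs.neg.div hks hk0
  have hc0 : ∀ q ∈ I ×ˢ J, c q ≠ 0 := fun q hq => div_ne_zero (neg_ne_zero.2 (hr0 q hq)) (hk0 q hq)
  have hr1 := contDiffOn_pd hD hrs 1
  have hr00 := contDiffOn_pd hD hrs 0
  set e : ℝ × ℝ → ℝ := fun q => -(pd 1 r q + 2 * pd 0 m q * r q + m q * pd 0 r q) / k q with he
  have hes : ContDiffOn ℝ ∞ e (I ×ˢ J) :=
    ((hr1.add ((contDiffOn_const.mul hm0).mul hrs)).add (hms.mul hr00)).neg.div hks hk0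
  have hrc : EqOn r (fun q => -(c q * k q)) (I ×ˢ J) := fun q hq => by
    simp only [hc]; have := hk0 q hq; field_simp
  have hGce : EqOn (pd 0 G) (fun q => c q • pd 1 H q + e q • H q) (I ×ˢ J) := fun q hq => by
    have hkq := hk0 q hq
    have e1 : (k q)⁻¹ • (k q • pd 0 G q) = (k q)⁻¹ • (-(r q • pd 1 H q)
      - (pd 1 r q + 2 * pd 0 m q * r q + m q * pd 0 r q) • H q) := congrArg _ (key q hq)
    rw [smul_smul, inv_mul_cancel₀ hkq, one_smul] at e1
    rw [e1]
    simp only [hc, he, div_eq_inv_mul]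
    module
  have hcH : ContDiffOn ℝ ∞ (fun q => c q • pd 1 H q) (I ×ˢ J) := hcs.smul hH1
  have heH : ContDiffOn ℝ ∞ (fun q => e q • H q) (I ×ˢ J) := hes.smul hHs
  have hsplit : ∀ q ∈ I ×ˢ J, pd 0 c q = 0 ∧ pd 0 e q = r q := fun q hq => by
    have e1 := hrH hq
    rw [pd_congr hD hGce 0 hq, pd_add (dD hcH q hq) (dD heH q hq), pd_smul (dD hcs q hq) (dD hH1 q hq),
      pd_smul (dD hes q hq) (dD hHs q hq), hH10 q hq, hH0 q hq, smul_zero, smul_zero, add_zero,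
      add_zero] at e1
    have e2 := congrArg (fun z => ip z (pd 1 G q)) e1
    simp only [ip_add_left, ip_smul_left, hn q hq 1, mul_zero, add_zero, mul_eq_zero] at e2
    have e3 := e2.resolve_right (hi0 q hq)
    rw [e3, zero_smul, zero_add] at e1
    exact ⟨e3, smul_left_injective ℝ (hLL q hq).1 e1⟩
  -- the function `L`
  set L := intrinsicL m with hL
  have hLs : ContDiffOn ℝ ∞ L (I ×ˢ J) :=
    contDiffOn_intrinsicL hD hms fun x hx => by rw [hKk]; exact hk0 x hx
  have hLk : ∀ q ∈ I ×ˢ J, L q * k q = -(pd 1 k q + m q * pd 0 k q + 3 * pd 0 m q * k q) :=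
    fun q hq => by
    rw [hL, intrinsicL, metricGaussCurvature_semiGeodesicMetric, ← hk, div_mul_cancel₀ _ (hk0 q hq)]
  have hmL : ContDiffOn ℝ ∞ (fun q => L q + pd 0 m q) (I ×ˢ J) := hLs.add hm0
  have hc1 := contDiffOn_pd hD hcs 1
  have heL : EqOn e (fun q => pd 1 c q - c q * (L q + pd 0 m q)) (I ×ˢ J) := fun q hq => by
    have r1 : pd 1 r q = -(pd 1 c q * k q + c q * pd 1 k q) := by
      rw [pd_congr hD hrc 1 hq, pd_neg, pd_mul (dD hcs q hq) (dD hks q hq)]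
    have r0 : pd 0 r q = -(c q * pd 0 k q) := by
      rw [pd_congr hD hrc 0 hq, pd_neg, pd_mul (dD hcs q hq) (dD hks q hq), (hsplit q hq).1]
      ring
    have hkq := hk0 q hq
    simp only [he]
    rw [div_eq_iff hkq, r1, r0, hrc hq]
    linear_combination c q * hLk q hq
  have hL0 : ∀ q ∈ I ×ˢ J, pd 0 L q = 0 := fun q hq => by
    have e1 := (hsplit q hq).2
    have e2 : pd 0 (pd 1 c) q = 0 := by
      rw [pd_comm hD hcs hq, pd_congr hD (fun x hx => (hsplit x hx).1) 1 hq]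
      exact pd_const _ _
    rw [pd_congr hD heL 0 hq, pd_sub (dD hc1 q hq) (dD (hcs.mul hmL) q hq),
      pd_mul (dD hcs q hq) (dD hmL q hq), pd_add (dD hLs q hq) (dD hm0 q hq), (hsplit q hq).1, e2,
      hrc hq, ← hk] at e1
    have e3 : c q * pd 0 L q = 0 := by linear_combination -e1
    exact (mul_eq_zero.1 e3).resolve_left (hc0 q hq)
  -- functions of the second coordinate
  have fH : ∀ q ∈ I ×ˢ J, H (s₀, q.2) = H q := fun q hq => eq_of_pd_zero hI hJ hHs hH0 hs₀ hq.1 hq.2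
  have fH1 : ∀ q ∈ I ×ˢ J, pd 1 H (s₀, q.2) = pd 1 H q := fun q hq =>
    eq_of_pd_zero hI hJ hH1 hH10 hs₀ hq.1 hq.2
  have fc : ∀ q ∈ I ×ˢ J, c (s₀, q.2) = c q := fun q hq =>
    eq_of_pd_zero hI hJ hcs (fun x hx => (hsplit x hx).1) hs₀ hq.1 hq.2
  have hc10 : ∀ q ∈ I ×ˢ J, pd 0 (pd 1 c) q = 0 := fun q hq => by
    rw [pd_comm hD hcs hq, pd_congr hD (fun x hx => (hsplit x hx).1) 1 hq]
    exact pd_const _ _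
  have fc1 : ∀ q ∈ I ×ˢ J, pd 1 c (s₀, q.2) = pd 1 c q := fun q hq =>
    eq_of_pd_zero hI hJ hc1 hc10 hs₀ hq.1 hq.2
  have fL : ∀ q ∈ I ×ˢ J, L (s₀, q.2) = L q := fun q hq =>
    eq_of_pd_zero hI hJ hLs hL0 hs₀ hq.1 hq.2
  set α : ℝ → E42 := fun t => H (s₀, t) with hα
  set a : ℝ → ℝ := fun t => c (s₀, t) with ha
  have hα1 : EqOn (deriv α) (fun t => pd 1 H (s₀, t)) J := fun t ht => deriv_line hI hJ hHs hs₀ ht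
  have hα2 : ∀ t ∈ J, deriv (deriv α) t = pd 1 (pd 1 H) (s₀, t) := fun t ht => by
    rw [(Filter.eventuallyEq_of_mem (hJ.1.mem_nhds ht) hα1).deriv_eq]
    exact deriv_line hI hJ hH1 hs₀ ht
  have ha1 : ∀ t ∈ J, deriv a t = pd 1 c (s₀, t) := fun t ht => deriv_line hI hJ hcs hs₀ ht
  -- the curve `η`
  set B : ℝ × ℝ → ℝ := fun q => q.1 * pd 1 c q - c q * (m q + q.1 * L q) with hB
  have hfst : ContDiffOn ℝ ∞ (fun q : ℝ × ℝ => q.1) (I ×ˢ J) := contDiffOn_fst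
  have hfL : ContDiffOn ℝ ∞ (fun q : ℝ × ℝ => q.1 * L q) (I ×ˢ J) := hfst.mul hLs
  have hmfL : ContDiffOn ℝ ∞ (fun q : ℝ × ℝ => m q + q.1 * L q) (I ×ˢ J) := hms.add hfL
  have hfc1 : ContDiffOn ℝ ∞ (fun q : ℝ × ℝ => q.1 * pd 1 c q) (I ×ˢ J) := hfst.mul hc1
  have hcmL : ContDiffOn ℝ ∞ (fun q : ℝ × ℝ => c q * (m q + q.1 * L q)) (I ×ˢ J) := hcs.mul hmfL
  have hBs : ContDiffOn ℝ ∞ B (I ×ˢ J) := hfc1.sub hcmL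
  have hBH : ContDiffOn ℝ ∞ (fun q => B q • H q) (I ×ˢ J) := hBs.smul hHs
  have hfc : ContDiffOn ℝ ∞ (fun q : ℝ × ℝ => q.1 * c q) (I ×ˢ J) := hfst.mul hcs
  have hfcH : ContDiffOn ℝ ∞ (fun q : ℝ × ℝ => (q.1 * c q) • pd 1 H q) (I ×ˢ J) := hfc.smul hH1
  have hGB : ContDiffOn ℝ ∞ (fun q => G q - B q • H q) (I ×ˢ J) := hGs.sub hBH
  set E : ℝ × ℝ → E42 := fun q => G q - B q • H q - (q.1 * c q) • pd 1 H q with hE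
  have hEs : ContDiffOn ℝ ∞ E (I ×ˢ J) := hGB.sub hfcH
  have hE0 : ∀ q ∈ I ×ˢ J, pd 0 E q = 0 := fun q hq => by
    rw [hE, pd_sub (dD hGB q hq) (dD hfcH q hq), pd_sub (dD hGs q hq) (dD hBH q hq),
      pd_smul (dD hBs q hq) (dD hHs q hq), pd_smul (dD hfc q hq) (dD hH1 q hq), hB,
      pd_sub (dD hfc1 q hq) (dD hcmL q hq), pd_mul (dD hfst q hq) (dD hc1 q hq),
      pd_mul (dD hcs q hq) (dD hmfL q hq), pd_add (dD hms q hq) (dD hfL q hq),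
      pd_mul (dD hfst q hq) (dD hLs q hq), pd_mul (dD hfst q hq) (dD hcs q hq), hGce hq,
      pd_fst, if_pos rfl, hH0 q hq, hH10 q hq, hc10 q hq, hL0 q hq, (hsplit q hq).1]
    have e2 := heL hq
    beta_reduce at e2 ⊢
    rw [e2]
    module
  have fE : ∀ q ∈ I ×ˢ J, E (s₀, q.2) = E q := fun q hq => eq_of_pd_zero hI hJ hEs hE0 hs₀ hq.1 hq.2
  refine ⟨I, J, hI, hJ, rfl, m, fun t => L (s₀, t), a, α, fun t => E (s₀, t), hms,
    contDiffOn_line hcs hs₀, contDiffOn_line hHs hs₀, contDiffOn_line hEs hs₀, ?_, ?_, ?_, ?_⟩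
  · intro q hq
    exact ⟨by rw [hKk]; exact hk0 q hq, (fL q hq).symm⟩
  · intro t ht
    have hq : (s₀, t) ∈ I ×ˢ J := ⟨hs₀, ht⟩
    rw [hα2 t ht, hα1 ht, ha1 t ht, deriv_line hI hJ hEs hs₀ ht]
    simp only [hα, ha]
    have sHH : ∀ q ∈ I ×ˢ J, ip (H q) (H q) = 0 := fun q hq => (hLL q hq).2
    have sH1 : ∀ q ∈ I ×ˢ J, ip (H q) (pd 1 H q) = 0 := fun q hq => by
      have := pd_ip_of_const hD hHs hHs sHH hq 1
      rw [ip_comm (pd 1 H q)] at this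
      linarith
    have s0H1 : ∀ q ∈ I ×ˢ J, ip (pd 0 G q) (pd 1 H q) = 0 := fun q hq => by
      have e1 := pd_ip_of_const hD hHs hG0 (fun x hx => hn x hx 0) hq 1
      have e2 := h.ip_zero_zero
      rw [hG10 hq, ip_sub_right, ip_sub_right, ip_neg_right, ip_smul_right, ip_smul_right, sHH q hq,
        hn q hq 0, ip_comm] at e1
      linarith
    have s11 : ∀ q ∈ I ×ˢ J, ip (pd 1 H q) (pd 1 H q) = 0 := fun q hq => by
      have e1 := s0H1 q hq
      rw [hGce hq, ip_add_left, ip_smul_left, ip_smul_left, sH1 q hq, mul_zero, add_zero] at e1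
      exact (mul_eq_zero.1 e1).resolve_left (hc0 q hq)
    have sH2 : ∀ q ∈ I ×ˢ J, ip (H q) (pd 1 (pd 1 H) q) = 0 := fun q hq => by
      have := pd_ip_of_const hD hHs hH1 sH1 hq 1
      rw [s11 q hq] at this
      linarith
    have s12 : ∀ q ∈ I ×ˢ J, ip (pd 1 H q) (pd 1 (pd 1 H) q) = 0 := fun q hq => by
      have := pd_ip_of_const hD hH1 hH1 s11 hq 1
      rw [ip_comm (pd 1 (pd 1 H) q)] at this
      linarith
    have hG1H : ip (pd 1 G (s₀, t)) (H (s₀, t)) = 0 := by rw [ip_comm]; exact hn _ hq 1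
    have hcq := hc0 _ hq
    have hG1H1 : c (s₀, t) * ip (pd 1 G (s₀, t)) (pd 1 H (s₀, t)) = -1 := by
      have e1 := hrk _ hq
      rw [hrc hq, ip_comm] at e1
      have e2 : k (s₀, t) * (c (s₀, t) * ip (pd 1 G (s₀, t)) (pd 1 H (s₀, t)))
          = k (s₀, t) * (-1) := by linear_combination -e1
      exact mul_left_cancel₀ (hk0 _ hq) e2
    have hli : LinearIndependent ℝ ![H (s₀, t), pd 1 H (s₀, t)] := by
      rw [LinearIndependent.pair_iff]
      intro x y hxy
      have e1 := congrArg (fun z => ip z (pd 1 G (s₀, t))) hxy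
      simp only [ip_add_left, ip_smul_left, hn _ hq 1, ip_zero_left, mul_zero, zero_add] at e1
      have hy := (mul_eq_zero.1 e1).resolve_right (hi0 _ hq)
      rw [hy, zero_smul, add_zero] at hxy
      exact ⟨(smul_eq_zero.1 hxy).resolve_right (hLL _ hq).1, hy⟩
    have s22 : ip (pd 1 (pd 1 H) (s₀, t)) (pd 1 (pd 1 H) (s₀, t)) = 0 := by
      obtain ⟨x, y, hxy⟩ := exists_eq_smul_add_smul hli (sHH _ hq) (sH1 _ hq) (s11 _ hq)
        (by rw [ip_comm]; exact sH2 _ hq) (by rw [ip_comm]; exact s12 _ hq)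
      nth_rewrite 1 [hxy]
      rw [ip_add_left, ip_smul_left, ip_smul_left, sH2 _ hq, s12 _ hq]
      ring
    -- `⟨∂₁∂₀G, ∂₁G⟩ = ∂₀m`, computed in two ways
    have hG1H2 : c (s₀, t) ^ 2 * ip (pd 1 G (s₀, t)) (pd 1 (pd 1 H) (s₀, t))
        = 2 * pd 1 c (s₀, t) - c (s₀, t) * L (s₀, t) := by
      have e1 : ip (pd 1 (pd 0 G) (s₀, t)) (pd 1 G (s₀, t)) = pd 0 m (s₀, t) := by
        rw [hG10 hq]
        simp only [ip_sub_left, ip_neg_left, ip_smul_left, hn _ hq 1, h.ip_zero_one _ hq]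
        ring
      rw [pd_congr hD hGce 1 hq, pd_add (dD hcH _ hq) (dD heH _ hq),
        pd_smul (dD hcs _ hq) (dD hH1 _ hq), pd_smul (dD hes _ hq) (dD hHs _ hq), heL hq] at e1
      simp only [ip_add_left, ip_smul_left, hn _ hq 1, ip_comm (pd 1 H (s₀, t)),
        ip_comm (pd 1 (pd 1 H) (s₀, t))] at e1
      linear_combination c (s₀, t) * e1
        - (2 * pd 1 c (s₀, t) - c (s₀, t) * (L (s₀, t) + pd 0 m (s₀, t))) * hG1H1
    have hE1 : pd 1 E (s₀, t) = pd 1 G (s₀, t) - pd 1 B (s₀, t) • H (s₀, t)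
        - (B (s₀, t) + s₀ * pd 1 c (s₀, t)) • pd 1 H (s₀, t)
        - (s₀ * c (s₀, t)) • pd 1 (pd 1 H) (s₀, t) := by
      rw [hE, pd_sub (dD hGB _ hq) (dD hfcH _ hq), pd_sub (dD hGs _ hq) (dD hBH _ hq),
        pd_smul (dD hBs _ hq) (dD hHs _ hq), pd_smul (dD hfc _ hq) (dD hH1 _ hq),
        pd_mul (dD hfst _ hq) (dD hcs _ hq), pd_fst]
      simp only [one_ne_zero, if_false, zero_mul, zero_add]
      module
    have s1H := sH1 _ hq
    have s2H := sH2 _ hq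
    have s21 := s12 _ hq
    rw [ip_comm] at s1H s2H s21
    have hHG1 := hn _ hq 1
    have hG1H1' : ip (pd 1 H (s₀, t)) (pd 1 G (s₀, t)) = -(1 / c (s₀, t)) := by
      rw [ip_comm]; field_simp; linear_combination hG1H1
    have hG1H1'' : ip (pd 1 G (s₀, t)) (pd 1 H (s₀, t)) = -(1 / c (s₀, t)) := by
      rw [ip_comm]; exact hG1H1'
    have hG1H2' : ip (pd 1 G (s₀, t)) (pd 1 (pd 1 H) (s₀, t))
        = (2 * pd 1 c (s₀, t) - c (s₀, t) * L (s₀, t)) / c (s₀, t) ^ 2 := by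
      rw [← hG1H2]; field_simp
    have hG1H2'' : ip (pd 1 (pd 1 H) (s₀, t)) (pd 1 G (s₀, t))
        = (2 * pd 1 c (s₀, t) - c (s₀, t) * L (s₀, t)) / c (s₀, t) ^ 2 := by
      rw [ip_comm]; exact hG1H2'
    have hmm : ip (pd 1 G (s₀, t)) (pd 1 G (s₀, t)) = 2 * m (s₀, t) := by simp only [hm]; ring
    refine ⟨hcq, sHH _ hq, ⟨fun h0 => hi0 _ hq (by rw [h0, ip_zero_left]), s11 _ hq⟩, hli, ?_, ?_, ?_,
      ?_⟩
    · rw [hE1]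
      simp only [ip_sub_left, ip_sub_right, ip_smul_left, ip_smul_right, sHH _ hq, sH1 _ hq, s11 _ hq,
        sH2 _ hq, s12 _ hq, s22, s1H, s2H, s21, hG1H, hHG1, hG1H1', hG1H1'', hG1H2', hG1H2'', hmm,
        hB]
      field_simp
      ring
    · rw [hE1]
      simp only [ip_sub_right, ip_smul_right, sHH _ hq, sH1 _ hq, sH2 _ hq, hHG1]
      ring
    · rw [hE1]
      simp only [ip_sub_left, ip_smul_left, sH1 _ hq, s11 _ hq, s21, hG1H1'']
      ring
    · rw [hE1]
      simp only [ip_sub_left, ip_smul_left, sH2 _ hq, s12 _ hq, s22, hG1H2']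
      ring
  · intro q hq
    beta_reduce
    rw [fE q hq, hα1 hq.2, ha1 q.2 hq.2]
    simp only [hα, ha]
    rw [fH q hq, fc q hq, fH1 q hq, fc1 q hq, fL q hq]
    simp only [hE, hB]
    abel
  · intro q hq
    have e1 := hH q hq
    exact fun h0 => (hLL q hq).1 (by rw [hHdef, e1, h0, neg_zero])

end IsAdapted

end QuasiMinimal
end

noncomputable section
namespace QuasiMinimal
open Set

/-! ### The local classification -/

section Classification

variable {I J : Set ℝ} {F : ℝ × ℝ → E42} {q₀ : ℝ × ℝ}

lemma IsNullParametrized.coordCongruent_of_ne (h : IsNullParametrized I J F) (hq₀ : q₀ ∈ I ×ˢ J)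
    (h1 : ∃ q ∈ I ×ˢ J, ip (meanCurvature F q) (pd 1 (pd 1 F) q) ≠ 0) :
    ((∀ q ∈ I ×ˢ J, metricGaussCurvature (inducedMetric F) q = 0) →
      CoordCongruent IsRuledType (I ×ˢ J) F q₀) ∧
    ((∀ q ∈ I ×ˢ J, metricGaussCurvature (inducedMetric F) q ≠ 0) →
      CoordCongruent IsNonFlatType (I ×ˢ J) F q₀) := by
  obtain ⟨q₁, hq₁, h1⟩ := h1
  obtain ⟨ψ, hψd, hψq, hψs, I', J', hψt, hG, hflat⟩ :=
    h.exists_adapted (h.pd_meanCurvature_eq_zero hq₁ h1) hq₀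
  have hx₀ : ψ q₀ ∈ I' ×ˢ J' := by rw [← hψt]; exact ψ.map_source hψq
  refine ⟨fun hK => CoordCongruent.of_diffeo hψd hψq hψs ?_,
    fun hK => CoordCongruent.of_diffeo hψd hψq hψs ?_⟩
  · have hf := hflat fun q hq =>
      ⟨h.pd_zero_normalized_eq_zero hq₁ h1 hK hq, h.pd_logDeriv_eq_zero hK hq⟩
    have hR := hG.isRuledType ⟨_, hx₀.1⟩ (fun x hx => (hf x hx).1) fun x hx => (hf x hx).2
    rw [hψt]
    refine CoordCongruent.of_swap hG.isOpen hx₀ ?_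
    rw [show Prod.swap ⁻¹' (I' ×ˢ J') = J' ×ˢ I' from Set.preimage_swap_prod _ _]
    exact CoordCongruent.refl (hG.isOpenInterval_snd.1.prod hG.isOpenInterval_fst.1) hR
      ⟨hx₀.2, hx₀.1⟩
  · rw [hψt]
    refine CoordCongruent.refl hG.isOpen (hG.isNonFlatType ⟨_, hx₀.1⟩ fun x hx => ?_) hx₀
    rw [← hψt] at hx
    rw [h.surface.metricGaussCurvature_symm_diffeo hψd hψs hx]
    exact hK _ (hψs (ψ.map_target hx))

/-- The alternative: `⟨H, ∂₁∂₁F⟩` or `⟨H, ∂₀∂₀F⟩` is not identically zero, and these cases are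
interchanged by the interchange of the coordinates, or both vanish. -/
lemma IsNullParametrized.coordCongruent (h : IsNullParametrized I J F) (hq₀ : q₀ ∈ I ×ˢ J) :
    ((∀ q ∈ I ×ˢ J, metricGaussCurvature (inducedMetric F) q = 0) →
      CoordCongruent IsGraphType (I ×ˢ J) F q₀ ∨ CoordCongruent IsRuledType (I ×ˢ J) F q₀) ∧
    ((∀ q ∈ I ×ˢ J, metricGaussCurvature (inducedMetric F) q ≠ 0) →
      CoordCongruent IsNonFlatType (I ×ˢ J) F q₀) := by
  by_cases h1 : ∃ q ∈ I ×ˢ J, ip (meanCurvature F q) (pd 1 (pd 1 F) q) ≠ 0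
  · have := h.coordCongruent_of_ne hq₀ h1
    exact ⟨fun hK => Or.inr (this.1 hK), this.2⟩
  by_cases h2 : ∃ q ∈ I ×ˢ J, ip (meanCurvature F q) (pd 0 (pd 0 F) q) ≠ 0
  · obtain ⟨q₁, hq₁, h2⟩ := h2
    have hc : IsCoordChange (J ×ˢ I) (I ×ˢ J) (fun x => x.2) (fun x => x.1) :=
      ⟨h.isOpenInterval_snd.1.prod h.isOpenInterval_fst.1, h.isOpen, contDiffOn_snd, contDiffOn_fst,
        fun x hx => ⟨hx.2, hx.1⟩, fun x _ => by simp [pd_fst, pd_snd]⟩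
    have hs : ∀ q ∈ I ×ˢ J, q.swap ∈ J ×ˢ I := fun q hq => ⟨hq.2, hq.1⟩
    have h3 : ∃ q ∈ J ×ˢ I, ip (meanCurvature (fun x => F x.swap) q)
        (pd 1 (pd 1 fun x => F x.swap) q) ≠ 0 := by
      refine ⟨q₁.swap, hs q₁ hq₁, ?_⟩
      have e1 : meanCurvature (fun x => F x.swap) q₁.swap = meanCurvature F q₁ :=
        hc.meanCurvature_comp h.surface.smooth (hs q₁ hq₁) (h.surface.det_ne_zero q₁ hq₁)
      have e2 := hc.pd_pd_comp_eq h.surface.smooth (hs q₁ hq₁) 1 1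
      have e3 : pd 1 (pd 1 fun x => F x.swap) q₁.swap = pd 0 (pd 0 F) q₁ := by
        refine Eq.trans e2 ?_
        have f1 : ∀ j, pd j (fun x : ℝ × ℝ => x.1) = fun _ => if j = 0 then 1 else 0 := fun j =>
          funext fun x => pd_fst j
        have f2 : ∀ j, pd j (fun x : ℝ × ℝ => x.2) = fun _ => if j = 0 then 0 else 1 := fun j =>
          funext fun x => pd_snd j
        simp [f1, f2, pd_const]
      rw [e1, e3]
      exact h2
    have hK : ∀ q ∈ J ×ˢ I, metricGaussCurvature (inducedMetric fun x => F x.swap) q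
        = metricGaussCurvature (inducedMetric F) q.swap := fun q hq =>
      hc.metricGaussCurvature_comp h.surface.smooth h.surface.det_ne_zero hq
    have := h.swap.coordCongruent_of_ne (hs q₀ hq₀) h3
    have hpre : Prod.swap ⁻¹' (I ×ˢ J) = J ×ˢ I := Set.preimage_swap_prod _ _
    refine ⟨fun h0 => Or.inr (CoordCongruent.of_swap h.isOpen hq₀ ?_),
      fun h0 => CoordCongruent.of_swap h.isOpen hq₀ ?_⟩
    · rw [hpre]
      exact this.1 fun q hq => by rw [hK q hq]; exact h0 _ ⟨hq.2, hq.1⟩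
    · rw [hpre]
      exact this.2 fun q hq => by rw [hK q hq]; exact h0 _ ⟨hq.2, hq.1⟩
  · push Not at h1 h2
    have hgraph := h.coordCongruent_isGraphType
      (fun q hq i => by fin_cases i; exacts [h2 q hq, h1 q hq]) hq₀
    refine ⟨fun _ => Or.inl hgraph, fun hK => ?_⟩
    -- a surface of the graph type is flat
    obtain ⟨φ, hφ, hφq, hφs, T, hT, G, hG, hTG⟩ := hgraph
    have hx := φ.map_source hφq
    have e1 := (isQMBiharmonicOn_of_isGraphType hG).2 _ hx
    rw [← metricGaussCurvature_congr φ.open_target (inducedMetric_congr φ.open_target hTG) hx,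
      inducedMetric_isometry hT, h.surface.metricGaussCurvature_symm_diffeo hφ hφs hx,
      φ.left_inv hφq] at e1
    exact absurd e1 (hK q₀ hq₀)

lemma IsQMBiharmonicOn.coordCongruent {Ω : Set (ℝ × ℝ)} (h : IsQMBiharmonicOn Ω F)
    (hq₀ : q₀ ∈ Ω) :
    ((∀ q ∈ Ω, metricGaussCurvature (inducedMetric F) q = 0) →
      CoordCongruent IsGraphType Ω F q₀ ∨ CoordCongruent IsRuledType Ω F q₀) ∧
    ((∀ q ∈ Ω, metricGaussCurvature (inducedMetric F) q ≠ 0) →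
      CoordCongruent IsNonFlatType Ω F q₀) := by
  obtain ⟨φ, hφ, hφq, hφs, hnull⟩ := h.exists_null_coordinates hq₀
  obtain ⟨ψ, hψ, hψq, hψs, hψe, hψe', I, J, hI, hJ, hψt⟩ := exists_restr_box hφ hφq
  have hs : ψ.source ⊆ Ω := hψs.trans hφs
  have htar : ∀ x ∈ ψ.target, x ∈ φ.target := fun x hx => by
    have := φ.map_source (hψs (ψ.map_target hx))
    rwa [← hψe, ψ.right_inv hx] at this
  have hG := h.symm_diffeo hψ hs
  have hN : IsNullParametrized I J (fun x => F (ψ.symm x)) := by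
    refine ⟨hI, hJ, by rw [← hψt]; exact hG, fun q hq i => ?_⟩
    rw [← hψt] at hq
    have := hnull q (htar q hq)
    rw [hψe']
    fin_cases i
    exacts [this.1, this.2]
  have hx₀ : ψ q₀ ∈ I ×ˢ J := by rw [← hψt]; exact ψ.map_source hψq
  have hK : ∀ x ∈ I ×ˢ J, metricGaussCurvature (inducedMetric fun x => F (ψ.symm x)) x
      = metricGaussCurvature (inducedMetric F) (ψ.symm x) ∧ ψ.symm x ∈ Ω := fun x hx => by
    rw [← hψt] at hx
    exact ⟨h.metricGaussCurvature_symm_diffeo hψ hs hx, hs (ψ.map_target hx)⟩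
  obtain ⟨c1, c2⟩ := hN.coordCongruent hx₀
  rw [← hψt] at c1 c2
  refine ⟨fun h0 => ?_, fun h0 => ?_⟩
  · rcases c1 fun x hx => by rw [hψt] at hx; rw [(hK x hx).1]; exact h0 _ (hK x hx).2 with c | c
    · exact Or.inl (c.of_diffeo hψ hψq hs)
    · exact Or.inr (c.of_diffeo hψ hψq hs)
  · exact (c2 fun x hx => by
      rw [hψt] at hx; rw [(hK x hx).1]; exact h0 _ (hK x hx).2).of_diffeo hψ hψq hs

end Classification

end QuasiMinimal
end

noncomputable section
namespace QuasiMinimal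
open Set Topology

/-! ### Coordinate systems of a surface -/

section Charts

variable {M : Type*} [TopologicalSpace M] [ChartedSpace (ℝ × ℝ) M]
  {f : M → E42} {p : M} {e e' : OpenPartialHomeomorph M (ℝ × ℝ)}

lemma contDiffOn_comp_symm (hf : ContMDiff 𝓘(ℝ, ℝ × ℝ) 𝓘(ℝ, E42) ∞ f) (he : e ∈ coordSystems M) :
    ContDiffOn ℝ ∞ (f ∘ e.symm) e.target :=
  contMDiffOn_iff_contDiffOn.1 (hf.comp_contMDiffOn (contMDiffOn_symm_of_mem_maximalAtlas he))

lemma isQMBiharmonicOn_of_isSurface (h1 : IsSurface f) (h2 : IsQuasiMinimal f)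
    (h3 : IsBiharmonic f) (he : e ∈ coordSystems M) : IsQMBiharmonicOn e.target (f ∘ e.symm) :=
  ⟨e.open_target, contDiffOn_comp_symm h1.1 he, h1.2 e he, h2 e he, h3 e he⟩

variable [IsManifold 𝓘(ℝ, ℝ × ℝ) ∞ M]

lemma trans_mem_coordSystems (he : e ∈ coordSystems M)
    {φ : OpenPartialHomeomorph (ℝ × ℝ) (ℝ × ℝ)} (hφ : IsDiffeo φ) :
    e.trans φ ∈ coordSystems M := by
  refine OpenPartialHomeomorph.mem_maximalAtlas_of_contMDiffOn _ ?_ ?_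
  · exact (contMDiffOn_iff_contDiffOn.2 hφ.1).comp
      ((contMDiffOn_of_mem_maximalAtlas he).mono (by simp)) fun x hx => by simpa using hx.2
  · exact (contMDiffOn_symm_of_mem_maximalAtlas he).comp
      ((contMDiffOn_iff_contDiffOn.2 hφ.2).mono (by simp)) fun x hx => by simpa using hx.2

omit [IsManifold 𝓘(ℝ, ℝ × ℝ) ∞ M] in
lemma isDiffeo_transition (he : e ∈ coordSystems M) (he' : e' ∈ coordSystems M) :
    IsDiffeo (e.symm.trans e') := by
  constructor
  · exact contMDiffOn_iff_contDiffOn.1 ((contMDiffOn_of_mem_maximalAtlas he').comp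
      ((contMDiffOn_symm_of_mem_maximalAtlas he).mono (by simp)) fun x hx => by simpa using hx.2)
  · exact contMDiffOn_iff_contDiffOn.1 ((contMDiffOn_of_mem_maximalAtlas he).comp
      ((contMDiffOn_symm_of_mem_maximalAtlas he').mono (by simp)) fun x hx => by simpa using hx.2)

omit [ChartedSpace (ℝ × ℝ) M] [IsManifold 𝓘(ℝ, ℝ × ℝ) ∞ M] in
lemma eqOn_transition (f : M → E42) (e e' : OpenPartialHomeomorph M (ℝ × ℝ)) :
    EqOn (f ∘ e.symm) (fun x => (f ∘ e'.symm) ((e.symm.trans e') x)) (e.symm.trans e').source := by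
  intro x hx
  have : e.symm x ∈ e'.source := by simpa using hx.2
  simp [e'.left_inv this]

omit [IsManifold 𝓘(ℝ, ℝ × ℝ) ∞ M] in
lemma isQMBiharmonicOn_transition (he : e ∈ coordSystems M) (he' : e' ∈ coordSystems M)
    (h : IsQMBiharmonicOn e'.target (f ∘ e'.symm)) :
    IsQMBiharmonicOn (e.symm.trans e').source (f ∘ e.symm) := by
  have hφ := isDiffeo_transition he he'
  have hs : (e.symm.trans e').target ⊆ e'.target := by simp
  exact ((h.mono (e.symm.trans e').open_target hs).comp hφ.isCoordChange).congr
    (eqOn_transition f e e')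

omit [IsManifold 𝓘(ℝ, ℝ × ℝ) ∞ M] in
lemma metricGaussCurvature_transition (he : e ∈ coordSystems M) (he' : e' ∈ coordSystems M)
    (h : IsQMBiharmonicOn e'.target (f ∘ e'.symm)) (hp : p ∈ e.source) (hp' : p ∈ e'.source) :
    metricGaussCurvature (inducedMetric (f ∘ e.symm)) (e p)
      = metricGaussCurvature (inducedMetric (f ∘ e'.symm)) (e' p) := by
  have hφ := isDiffeo_transition he he'
  set φ := e.symm.trans e' with hφd
  have hs : φ.target ⊆ e'.target := by simp [hφd]
  have hx : e p ∈ φ.source := by simp [hφd, hp, hp']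
  have h' := h.mono φ.open_target hs
  rw [metricGaussCurvature_congr φ.open_source
    (inducedMetric_congr φ.open_source (eqOn_transition f e e')) hx]
  have := hφ.isCoordChange.metricGaussCurvature_comp h'.smooth h'.det_ne_zero hx
  have hφe : φ (e p) = e' p := by simp [hφd, hp]
  refine this.trans ?_
  change metricGaussCurvature _ (φ (e p)) = _
  rw [hφe]

lemma gaussCurvature_eq (hall : ∀ e ∈ coordSystems M, IsQMBiharmonicOn e.target (f ∘ e.symm))
    (he : e ∈ coordSystems M) (hp : p ∈ e.source) :
    gaussCurvature f p = metricGaussCurvature (inducedMetric (f ∘ e.symm)) (e p) :=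
  metricGaussCurvature_transition (IsManifold.chart_mem_maximalAtlas p) he (hall e he)
    (mem_chart_source (ℝ × ℝ) p) hp

lemma continuous_gaussCurvature
    (hall : ∀ e ∈ coordSystems M, IsQMBiharmonicOn e.target (f ∘ e.symm)) :
    Continuous (gaussCurvature f) := by
  rw [continuous_iff_continuousAt]
  intro p
  have he : chartAt (ℝ × ℝ) p ∈ coordSystems M := IsManifold.chart_mem_maximalAtlas p
  set e := chartAt (ℝ × ℝ) p with hedef
  have hp : p ∈ e.source := mem_chart_source (ℝ × ℝ) p
  have h1 : ContinuousAt (fun x => metricGaussCurvature (inducedMetric (f ∘ e.symm)) (e x)) p :=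
    ContinuousAt.comp (f := e)
      ((hall e he).continuousOn_metricGaussCurvature.continuousAt
        (e.open_target.mem_nhds (e.map_source hp))) (e.continuousAt hp)
  refine h1.congr ?_
  filter_upwards [e.open_source.mem_nhds hp] with x hx
  exact (gaussCurvature_eq hall he hx).symm

lemma CoordCongruent.locallyCongruent {P : Set (ℝ × ℝ) → (ℝ × ℝ → E42) → Prop}
    (he : e ∈ coordSystems M) (hp : p ∈ e.source)
    (h : CoordCongruent P e.target (f ∘ e.symm) (e p)) : LocallyCongruent P f p := by
  obtain ⟨φ, hφ, hφp, hφs, T, hT, G, hG, hTG⟩ := h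
  have ht : (e.trans φ).target = φ.target := by
    rw [OpenPartialHomeomorph.trans_target]
    exact inter_eq_left.2 fun x hx => hφs (φ.map_target hx)
  refine ⟨e.trans φ, trans_mem_coordSystems he hφ, ?_, T, hT, G, by rwa [ht], fun x hx => ?_⟩
  · rw [OpenPartialHomeomorph.trans_source]; exact ⟨hp, hφp⟩
  · exact hTG x (ht ▸ hx)

omit [IsManifold 𝓘(ℝ, ℝ × ℝ) ∞ M] in
/-- If every member of the family `P` is quasi-minimal and biharmonic with curvature satisfying `Q`,
then so is a surface locally congruent to one, in the coordinates that realize the congruence. -/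
lemma LocallyCongruent.exists_isQMBiharmonicOn {P : Set (ℝ × ℝ) → (ℝ × ℝ → E42) → Prop}
    {Q : ℝ → Prop}
    (hP : ∀ D F, P D F → IsQMBiharmonicOn D F ∧
      ∀ q ∈ D, Q (metricGaussCurvature (inducedMetric F) q))
    (h : LocallyCongruent P f p) :
    ∃ e ∈ coordSystems M, p ∈ e.source ∧ IsQMBiharmonicOn e.target (f ∘ e.symm) ∧
      ∀ q ∈ e.target, Q (metricGaussCurvature (inducedMetric (f ∘ e.symm)) q) := by
  obtain ⟨e, he, hp, T, hT, F, hF, hTF⟩ := h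
  obtain ⟨h1, h2⟩ := hP _ _ hF
  have hfe : EqOn (f ∘ e.symm) (fun q => T.symm (F q)) e.target := fun q hq => by
    beta_reduce
    rw [← hTF q hq]; simp
  refine ⟨e, he, hp, (h1.isometry (isIsometry_symm hT)).congr hfe, fun q hq => ?_⟩
  rw [metricGaussCurvature_congr e.open_target (inducedMetric_congr e.open_target hfe) hq,
    inducedMetric_isometry (isIsometry_symm hT)]
  exact h2 q hq

end Charts

end QuasiMinimal
end

open QuasiMinimal Set in
theorem mainTheorem3 {M : Type*} [TopologicalSpace M] [ChartedSpace (ℝ × ℝ) M]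
    [IsManifold 𝓘(ℝ, ℝ × ℝ) ∞ M] (f : M → QuasiMinimal.E42) :
    ((QuasiMinimal.IsSurface f ∧ QuasiMinimal.IsQuasiMinimal f ∧ QuasiMinimal.IsBiharmonic f ∧
        frontier {p : M | QuasiMinimal.gaussCurvature f p = 0} = ∅) ↔
      ∀ p : M,
        QuasiMinimal.LocallyCongruent QuasiMinimal.IsGraphType f p ∨
        QuasiMinimal.LocallyCongruent QuasiMinimal.IsRuledType f p ∨
        QuasiMinimal.LocallyCongruent QuasiMinimal.IsNonFlatType f p) ∧
    (QuasiMinimal.IsSurface f → QuasiMinimal.IsQuasiMinimal f → QuasiMinimal.IsBiharmonic f →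
      Dense (frontier {p : M | QuasiMinimal.gaussCurvature f p = 0})ᶜ ∧
      ∀ p : M, p ∉ frontier {p : M | QuasiMinimal.gaussCurvature f p = 0} →
        (QuasiMinimal.gaussCurvature f p = 0 →
          QuasiMinimal.LocallyCongruent QuasiMinimal.IsGraphType f p ∨
          QuasiMinimal.LocallyCongruent QuasiMinimal.IsRuledType f p) ∧
        (QuasiMinimal.gaussCurvature f p ≠ 0 →
          QuasiMinimal.LocallyCongruent QuasiMinimal.IsNonFlatType f p)) := by
  have hB : IsSurface f → IsQuasiMinimal f → IsBiharmonic f →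
      Dense (frontier {p : M | gaussCurvature f p = 0})ᶜ ∧
      ∀ p : M, p ∉ frontier {p : M | gaussCurvature f p = 0} →
        (gaussCurvature f p = 0 →
          LocallyCongruent IsGraphType f p ∨ LocallyCongruent IsRuledType f p) ∧
        (gaussCurvature f p ≠ 0 → LocallyCongruent IsNonFlatType f p) := by
    intro h1 h2 h3
    have hall : ∀ e ∈ coordSystems M, IsQMBiharmonicOn e.target (f ∘ e.symm) := fun e he =>
      isQMBiharmonicOn_of_isSurface h1 h2 h3 he
    have hcont := continuous_gaussCurvature hall
    have hclosed : IsClosed {p : M | gaussCurvature f p = 0} := isClosed_eq hcont continuous_const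
    refine ⟨interior_eq_empty_iff_dense_compl.1 (interior_frontier hclosed), fun p hpf => ?_⟩
    have he : chartAt (ℝ × ℝ) p ∈ coordSystems M := IsManifold.chart_mem_maximalAtlas p
    set e := chartAt (ℝ × ℝ) p with hedef
    have hp : p ∈ e.source := mem_chart_source (ℝ × ℝ) p
    -- restriction of the chart to an open set of points
    have hU : ∀ U : Set M, IsOpen U → p ∈ U →
        e p ∈ e.target ∩ e.symm ⁻¹' U ∧
        IsQMBiharmonicOn (e.target ∩ e.symm ⁻¹' U) (f ∘ e.symm) ∧
        ∀ q ∈ e.target ∩ e.symm ⁻¹' U, ∃ p' ∈ U,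
          metricGaussCurvature (inducedMetric (f ∘ e.symm)) q = gaussCurvature f p' := by
      intro U hU hpU
      refine ⟨⟨e.map_source hp, by simpa [hp] using hpU⟩,
        (hall e he).mono (e.isOpen_inter_preimage_symm hU) inter_subset_left, fun q hq => ?_⟩
      refine ⟨e.symm q, hq.2, ?_⟩
      rw [gaussCurvature_eq hall he (e.map_target hq.1), e.right_inv hq.1]
    constructor
    · intro h0
      have hint : p ∈ interior {p : M | gaussCurvature f p = 0} := by
        by_contra hn
        exact hpf ⟨subset_closure h0, hn⟩
      obtain ⟨hpU, hQ, hK⟩ := hU _ isOpen_interior hint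
      have := (hQ.coordCongruent hpU).1 fun q hq => by
        obtain ⟨p', hp', hKp⟩ := hK q hq
        rw [hKp]
        have hp0 : p' ∈ {p : M | gaussCurvature f p = 0} := interior_subset hp'
        exact hp0
      exact this.imp (fun c => (c.mono inter_subset_left).locallyCongruent he hp)
        fun c => (c.mono inter_subset_left).locallyCongruent he hp
    · intro h0
      obtain ⟨hpU, hQ, hK⟩ := hU _ hclosed.isOpen_compl h0
      have := (hQ.coordCongruent hpU).2 fun q hq => by
        obtain ⟨p', hp', hKp⟩ := hK q hq
        rw [hKp]
        exact hp'
      exact (this.mono inter_subset_left).locallyCongruent he hp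
  refine ⟨⟨?_, fun h => ?_⟩, hB⟩
  · rintro ⟨h1, h2, h3, h4⟩ p
    obtain ⟨-, h5⟩ := hB h1 h2 h3
    obtain ⟨h6, h7⟩ := h5 p (by rw [h4]; exact notMem_empty p)
    by_cases h0 : gaussCurvature f p = 0
    · exact (h6 h0).imp_right Or.inl
    · exact Or.inr (Or.inr (h7 h0))
  · -- good coordinates around each point, with `K ≡ 0` or `K ≠ 0` on the whole domain
    have hloc : ∀ p, ∃ e ∈ coordSystems M, p ∈ e.source ∧ IsQMBiharmonicOn e.target (f ∘ e.symm) ∧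
        ((∀ q ∈ e.target, metricGaussCurvature (inducedMetric (f ∘ e.symm)) q = 0) ∨
          ∀ q ∈ e.target, metricGaussCurvature (inducedMetric (f ∘ e.symm)) q ≠ 0) := by
      intro p
      rcases h p with c | c | c
      · obtain ⟨e, he, hp, hQ, hK⟩ := c.exists_isQMBiharmonicOn (Q := (· = 0))
          fun D F hF => isQMBiharmonicOn_of_isGraphType hF
        exact ⟨e, he, hp, hQ, Or.inl hK⟩
      · obtain ⟨e, he, hp, hQ, hK⟩ := c.exists_isQMBiharmonicOn (Q := (· = 0))
          fun D F hF => isQMBiharmonicOn_of_isRuledType hF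
        exact ⟨e, he, hp, hQ, Or.inl hK⟩
      · obtain ⟨e, he, hp, hQ, hK⟩ := c.exists_isQMBiharmonicOn (Q := (· ≠ 0))
          fun D F hF => isQMBiharmonicOn_of_isNonFlatType hF
        exact ⟨e, he, hp, hQ, Or.inr hK⟩
    have hsmooth : ContMDiff 𝓘(ℝ, ℝ × ℝ) 𝓘(ℝ, E42) ∞ f := by
      intro p
      obtain ⟨e, he, hp, hQ, -⟩ := hloc p
      have h1 : ContMDiffAt 𝓘(ℝ, ℝ × ℝ) 𝓘(ℝ, E42) ∞ (fun x => (f ∘ e.symm) (e x)) p :=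
        ContMDiffAt.comp (g := f ∘ e.symm) (f := e) p ((contMDiffOn_iff_contDiffOn.2 hQ.smooth).contMDiffAt
          (e.open_target.mem_nhds (e.map_source hp))) (contMDiffAt_of_mem_maximalAtlas he hp)
      refine h1.congr_of_eventuallyEq ?_
      filter_upwards [e.open_source.mem_nhds hp] with x hx
      simp [e.left_inv hx]
    have hpt : ∀ e ∈ coordSystems M, ∀ q ∈ e.target,
        ∃ Ω : Set (ℝ × ℝ), q ∈ Ω ∧ IsQMBiharmonicOn Ω (f ∘ e.symm) := by
      intro e he q hq
      obtain ⟨e', he', hp, hQ, -⟩ := hloc (e.symm q)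
      exact ⟨_, by simp [hq, hp], isQMBiharmonicOn_transition he he' hQ⟩
    have h1 : IsSurface f := ⟨hsmooth, fun e he q hq => by
      obtain ⟨Ω, hqΩ, hQ⟩ := hpt e he q hq
      exact hQ.det_ne_zero q hqΩ⟩
    have h2 : IsQuasiMinimal f := fun e he q hq => by
      obtain ⟨Ω, hqΩ, hQ⟩ := hpt e he q hq
      exact hQ.isLightLike q hqΩ
    have h3 : IsBiharmonic f := fun e he q hq => by
      obtain ⟨Ω, hqΩ, hQ⟩ := hpt e he q hq
      exact hQ.bitension_eq_zero q hqΩ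
    have hall : ∀ e ∈ coordSystems M, IsQMBiharmonicOn e.target (f ∘ e.symm) := fun e he =>
      isQMBiharmonicOn_of_isSurface h1 h2 h3 he
    refine ⟨h1, h2, h3, isClopen_iff_frontier_eq_empty.1
      ⟨isClosed_eq (continuous_gaussCurvature hall) continuous_const, isOpen_iff_mem_nhds.2 ?_⟩⟩
    intro p hp0
    obtain ⟨e, he, hp, hQ, hK⟩ := hloc p
    have hp0' : gaussCurvature f p = 0 := hp0
    rcases hK with hK | hK
    · filter_upwards [e.open_source.mem_nhds hp] with x hx
      exact (gaussCurvature_eq hall he hx).trans (hK _ (e.map_source hx))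
    · rw [gaussCurvature_eq hall he hp] at hp0'
      exact absurd hp0' (hK _ (e.map_source hp))
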